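/- Let $G=(V,E)$ be a finite simple undirected graph with $n=|V|$, and let $(c,w)\in\mathbb{Q}^{V}\times\mathbb{Q}^{E}$ be a rational point satisfying the basic inequalities of the Total Matching Polytope: $$c_v+\sum_{e\in\delta(v)}w_e\le 1\ \ (v\in V),\qquad c_u+c_v+w_{uv}\le 1\ \ (uv\in E),\qquad c_v\ge 0\ (v\in V),\quad w_e\ge 0\ (e\in E).$$ For a cycle $C$ of $G$ of length $k$ with $k\equiv 1$ or $k\equiv 2 \pmod 3$, the congruent-$2k3$ cycle inequality of $C$ is $$\sum_{v\in V(C)}x_v+\sum_{e\in E(C)}y_e\le\left\lfloor\frac{2k}{3}\right\rfloor .$$ The separation problem for these inequalities is: given $G$ and $(c,w)$ as above, either return a cycle whose congruent-$2k3$ cycle inequality is violated by $(c,w)$, or report that $(c,w)$ satisfies all congruent-$2k3$ cycle inequalities of $G$. **Proposition.** The separation problem of the congruent-$2k3$ cycle inequalities is in $P$: there is a single deterministic algorithm that solves it for all such $G$ and $(c,w)$ in time polynomial in the bit length of the input $(G,c,w)$. -/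

import Mathlib

/-! ### Random access machines with logarithmic cost -/

/-- Programs of a random access machine over the integers, written in structured form. Registers
are named by natural numbers that are fixed in the program; the main memory is addressed by the
contents of registers. -/
inductive RamProgram : Type
  /-- `R r := a` -/
  | const (r : ℕ) (a : ℤ)
  /-- `R r := R s + R t` -/
  | add (r s t : ℕ)
  /-- `R r := R s - R t` -/
  | sub (r s t : ℕ)
  /-- `R r := R s * R t` -/
  | mul (r s t : ℕ)
  /-- `R r := M[R s]` -/
  | load (r s : ℕ)
  /-- `M[R r] := R s` -/
  | store (r s : ℕ)
  /-- run the first program, then the second -/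
  | comp (P Q : RamProgram)
  /-- if `0 < R r` run the first program, otherwise the second -/
  | branch (r : ℕ) (P Q : RamProgram)
  /-- while `0 < R r` run the program -/
  | loop (r : ℕ) (P : RamProgram)

/-- The contents of the registers and of the main memory. -/
structure RamState : Type where
  reg : ℕ → ℤ
  mem : ℤ → ℤ

namespace RamState

/-- Overwrite one register. -/
def setReg (σ : RamState) (r : ℕ) (a : ℤ) : RamState :=
  { reg := Function.update σ.reg r a, mem := σ.mem }

/-- Overwrite one memory cell. -/
def setMem (σ : RamState) (i a : ℤ) : RamState :=
  { reg := σ.reg, mem := Function.update σ.mem i a }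

end RamState

/-- The bit length of an integer (binary digits of its absolute value, plus one for the sign). -/
def bitLength (a : ℤ) : ℕ := Nat.size a.natAbs + 1

/-- `RamExec P σ τ t`: started in state `σ`, the program `P` halts in state `τ`, at total cost `t`.
Every elementary instruction and every test is charged the sum of the bit lengths of all numbers,
addresses included, that it handles (logarithmic cost). -/
inductive RamExec : RamProgram → RamState → RamState → ℕ → Prop
  | const (r : ℕ) (a : ℤ) (σ : RamState) :
      RamExec (.const r a) σ (σ.setReg r a) (bitLength a)
  | add (r s t : ℕ) (σ : RamState) :
      RamExec (.add r s t) σ (σ.setReg r (σ.reg s + σ.reg t))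
        (bitLength (σ.reg s) + bitLength (σ.reg t))
  | sub (r s t : ℕ) (σ : RamState) :
      RamExec (.sub r s t) σ (σ.setReg r (σ.reg s - σ.reg t))
        (bitLength (σ.reg s) + bitLength (σ.reg t))
  | mul (r s t : ℕ) (σ : RamState) :
      RamExec (.mul r s t) σ (σ.setReg r (σ.reg s * σ.reg t))
        (bitLength (σ.reg s) + bitLength (σ.reg t))
  | load (r s : ℕ) (σ : RamState) :
      RamExec (.load r s) σ (σ.setReg r (σ.mem (σ.reg s)))
        (bitLength (σ.reg s) + bitLength (σ.mem (σ.reg s)))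
  | store (r s : ℕ) (σ : RamState) :
      RamExec (.store r s) σ (σ.setMem (σ.reg r) (σ.reg s))
        (bitLength (σ.reg r) + bitLength (σ.reg s))
  | comp {P Q : RamProgram} {σ τ ρ : RamState} {t u : ℕ} :
      RamExec P σ τ t → RamExec Q τ ρ u → RamExec (.comp P Q) σ ρ (t + u)
  | branchPos {r : ℕ} {P Q : RamProgram} {σ τ : RamState} {t : ℕ} :
      0 < σ.reg r → RamExec P σ τ t → RamExec (.branch r P Q) σ τ (bitLength (σ.reg r) + t)
  | branchNonpos {r : ℕ} {P Q : RamProgram} {σ τ : RamState} {t : ℕ} :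
      σ.reg r ≤ 0 → RamExec Q σ τ t → RamExec (.branch r P Q) σ τ (bitLength (σ.reg r) + t)
  | loopPos {r : ℕ} {P : RamProgram} {σ τ ρ : RamState} {t u : ℕ} :
      0 < σ.reg r → RamExec P σ τ t → RamExec (.loop r P) τ ρ u →
        RamExec (.loop r P) σ ρ (bitLength (σ.reg r) + t + u)
  | loopNonpos {r : ℕ} {P : RamProgram} {σ : RamState} :
      σ.reg r ≤ 0 → RamExec (.loop r P) σ σ (bitLength (σ.reg r))

/-- The initial state for an input word: the input is written in the memory cells `0, 1, 2, …`,
its length in register `0`, and everything else is `0`. -/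
def ramInput (input : List ℤ) : RamState where
  reg := fun r => if r = 0 then (input.length : ℤ) else 0
  mem := fun i => if 0 ≤ i then input.getD i.toNat 0 else 0

/-- The output word of a halting state: register `0` holds its length, and the memory cells
`0, 1, 2, …` hold its entries. -/
def ramOutput (σ : RamState) : List ℤ :=
  (List.range (σ.reg 0).toNat).map fun i => σ.mem (i : ℤ)

/-- On the given input the program `P` halts with the given output, at total cost `t`. -/
def RamComputes (P : RamProgram) (input output : List ℤ) (t : ℕ) : Prop :=
  ∃ τ : RamState, RamExec P (ramInput input) τ t ∧ ramOutput τ = output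

/-- The total bit length of a word of integers. -/
def wordSize (l : List ℤ) : ℕ := (l.map bitLength).sum

/-! ### The basic inequalities and the congruent-2k3 cycle inequalities

Edge weights are functions on `Sym2 (Fin n)`, but only their values on the edges of the graph are
ever used. -/

open scoped Classical in
/-- The point `(c, w)` satisfies the basic inequalities of the total matching polytope of `G`. -/
structure SatisfiesBasic {n : ℕ} (G : SimpleGraph (Fin n)) (c : Fin n → ℚ)
    (w : Sym2 (Fin n) → ℚ) : Prop where
  vertex : ∀ v, c v + ∑ e with e ∈ G.incidenceSet v, w e ≤ 1
  edge : ∀ u v, G.Adj u v → c u + c v + w s(u, v) ≤ 1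
  vertex_nonneg : ∀ v, 0 ≤ c v
  edge_nonneg : ∀ e ∈ G.edgeSet, 0 ≤ w e

/-- A cycle of `G` whose length `k` satisfies `k ≡ 1` or `k ≡ 2` modulo `3`. -/
def IsCongruentCycle {n : ℕ} {G : SimpleGraph (Fin n)} {u : Fin n} (C : G.Walk u u) : Prop :=
  C.IsCycle ∧ (C.length ≡ 1 [MOD 3] ∨ C.length ≡ 2 [MOD 3])

/-- Left-hand side minus right-hand side, at the point `(c, w)`, of the cycle inequality
`∑_{v ∈ V(C)} x_v + ∑_{e ∈ E(C)} y_e ≤ ⌊2k/3⌋`, where `k` is the length of `C`. -/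
def cycleViolation {n : ℕ} {G : SimpleGraph (Fin n)} (c : Fin n → ℚ) (w : Sym2 (Fin n) → ℚ)
    {u : Fin n} (C : G.Walk u u) : ℚ :=
  ∑ v ∈ C.support.toFinset, c v + ∑ e ∈ C.edges.toFinset, w e - ⌊(2 * C.length / 3 : ℚ)⌋

/-- The vertices of a closed walk in the order of traversal, each visit listed once. -/
def cycleWord {n : ℕ} {G : SimpleGraph (Fin n)} {u : Fin n} (C : G.Walk u u) : List ℤ :=
  C.support.tail.map fun v => ((v : ℕ) : ℤ)

/-- `out` is a correct answer to the separation problem at `(c, w)`: it lists the vertices of a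
cycle whose congruent-2k3 cycle inequality is violated, or it is empty and all these inequalities
are satisfied. -/
def IsSeparationAnswer {n : ℕ} (G : SimpleGraph (Fin n)) (c : Fin n → ℚ) (w : Sym2 (Fin n) → ℚ)
    (out : List ℤ) : Prop :=
  (∃ (u : Fin n) (C : G.Walk u u),
      IsCongruentCycle C ∧ 0 < cycleViolation c w C ∧ out = cycleWord C) ∨
  (out = [] ∧ ∀ (u : Fin n) (C : G.Walk u u), IsCongruentCycle C → cycleViolation c w C ≤ 0)

open scoped Classical in
/-- The input word of an instance: the number `n` of vertices; numerator and denominator of the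
weight of each vertex; then, row by row, for each pair of vertices a bit for adjacency with
numerator and denominator of the weight of the edge (`0`, `0`, `1` for a nonadjacent pair). -/
noncomputable def encodeInstance {n : ℕ} (G : SimpleGraph (Fin n)) (c : Fin n → ℚ)
    (w : Sym2 (Fin n) → ℚ) : List ℤ :=
  [(n : ℤ)] ++
  (List.finRange n).flatMap (fun v => [(c v).num, ((c v).den : ℤ)]) ++
  (List.finRange n).flatMap (fun u => (List.finRange n).flatMap fun v =>
    if G.Adj u v then [1, (w s(u, v)).num, ((w s(u, v)).den : ℤ)] else [0, 0, 1])

/-! ### Cyclic lists without equal neighbours -/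

namespace Cycle

theorem chain_coe_iff {α : Type*} {r : α → α → Prop} (l : List α) :
    Cycle.Chain r (l : Cycle α) ↔
      l.IsChain r ∧ ∀ x ∈ l.getLast?, ∀ y ∈ l.head?, r x y := by
  cases l with
  | nil => simp
  | cons a l => rw [Cycle.chain_coe_cons, ← List.cons_append, List.isChain_append]; simp

theorem chain_append_comm {α : Type*} {r : α → α → Prop} (l m : List α) :
    Cycle.Chain r ((l ++ m : List α) : Cycle α) ↔ Cycle.Chain r ((m ++ l : List α) : Cycle α) := by
  rw [Cycle.coe_eq_coe.2 List.isRotated_append]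

end Cycle

/-! ### Lists in which three consecutive entries sum to at most one -/

/-- Any three consecutive entries sum to at most one. -/
def TripleBounded (l : List ℚ) : Prop :=
  ∀ a b d : ℚ, [a, b, d] <:+: l → a + b + d ≤ 1

theorem TripleBounded.infix {l m : List ℚ} (hl : TripleBounded l) (h : m <:+: l) :
    TripleBounded m :=
  fun a b d h' => hl a b d (h'.trans h)

theorem TripleBounded.cons {a b d : ℚ} {l : List ℚ} (h : a + b + d ≤ 1)
    (hl : TripleBounded (b :: d :: l)) : TripleBounded (a :: b :: d :: l) := by
  intro x y z hxyz
  rcases List.infix_cons_iff.1 hxyz with h' | h'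
  · obtain ⟨t, ht⟩ := h'
    simp only [List.cons_append, List.cons.injEq] at ht
    obtain ⟨rfl, rfl, rfl, -⟩ := ht
    exact h
  · exact hl x y z h'

/-- Cut the list into consecutive blocks of three. -/
theorem TripleBounded.sum_le {l : List ℚ} (hl : TripleBounded l) {m : ℕ}
    (hm : l.length = 3 * m) : l.sum ≤ m := by
  induction m generalizing l with
  | zero =>
    obtain rfl : l = [] := List.length_eq_zero_iff.1 (by simpa using hm)
    simp
  | succ m ih =>
    match l, hm with
    | a :: b :: d :: l, hm =>
      have h1 := hl a b d ⟨[], l, rfl⟩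
      have h2 := ih (hl.infix ⟨[a, b, d], [], by simp⟩ : TripleBounded l)
        (by simp only [List.length_cons] at hm; omega)
      simp only [List.sum_cons]
      push_cast
      linarith

/-! ### Slack of walks -/

section Slack

open SimpleGraph

variable {n : ℕ} {G : SimpleGraph (Fin n)} (c : Fin n → ℚ) (w : Sym2 (Fin n) → ℚ)

/-- The contribution of an edge to the slack of a closed walk. -/
def edgeSlack (u v : Fin n) : ℚ := 2 - 3 / 2 * (c u + c v) - 3 * w s(u, v)

/-- The sum of the edge slacks along a walk. -/
def walkSlack {u v : Fin n} : G.Walk u v → ℚ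
  | .nil => 0
  | .cons (u := u) (v := v) _ p => edgeSlack c w u v + walkSlack p

/-- The weights of the vertices and edges of a walk in the order of traversal. -/
def walkWeights {u v : Fin n} : G.Walk u v → List ℚ
  | .nil (u := u) => [c u]
  | .cons (u := u) (v := v) _ p => c u :: w s(u, v) :: walkWeights p

@[simp] theorem walkSlack_nil {u : Fin n} : walkSlack c w (.nil : G.Walk u u) = 0 := rfl

@[simp] theorem walkSlack_cons {u v t : Fin n} (h : G.Adj u v) (p : G.Walk v t) :
    walkSlack c w (.cons h p) = edgeSlack c w u v + walkSlack c w p := rfl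

@[simp] theorem walkWeights_nil {u : Fin n} : walkWeights c w (.nil : G.Walk u u) = [c u] := rfl

@[simp] theorem walkWeights_cons {u v t : Fin n} (h : G.Adj u v) (p : G.Walk v t) :
    walkWeights c w (.cons h p) = c u :: w s(u, v) :: walkWeights c w p := rfl

theorem edgeSlack_comm (u v : Fin n) : edgeSlack c w u v = edgeSlack c w v u := by
  simp only [edgeSlack, Sym2.eq_swap (a := u), add_comm (c u)]

@[simp] theorem walkSlack_append {u v t : Fin n} (p : G.Walk u v) (q : G.Walk v t) :
    walkSlack c w (p.append q) = walkSlack c w p + walkSlack c w q := by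
  induction p with
  | nil => simp
  | cons h p ih => simp [ih, add_assoc]

@[simp] theorem walkSlack_reverse {u v : Fin n} (p : G.Walk u v) :
    walkSlack c w p.reverse = walkSlack c w p := by
  induction p with
  | nil => simp
  | cons h p ih => simp [ih, edgeSlack_comm c w, add_comm]

/-- An inner vertex receives a half from each of its two edges; the last term makes up for the
missing halves at the ends. For a closed walk it cancels the double count of the base vertex. -/
theorem walkSlack_eq {u v : Fin n} (p : G.Walk u v) :
    walkSlack c w p =
      2 * p.length - 3 * (walkWeights c w p).sum + 3 / 2 * (c u + c v) := by
  induction p with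
  | nil => simp; ring
  | cons h p ih => simp only [walkSlack_cons, ih, edgeSlack, Walk.length_cons, walkWeights_cons,
      List.sum_cons]; push_cast; ring

theorem length_walkWeights {u v : Fin n} (p : G.Walk u v) :
    (walkWeights c w p).length = 2 * p.length + 1 := by
  induction p with
  | nil => simp
  | cons h p ih => simp [ih]; ring

theorem walkWeights_concat {u v t : Fin n} (p : G.Walk u v) (h : G.Adj v t) :
    walkWeights c w (p.concat h) = walkWeights c w p ++ [w s(v, t), c t] := by
  induction p with
  | nil => rfl
  | cons h p ih => simp [ih]

/-- A closed walk whose inequality, counted with multiplicities, is violated. -/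
def WalkViolated {u : Fin n} (p : G.Walk u u) : Prop :=
  walkSlack c w p < ((2 * p.length % 3 : ℕ) : ℚ)

/-- No two consecutive edges of the closed walk coincide, cyclically. -/
def CyclicallyReduced {u : Fin n} (p : G.Walk u u) : Prop :=
  Cycle.Chain (· ≠ ·) (p.edges : Cycle (Sym2 (Fin n)))

variable {c w}

theorem SatisfiesBasic.vertex_sum (hb : SatisfiesBasic G c w) {v : Fin n}
    (s : Finset (Sym2 (Fin n))) (hs : ∀ e ∈ s, e ∈ G.incidenceSet v) :
    c v + ∑ e ∈ s, w e ≤ 1 := by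
  classical
  refine le_trans (add_le_add le_rfl
    (Finset.sum_le_sum_of_subset_of_nonneg (fun e he => ?_) fun e he _ => ?_)) (hb.vertex v)
  · simpa using hs e he
  · exact hb.edge_nonneg e (G.incidenceSet_subset v (by simpa using he))

theorem SatisfiesBasic.vertex_two (hb : SatisfiesBasic G c w) {v : Fin n} {e f : Sym2 (Fin n)}
    (he : e ∈ G.incidenceSet v) (hf : f ∈ G.incidenceSet v) (hef : e ≠ f) :
    c v + w e + w f ≤ 1 := by
  have := hb.vertex_sum (v := v) {e, f} (by simp [he, hf])
  rw [Finset.sum_pair hef] at this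
  linarith

theorem SatisfiesBasic.vertex_three (hb : SatisfiesBasic G c w) {v : Fin n} {e f g : Sym2 (Fin n)}
    (he : e ∈ G.incidenceSet v) (hf : f ∈ G.incidenceSet v) (hg : g ∈ G.incidenceSet v)
    (hef : e ≠ f) (heg : e ≠ g) (hfg : f ≠ g) :
    c v + w e + w f + w g ≤ 1 := by
  have := hb.vertex_sum (v := v) {e, f, g} (by simp [he, hf, hg])
  rw [Finset.sum_insert (by simp [hef, heg]), Finset.sum_pair hfg] at this
  linarith

/-- Vertex and edge weights alternate. A window centred at an edge is an edge inequality. A window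
centred at a vertex contains two different edges, because the walk is reduced, and so is part of the
vertex inequality. -/
theorem SatisfiesBasic.tripleBounded (hb : SatisfiesBasic G c w) {u v : Fin n} (p : G.Walk u v)
    (hp : p.edges.IsChain (· ≠ ·)) : TripleBounded (walkWeights c w p) := by
  induction p with
  | nil =>
    intro a b d h
    have := h.length_le
    simp at this
  | @cons u v t h p ih =>
    have ih' := ih (by simpa using hp.tail)
    cases p with
    | nil =>
      simp only [walkWeights_cons, walkWeights_nil]
      intro a b d h'
      have := h'.eq_of_length (by simp)
      simp only [List.cons.injEq] at this
      obtain ⟨rfl, rfl, rfl, -⟩ := this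
      have := hb.edge u v h
      linarith
    | @cons _ v' _ h' p =>
      simp only [walkWeights_cons] at ih' ⊢
      simp only [Walk.edges_cons, List.isChain_cons_cons] at hp
      refine TripleBounded.cons ?_ (TripleBounded.cons ?_ ih')
      · have := hb.edge u v h
        linarith
      · have := hb.vertex_two (v := v) (e := s(u, v)) (f := s(v, v'))
          ⟨h, by simp⟩ ⟨h', by simp⟩ hp.1
        linarith

end Slack

/-! ### Lower bounds for the slack by the length modulo three -/

section Slack

open SimpleGraph

variable {n : ℕ} {G : SimpleGraph (Fin n)} {c : Fin n → ℚ} {w : Sym2 (Fin n) → ℚ}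

theorem SimpleGraph.Walk.exists_eq_cons_concat {V : Type*} {G : SimpleGraph V} {u v : V}
    (p : G.Walk u v) (hp : 2 ≤ p.length) :
    ∃ (a b : V) (h : G.Adj u a) (r : G.Walk a b) (h' : G.Adj b v),
      p = .cons h (r.concat h') := by
  cases p with
  | nil => simp at hp
  | cons h p =>
    cases p with
    | nil => simp at hp
    | cons h1 p =>
      obtain ⟨b, r, h', hr⟩ := Walk.exists_cons_eq_concat h1 p
      exact ⟨_, b, h, r, h', by rw [hr]⟩

theorem SimpleGraph.Walk.three_le_length_of_chain {V : Type*} {G : SimpleGraph V} {u : V}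
    (p : G.Walk u u) (hp : 0 < p.length) (h : p.edges.IsChain (· ≠ ·)) : 3 ≤ p.length := by
  match p, hp, h with
  | .cons h1 .nil, _, _ => exact (h1.ne rfl).elim
  | .cons h1 (.cons h2 .nil), _, h => simp [Sym2.eq_swap] at h
  | .cons h1 (.cons h2 (.cons h3 p)), _, _ => simp

/-- Remove the base vertex and its two edges, of total weight at most `1 - z`. The number of
remaining weights is a multiple of three, so they are bounded by triples. -/
theorem SatisfiesBasic.walkSlack_closed_ge (hb : SatisfiesBasic G c w) {x : Fin n}
    (A : G.Walk x x) (hA : A.edges.IsChain (· ≠ ·)) (h0 : 0 < A.length) (h3 : A.length % 3 = 0)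
    (z : ℚ) (hz : ∀ e ∈ A.edges.head?, ∀ f ∈ A.edges.getLast?, c x + w e + w f + z ≤ 1) :
    3 * z ≤ walkSlack c w A := by
  obtain ⟨a, b, h, r, h', rfl⟩ := A.exists_eq_cons_concat (by omega)
  have ht := hb.tripleBounded _ hA
  have hs := walkSlack_eq c w (Walk.cons h (r.concat h'))
  have hz' := hz s(x, a) (by simp) s(b, x) (by simp [Walk.edges_concat, List.getLast?_cons])
  simp only [walkWeights_cons, walkWeights_concat, Walk.length_cons, Walk.length_concat] at ht hs h3
  obtain ⟨m, hm⟩ : ∃ m, r.length = 3 * m + 1 := ⟨r.length / 3, by omega⟩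
  have hr := (ht.infix (m := walkWeights c w r) ⟨[c x, w s(x, a)], [w s(b, x), c x], by simp⟩).sum_le
    (m := 2 * m + 1) (by rw [length_walkWeights]; omega)
  simp only [List.sum_cons, List.sum_append, List.sum_nil, hm] at hs
  push_cast at hr hs
  linarith

/-- The dumbbell traverses `R` twice, so twice the slack is what matters. It involves every weight
twice except the two endpoint weights, which occur once. These are covered by two windows of the
list, each of length divisible by three; what remains uncovered appears as the loss in `w e` and `w
f`. -/
theorem SatisfiesBasic.two_mul_walkSlack_ge (hb : SatisfiesBasic G c w) {x y : Fin n}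
    (R : G.Walk x y) (hR : R.edges.IsChain (· ≠ ·)) {e f : Sym2 (Fin n)}
    (he : e ∈ R.edges.head?) (hf : f ∈ R.edges.getLast?) :
    (R.length % 3 = 0 → 0 ≤ 2 * walkSlack c w R) ∧
    (R.length % 3 = 1 → 1 - 3 * w e ≤ 2 * walkSlack c w R ∧ 1 - 3 * w f ≤ 2 * walkSlack c w R) ∧
    (R.length % 3 = 2 → -1 ≤ 2 * walkSlack c w R ∧
      2 - 3 * w e - 3 * w f ≤ 2 * walkSlack c w R) := by
  -- A single edge is both first and last, and is settled by its edge inequality.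
  rcases Nat.lt_or_ge R.length 2 with h2 | h2
  · match R, h2, he, hf with
    | .nil, _, he, _ => simp at he
    | .cons h .nil, _, he, hf =>
      simp only [Walk.edges_cons, Walk.edges_nil, List.head?_cons, List.getLast?_singleton,
        Option.mem_def, Option.some.injEq] at he hf
      subst he hf
      have h1 := hb.edge _ _ h
      have h2 := hb.edge_nonneg s(x, y) h
      simp [edgeSlack]
      linarith
  · obtain ⟨a, b, h, r, h', rfl⟩ := R.exists_eq_cons_concat h2
    have ht := hb.tripleBounded _ hR
    have hs := walkSlack_eq c w (Walk.cons h (r.concat h'))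
    obtain rfl : e = s(x, a) := by simpa [eq_comm] using he
    obtain rfl : f = s(b, y) := by
      simpa [eq_comm, Walk.edges_concat, List.getLast?_cons] using hf
    simp only [walkWeights_cons, walkWeights_concat, Walk.length_cons, Walk.length_concat,
      List.sum_cons, List.sum_append, List.sum_nil] at ht hs ⊢
    have hlen := length_walkWeights c w r
    have hx := hb.vertex_nonneg x
    have hy := hb.vertex_nonneg y
    have hbv := hb.vertex_nonneg b
    have hedge := hb.edge _ _ h'
    have hwe := hb.edge_nonneg s(x, a) h
    have hwf := hb.edge_nonneg s(b, y) h'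
    set l := walkWeights c w r
    set y₁ := w s(x, a)
    set y₂ := w s(b, y)
    refine ⟨fun h3 => ?_, fun h3 => ?_, fun h3 => ?_⟩
    -- Each of the two windows omits one endpoint, so together they cover everything.
    · obtain ⟨m, hm⟩ : ∃ m, r.length = 3 * m + 1 := ⟨r.length / 3, by omega⟩
      have h1 := (ht.infix (m := c x :: y₁ :: l ++ [y₂]) ⟨[], [c y], by simp⟩).sum_le
        (m := 2 * m + 2) (by simp; omega)
      have h2 := (ht.infix (m := y₁ :: l ++ [y₂, c y]) ⟨[c x], [], by simp⟩).sum_le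
        (m := 2 * m + 2) (by simp; omega)
      simp only [List.sum_cons, List.sum_append, List.sum_nil, hm, List.cons_append] at hs h1 h2
      push_cast at h1 h2 hs
      linarith
    -- The whole list is paired with a window that omits both endpoints and one end edge; the choice
    -- of that edge gives the two bounds.
    · obtain ⟨m, hm⟩ : ∃ m, r.length = 3 * m + 2 := ⟨r.length / 3, by omega⟩
      have h0 := (ht.infix (m := c x :: y₁ :: l ++ [y₂, c y]) ⟨[], [], by simp⟩).sum_le
        (m := 2 * m + 3) (by simp; omega)
      have h1 := (ht.infix (m := l ++ [y₂]) ⟨[c x, y₁], [c y], by simp⟩).sum_le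
        (m := 2 * m + 2) (by simp; omega)
      have h2 := (ht.infix (m := y₁ :: l) ⟨[c x], [y₂, c y], by simp⟩).sum_le
        (m := 2 * m + 2) (by simp; omega)
      simp only [List.sum_cons, List.sum_append, List.sum_nil, hm, List.cons_append] at hs h0 h1 h2
      push_cast at h0 h1 h2 hs
      constructor <;> linarith
    -- The constant bound uses `h0`, `h1` and the edge inequality of the last edge. The other bound
    -- uses `h1` and `h2`, which miss each end edge once.
    · obtain ⟨m, hm⟩ : ∃ m, r.length = 3 * m := ⟨r.length / 3, by omega⟩
      have h0 := (ht.infix (m := y₁ :: l ++ [y₂]) ⟨[c x], [c y], by simp⟩).sum_le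
        (m := 2 * m + 1) (by simp; omega)
      have h1 := (ht.infix (m := c x :: y₁ :: l) ⟨[], [y₂, c y], by simp⟩).sum_le
        (m := 2 * m + 1) (by simp; omega)
      have h2 := (ht.infix (m := l ++ [y₂, c y]) ⟨[c x, y₁], [], by simp⟩).sum_le
        (m := 2 * m + 1) (by simp; omega)
      simp only [List.sum_cons, List.sum_append, List.sum_nil, hm, List.cons_append] at hs h0 h1 h2
      push_cast at h0 h1 h2 hs
      constructor <;> linarith

theorem SimpleGraph.Walk.head_mem_incidenceSet {V : Type*} {G : SimpleGraph V} {u v : V}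
    (p : G.Walk u v) {e : Sym2 V} (he : e ∈ p.edges.head?) : e ∈ G.incidenceSet u := by
  cases p with
  | nil => simp at he
  | cons h p =>
    obtain rfl : _ = e := by simpa using he
    exact ⟨h, by simp⟩

theorem SimpleGraph.Walk.getLast_mem_incidenceSet {V : Type*} {G : SimpleGraph V} {u v : V}
    (p : G.Walk u v) {e : Sym2 V} (he : e ∈ p.edges.getLast?) : e ∈ G.incidenceSet v :=
  p.reverse.head_mem_incidenceSet (by simpa using he)

theorem SimpleGraph.Walk.edges_ne_nil {V : Type*} {G : SimpleGraph V} {u v : V}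
    (p : G.Walk u v) (hp : 0 < p.length) : p.edges ≠ [] := by
  rw [ne_eq, ← List.length_eq_zero_iff, Walk.length_edges]
  omega

/-- For lengths divisible by three, `e` is a third edge at `x`, and the closed bound applies with `z
= w e`. For the other residues the bound is the threshold itself. -/
theorem SatisfiesBasic.walkSlack_ge_of_not_violated (hb : SatisfiesBasic G c w) {x : Fin n}
    {A : G.Walk x x} (hA : CyclicallyReduced A) (h0 : 0 < A.length) (hv : ¬ WalkViolated c w A) :
    (A.length % 3 = 0 → 0 ≤ walkSlack c w A ∧ ∀ e ∈ G.incidenceSet x,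
      e ∉ A.edges.head? → e ∉ A.edges.getLast? → 3 * w e ≤ walkSlack c w A) ∧
    (A.length % 3 = 1 → 2 ≤ walkSlack c w A) ∧ (A.length % 3 = 2 → 1 ≤ walkSlack c w A) := by
  obtain ⟨hc, hl⟩ := (Cycle.chain_coe_iff _).1 hA
  rw [WalkViolated, not_lt] at hv
  refine ⟨fun h3 => ⟨?_, fun e he h1 h2 => ?_⟩, fun h3 => ?_, fun h3 => ?_⟩
  · have := hb.walkSlack_closed_ge A hc h0 h3 0 fun e he f hf => by
      have := hb.vertex_two (A.head_mem_incidenceSet he) (A.getLast_mem_incidenceSet hf)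
        (hl f hf e he).symm
      linarith
    linarith
  · refine hb.walkSlack_closed_ge A hc h0 h3 _ fun f hf g hg => ?_
    exact hb.vertex_three (A.head_mem_incidenceSet hf) (A.getLast_mem_incidenceSet hg) he
      (hl g hg f hf).symm (fun h => h1 (h ▸ hf)) (fun h => h2 (h ▸ hg))
  · rw [show 2 * A.length % 3 = 2 by omega] at hv
    exact_mod_cast hv
  · rw [show 2 * A.length % 3 = 1 by omega] at hv
    exact_mod_cast hv

/-- The thresholds 0, 2, 1 of the residues 0, 1, 2 are subadditive, which settles an empty `R`.
Otherwise `R` may lose up to `3 * w e` and `3 * w f`. A closed part of length divisible by three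
pays exactly for the edge of `R` at its base vertex. When a part has another residue, its own
threshold suffices, by `w e ≤ 1`, `w f ≤ 1` or the constant bound for `R`. -/
theorem SatisfiesBasic.not_walkViolated_dumbbell (hb : SatisfiesBasic G c w) {x y : Fin n}
    {A : G.Walk x x} {R : G.Walk x y} {B : G.Walk y y}
    (hA0 : 0 < A.length) (hB0 : 0 < B.length)
    (hA : CyclicallyReduced A) (hB : CyclicallyReduced B)
    (h : CyclicallyReduced (A.append (R.append (B.append R.reverse))))
    (hvA : ¬ WalkViolated c w A) (hvB : ¬ WalkViolated c w B) :
    ¬ WalkViolated c w (A.append (R.append (B.append R.reverse))) := by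
  obtain ⟨hA1, hA2, hA3⟩ := hb.walkSlack_ge_of_not_violated hA hA0 hvA
  obtain ⟨hB1, hB2, hB3⟩ := hb.walkSlack_ge_of_not_violated hB hB0 hvB
  simp only [WalkViolated, walkSlack_append, walkSlack_reverse, Walk.length_append,
    Walk.length_reverse, not_lt]
  rcases Nat.eq_zero_or_pos R.length with h0 | h0
  · obtain rfl := Walk.eq_of_length_eq_zero h0
    obtain rfl : R = .nil := by simpa using h0
    simp only [walkSlack_nil, Walk.length_nil]
    have ha : A.length % 3 < 3 := Nat.mod_lt _ (by norm_num)
    have hb : B.length % 3 < 3 := Nat.mod_lt _ (by norm_num)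
    rw [show 2 * (A.length + (0 + (B.length + 0))) % 3
      = 2 * (A.length % 3 + B.length % 3) % 3 by omega]
    generalize A.length % 3 = i at *
    generalize B.length % 3 = j at *
    interval_cases i <;> interval_cases j <;> norm_num at * <;> linarith
  · obtain ⟨hc, hl⟩ := (Cycle.chain_coe_iff _).1 h
    simp only [Walk.edges_append, Walk.edges_reverse] at hc hl
    obtain ⟨e, he⟩ := Option.ne_none_iff_exists'.1
      (mt List.head?_eq_none_iff.1 (R.edges_ne_nil h0))
    obtain ⟨f, hf⟩ := Option.ne_none_iff_exists'.1
      (mt List.getLast?_eq_none_iff.1 (R.edges_ne_nil h0))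
    have hAne := A.edges_ne_nil hA0
    have hBne := B.edges_ne_nil hB0
    simp only [List.isChain_append, List.head?_append, List.getLast?_append, List.head?_reverse,
      List.getLast?_reverse, he, hf, Option.mem_def, Option.some_or, Option.some.injEq,
      forall_eq'] at hc hl
    obtain ⟨-, ⟨hR, ⟨-, -, hBl⟩, hBh⟩, hAl⟩ := hc
    have hq := hb.two_mul_walkSlack_ge R hR he hf
    have heI := R.head_mem_incidenceSet he
    have hfI := R.getLast_mem_incidenceSet hf
    have hwe := hb.edge_nonneg _ (G.incidenceSet_subset _ heI)
    have hwf := hb.edge_nonneg _ (G.incidenceSet_subset _ hfI)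
    have hwe1 : w e ≤ 1 := by
      have := hb.vertex_sum (v := x) {e} (by simpa using heI)
      have := hb.vertex_nonneg x
      simp at *; linarith
    have hwf1 : w f ≤ 1 := by
      have := hb.vertex_sum (v := y) {f} (by simpa using hfI)
      have := hb.vertex_nonneg y
      simp at *; linarith
    -- The walk is reduced on entering and on leaving `A`, once at the cyclic closing point, so `e`
    -- is neither the first nor the last edge of `A`.
    have hA1' := fun h3 => (hA1 h3).2 e heI
      (fun h' => hl e (by simp [Option.mem_def.1 h']) rfl) (fun h' => hAl e h' rfl)
    have hB1' := fun h3 => (hB1 h3).2 f hfI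
      (fun h' => hBh f (by simp [Option.mem_def.1 h']) rfl) (fun h' => hBl f h' rfl)
    have ha : A.length % 3 < 3 := Nat.mod_lt _ (by norm_num)
    have hb : B.length % 3 < 3 := Nat.mod_lt _ (by norm_num)
    have hr : R.length % 3 < 3 := Nat.mod_lt _ (by norm_num)
    rw [show 2 * (A.length + (R.length + (B.length + R.length))) % 3
      = (2 * (A.length % 3 + B.length % 3) + 4 * (R.length % 3)) % 3 by omega]
    clear hA1 hB1
    generalize A.length % 3 = i at *
    generalize B.length % 3 = j at *
    generalize R.length % 3 = k at *
    obtain ⟨hq1, hq2, hq3⟩ := hq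
    interval_cases i <;> interval_cases j <;> interval_cases k <;>
      norm_num at hA1' hA2 hA3 hB1' hB2 hB3 hq1 hq2 hq3 ⊢ <;> linarith

end Slack

/-! ### Splitting closed walks and stripping their tails -/

namespace SimpleGraph.Walk

variable {V : Type*} {G : SimpleGraph V}

theorem exists_append_append_of_not_isPath {u v : V} (q : G.Walk u v) (hq : ¬ q.IsPath) :
    ∃ (x : V) (q₁ : G.Walk u x) (q₂ : G.Walk x x) (q₃ : G.Walk x v),
      0 < q₂.length ∧ q = q₁.append (q₂.append q₃) := by
  classical
  induction q with
  | nil => simp at hq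
  | @cons u t v h q ih =>
    by_cases hu : u ∈ q.support
    · exact ⟨u, .nil, .cons h (q.takeUntil u hu), q.dropUntil u hu, by simp, by simp⟩
    · obtain ⟨x, q₁, q₂, q₃, h0, hq'⟩ := ih fun hp => hq (hp.cons hu)
      exact ⟨x, .cons h q₁, q₂, q₃, h0, by rw [hq', cons_append]⟩

/-- While the first and the last edge coincide, peel both off. A nonempty reduced closed walk has
length at least three, so something remains each time. -/
theorem exists_eq_append_append_reverse (N : ℕ) {x : V} (W : G.Walk x x) (hN : W.length ≤ N)
    (h0 : 0 < W.length) (hW : W.edges.IsChain (· ≠ ·)) :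
    ∃ (y : V) (P : G.Walk x y) (A : G.Walk y y), 0 < A.length ∧
      Cycle.Chain (· ≠ ·) (A.edges : Cycle (Sym2 V)) ∧ W = P.append (A.append P.reverse) := by
  induction N generalizing x with
  | zero => omega
  | succ N ih =>
    by_cases hc : Cycle.Chain (· ≠ ·) (W.edges : Cycle (Sym2 V))
    · exact ⟨x, .nil, W, h0, hc, by simp⟩
    · have h3 := W.three_le_length_of_chain h0 hW
      obtain ⟨a, b, h, r, h', rfl⟩ := W.exists_eq_cons_concat (by omega)
      have hab : s(x, a) = s(b, x) := by
        by_contra hne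
        refine hc ((Cycle.chain_coe_iff _).2 ⟨hW, ?_⟩)
        simpa [edges_concat, List.getLast?_cons] using Ne.symm hne
      obtain rfl : a = b := by
        rcases Sym2.eq_iff.1 hab with ⟨rfl, -⟩ | ⟨-, h⟩
        · exact (h'.ne rfl).elim
        · exact h
      simp only [length_cons, length_concat] at hN h3
      obtain ⟨y, P, A, hA0, hA, hr⟩ := ih r (by omega) (by omega)
        (hW.infix ⟨[s(x, a)], [s(a, x)], by simp [edges_concat]⟩)
      refine ⟨y, .cons h P, A, hA0, hA, ?_⟩
      subst hr
      simp [concat_eq_append, append_assoc]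

end SimpleGraph.Walk

/-! ### A shortest violated closed walk is a cycle -/

section Slack

open SimpleGraph

variable {n : ℕ} {G : SimpleGraph (Fin n)} {c : Fin n → ℚ} {w : Sym2 (Fin n) → ℚ}

theorem CyclicallyReduced.append_comm {u v : Fin n} {p : G.Walk u v} {q : G.Walk v u}
    (h : CyclicallyReduced (p.append q)) : CyclicallyReduced (q.append p) := by
  simp only [CyclicallyReduced, Walk.edges_append] at h ⊢
  exact (Cycle.chain_append_comm _ _).1 h

theorem WalkViolated.append_comm {u v : Fin n} {p : G.Walk u v} {q : G.Walk v u}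
    (h : WalkViolated c w (p.append q)) : WalkViolated c w (q.append p) := by
  simp only [WalkViolated, walkSlack_append, Walk.length_append] at h ⊢
  rwa [add_comm (walkSlack c w q), add_comm q.length]

/-- The two closed walks at a repeated vertex have the forms P A P⁻¹ and Q B Q⁻¹. Rotated to start
with A, the whole walk is a dumbbell with connecting walk P⁻¹ Q. One of A and B must be violated,
and each is shorter because the other is nonempty. -/
theorem SatisfiesBasic.exists_shorter_violated (hb : SatisfiesBasic G c w) {u : Fin n}
    {W : G.Walk u u} (h0 : 0 < W.length) (hW : CyclicallyReduced W) (hv : WalkViolated c w W)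
    (hcyc : ¬ W.IsCycle) :
    ∃ (v : Fin n) (W' : G.Walk v v), 0 < W'.length ∧ CyclicallyReduced W' ∧
      WalkViolated c w W' ∧ W'.length < W.length := by
  have h3 := W.three_le_length_of_chain h0 ((Cycle.chain_coe_iff _).1 hW).1
  cases W with
  | nil => simp at h0
  | cons h q =>
  have hq : ¬ q.IsPath := fun hq => hcyc (Walk.isCycle_iff_isPath_tail_and_le_length.2
    ⟨by simpa using hq, h3⟩)
  obtain ⟨x, q₁, q₂, q₃, hq0, rfl⟩ := q.exists_append_append_of_not_isPath hq
  set W₁ := q₂ with hW₁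
  set W₂ := q₃.append (.cons h q₁) with hW₂
  have e : Walk.cons h (q₁.append (q₂.append q₃)) = (Walk.cons h q₁).append (q₂.append q₃) := by
    simp
  rw [e] at hW hv ⊢
  have hlen : ((Walk.cons h q₁).append (q₂.append q₃)).length = W₁.length + W₂.length := by
    simp [hW₁, hW₂]; omega
  rw [hlen]
  replace hW : CyclicallyReduced (W₁.append W₂) := by
    have := hW.append_comm
    rwa [← Walk.append_assoc] at this
  replace hv : WalkViolated c w (W₁.append W₂) := by
    have := hv.append_comm
    rwa [← Walk.append_assoc] at this
  have hW20 : 0 < W₂.length := by simp [hW₂]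
  clear_value W₁ W₂
  have hchain := ((Cycle.chain_coe_iff _).1 hW).1
  rw [Walk.edges_append] at hchain
  obtain ⟨y, P, A, hA0, hA, rfl⟩ := W₁.exists_eq_append_append_reverse _ le_rfl hq0
    hchain.left_of_append
  obtain ⟨z, Q, B, hB0, hB, rfl⟩ := W₂.exists_eq_append_append_reverse _ le_rfl hW20
    hchain.right_of_append
  have e2 : (P.append (A.append P.reverse)).append (Q.append (B.append Q.reverse)) =
      P.append (A.append (P.reverse.append (Q.append (B.append Q.reverse)))) := by
    simp only [Walk.append_assoc]
  have e3 : (A.append (P.reverse.append (Q.append (B.append Q.reverse)))).append P =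
      A.append ((P.reverse.append Q).append (B.append (P.reverse.append Q).reverse)) := by
    simp only [Walk.append_assoc, Walk.reverse_append, Walk.reverse_reverse]
  rw [e2] at hW hv
  replace hW := hW.append_comm
  replace hv := hv.append_comm
  rw [e3] at hW hv
  by_contra hcon
  push Not at hcon
  refine hb.not_walkViolated_dumbbell hA0 hB0 hA hB hW (fun hvA => ?_) (fun hvB => ?_) hv
  · have := hcon y A hA0 hA hvA
    simp only [Walk.length_append, Walk.length_reverse] at this
    omega
  · have := hcon z B hB0 hB hvB
    simp only [Walk.length_append, Walk.length_reverse] at this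
    omega

/-! ### Violated cycles -/

theorem sum_walkWeights {u v : Fin n} (p : G.Walk u v) :
    (walkWeights c w p).sum = (p.support.map c).sum + (p.edges.map w).sum := by
  induction p with
  | nil => simp
  | cons h p ih => simp [ih]; ring

theorem cycleViolation_eq {u : Fin n} {C : G.Walk u u} (hC : C.IsCycle) :
    cycleViolation c w C = 2 * C.length / 3 - walkSlack c w C / 3 - (2 * C.length / 3 : ℕ) := by
  -- The support lists the base vertex at both ends; its tail has no repetition.
  have h1 : C.support.toFinset = C.support.tail.toFinset := by
    ext x
    simp only [List.mem_toFinset]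
    refine ⟨fun hx => ?_, List.mem_of_mem_tail⟩
    rw [← Walk.cons_tail_support] at hx
    rcases List.mem_cons.1 hx with rfl | hx
    · exact Walk.end_mem_tail_support hC.not_nil
    · exact hx
  have h2 : ⌊(2 * C.length / 3 : ℚ)⌋ = ((2 * C.length / 3 : ℕ) : ℤ) := by
    rw [show (2 * C.length / 3 : ℚ) = ((2 * C.length : ℕ) : ℚ) / ((3 : ℕ) : ℚ) by push_cast; rfl]
    exact_mod_cast Rat.floor_natCast_div_natCast _ _
  rw [cycleViolation, h1, List.sum_toFinset _ hC.support_nodup,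
    List.sum_toFinset _ hC.isTrail.edges_nodup, h2, walkSlack_eq, sum_walkWeights,
    ← C.cons_tail_support, Int.cast_natCast]
  simp only [List.map_cons, List.sum_cons, List.tail_cons]
  ring

theorem cycleViolation_pos_iff {u : Fin n} {C : G.Walk u u} (hC : C.IsCycle) :
    0 < cycleViolation c w C ↔ WalkViolated c w C := by
  rw [cycleViolation_eq hC, WalkViolated]
  have : ((2 * C.length : ℕ) : ℚ) = ((3 * (2 * C.length / 3) + 2 * C.length % 3 : ℕ) : ℚ) := by
    rw [Nat.div_add_mod]
  push_cast at this ⊢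
  constructor <;> intro h <;> linarith

theorem CyclicallyReduced.of_isCycle {u : Fin n} {C : G.Walk u u} (hC : C.IsCycle) :
    CyclicallyReduced C := by
  have h3 := hC.three_le_length
  have hnd := hC.isTrail.edges_nodup
  obtain ⟨a, b, h, r, h', rfl⟩ := C.exists_eq_cons_concat (by omega)
  refine (Cycle.chain_coe_iff _).2 ⟨List.Pairwise.isChain hnd, ?_⟩
  simp only [Walk.edges_cons, Walk.edges_concat, List.concat_eq_append, List.nodup_cons] at hnd
  simp only [Walk.edges_cons, Walk.edges_concat, List.concat_eq_append, List.getLast?_cons,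
    List.getLast?_append]
  simp only [List.mem_append, List.mem_singleton, not_or] at hnd
  simpa [eq_comm] using hnd.1.2

end Slack

/-! ### Counting steps instead of bits -/

theorem bitLength_le_iff {a : ℤ} {k : ℕ} : bitLength a ≤ k + 1 ↔ a.natAbs < 2 ^ k := by
  rw [bitLength, Nat.add_le_add_iff_right, Nat.size_le]

theorem natAbs_lt_of_bitLength_le {a : ℤ} {k : ℕ} (h : bitLength a ≤ k) :
    2 * a.natAbs < 2 ^ k := by
  cases k with
  | zero => simp [bitLength] at h
  | succ k => rw [pow_succ]; have := bitLength_le_iff.1 h; omega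

theorem bitLength_add_le {a b : ℤ} {k : ℕ} (ha : bitLength a ≤ k) (hb : bitLength b ≤ k) :
    bitLength (a + b) ≤ k + 1 := by
  rw [bitLength_le_iff]
  have h1 := natAbs_lt_of_bitLength_le ha
  have h2 := natAbs_lt_of_bitLength_le hb
  have := Int.natAbs_add_le a b
  omega

theorem bitLength_neg (a : ℤ) : bitLength (-a) = bitLength a := by
  simp [bitLength]

theorem bitLength_sub_le {a b : ℤ} {k : ℕ} (ha : bitLength a ≤ k) (hb : bitLength b ≤ k) :
    bitLength (a - b) ≤ k + 1 := by
  rw [sub_eq_add_neg]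
  exact bitLength_add_le ha (by rwa [bitLength_neg])

theorem bitLength_mul_le {a b : ℤ} {k l : ℕ} (ha : bitLength a ≤ k) (hb : bitLength b ≤ l) :
    bitLength (a * b) ≤ k + l := by
  have h1 := natAbs_lt_of_bitLength_le ha
  have h2 := natAbs_lt_of_bitLength_le hb
  have h3 : 2 * (2 * (a * b).natAbs) < 2 ^ (k + l) := by
    rw [Int.natAbs_mul, pow_add]
    calc 2 * (2 * (a.natAbs * b.natAbs)) = 2 * a.natAbs * (2 * b.natAbs) := by ring
      _ < 2 ^ k * 2 ^ l := Nat.mul_lt_mul'' h1 h2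
  rcases Nat.eq_zero_or_pos (k + l) with h | h
  · rw [h] at h3
    have : k = 0 := by omega
    simp [this, bitLength] at ha
  · obtain ⟨m, hm⟩ : ∃ m, k + l = m + 1 := ⟨k + l - 1, by omega⟩
    rw [hm, bitLength_le_iff]
    rw [hm, pow_succ] at h3
    omega

theorem one_le_bitLength (a : ℤ) : 1 ≤ bitLength a := by simp [bitLength]

namespace RamState

@[simp] theorem setReg_reg (σ : RamState) (r : ℕ) (a : ℤ) (x : ℕ) :
    (σ.setReg r a).reg x = if x = r then a else σ.reg x := by
  simp [setReg, Function.update_apply]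

@[simp] theorem setReg_mem (σ : RamState) (r : ℕ) (a : ℤ) : (σ.setReg r a).mem = σ.mem := rfl

@[simp] theorem setMem_reg (σ : RamState) (i a : ℤ) : (σ.setMem i a).reg = σ.reg := rfl

@[simp] theorem setMem_mem (σ : RamState) (i a : ℤ) :
    (σ.setMem i a).mem = Function.update σ.mem i a := rfl

/-- All numbers stored in the state have bit length at most `b`. -/
def Bounded (σ : RamState) (b : ℕ) : Prop :=
  (∀ r, bitLength (σ.reg r) ≤ b) ∧ ∀ i, bitLength (σ.mem i) ≤ b

theorem Bounded.mono {σ : RamState} {b b' : ℕ} (h : σ.Bounded b) (hb : b ≤ b') : σ.Bounded b' :=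
  ⟨fun r => (h.1 r).trans hb, fun i => (h.2 i).trans hb⟩

theorem Bounded.setReg {σ : RamState} {b b' : ℕ} (h : σ.Bounded b) (hb : b ≤ b') {r : ℕ} {a : ℤ}
    (ha : bitLength a ≤ b') : (σ.setReg r a).Bounded b' := by
  refine ⟨fun x => ?_, fun i => (h.2 i).trans hb⟩
  rw [setReg_reg]
  split_ifs
  · exact ha
  · exact (h.1 x).trans hb

theorem Bounded.setMem {σ : RamState} {b b' : ℕ} (h : σ.Bounded b) (hb : b ≤ b') {i a : ℤ}
    (ha : bitLength a ≤ b') : (σ.setMem i a).Bounded b' := by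
  refine ⟨fun x => (h.1 x).trans hb, fun j => ?_⟩
  rw [setMem_mem, Function.update_apply]
  split_ifs
  · exact ha
  · exact (h.2 j).trans hb

end RamState

/-- `P` takes `σ` to `τ` in `s` weighted steps, each of which lengthens the stored numbers by at
most `B + 1` bits. -/
def RamRuns (B : ℕ) (P : RamProgram) (σ τ : RamState) (s : ℕ) : Prop :=
  ∀ b, σ.Bounded b → τ.Bounded (b + s * (B + 1)) ∧
    ∃ t ≤ s * (2 * (b + s * (B + 1))), RamExec P σ τ t

/-- From `σ`, within `s` weighted steps, `P` halts in a state satisfying `Q`. -/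
def RamReaches (B s : ℕ) (P : RamProgram) (σ : RamState) (Q : RamState → Prop) : Prop :=
  ∃ τ, RamRuns B P σ τ s ∧ Q τ

/-! ### Rules for counting weighted steps -/

namespace RamReaches

variable {B s s' : ℕ} {P P' : RamProgram} {σ : RamState} {Q Q' : RamState → Prop}

theorem mono (h : RamReaches B s P σ Q) (hs : s ≤ s') (hQ : ∀ τ, Q τ → Q' τ) :
    RamReaches B s' P σ Q' := by
  obtain ⟨τ, hr, hq⟩ := h
  refine ⟨τ, fun b hb => ?_, hQ τ hq⟩
  obtain ⟨h1, t, ht, he⟩ := hr b hb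
  have h2 : b + s * (B + 1) ≤ b + s' * (B + 1) := by gcongr
  refine ⟨h1.mono h2, t, ht.trans ?_, he⟩
  gcongr

theorem comp (h : RamReaches B s P σ fun τ => RamReaches B s' P' τ Q) :
    RamReaches B (s + s') (.comp P P') σ Q := by
  obtain ⟨τ, h1, ρ, h2, hq⟩ := h
  refine ⟨ρ, fun b hb => ?_, hq⟩
  obtain ⟨hb1, t, ht, he⟩ := h1 b hb
  obtain ⟨hb2, u, hu, he'⟩ := h2 _ hb1
  refine ⟨hb2.mono (by rw [add_mul]; omega), t + u, ?_, .comp he he'⟩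
  calc t + u ≤ s * (2 * (b + (s + s') * (B + 1))) + s' * (2 * (b + (s + s') * (B + 1))) := by
        refine add_le_add (ht.trans ?_) (hu.trans ?_)
        · gcongr; omega
        · rw [add_mul s, add_assoc]
    _ = _ := by ring

theorem of_step {τ : RamState} (h : ∀ b, σ.Bounded b → τ.Bounded (b + (B + 1)) ∧
    ∃ t ≤ 2 * b, RamExec P σ τ t) (hQ : Q τ) : RamReaches B 1 P σ Q := by
  refine ⟨τ, fun b hb => ?_, hQ⟩
  obtain ⟨h1, t, ht, he⟩ := h b hb
  exact ⟨by simpa using h1, t, by omega, he⟩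

/-- A constant may be longer than anything stored so far, hence the weight. -/
theorem const {r : ℕ} {a : ℤ} (hQ : Q (σ.setReg r a)) :
    RamReaches B (bitLength a) (.const r a) σ Q := by
  refine ⟨_, fun b hb => ⟨?_, _, ?_, .const r a σ⟩, hQ⟩
  · exact hb.setReg (by omega) (by nlinarith)
  · have := one_le_bitLength a
    nlinarith [Nat.zero_le (bitLength a * B), Nat.zero_le b]

theorem add {r x y : ℕ} (hQ : Q (σ.setReg r (σ.reg x + σ.reg y))) :
    RamReaches B 1 (.add r x y) σ Q :=
  of_step (fun b hb => ⟨hb.setReg (by omega)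
    ((bitLength_add_le (hb.1 x) (hb.1 y)).trans (by omega)), _,
    by have := hb.1 x; have := hb.1 y; omega, .add r x y σ⟩) hQ

theorem sub {r x y : ℕ} (hQ : Q (σ.setReg r (σ.reg x - σ.reg y))) :
    RamReaches B 1 (.sub r x y) σ Q :=
  of_step (fun b hb => ⟨hb.setReg (by omega)
    ((bitLength_sub_le (hb.1 x) (hb.1 y)).trans (by omega)), _,
    by have := hb.1 x; have := hb.1 y; omega, .sub r x y σ⟩) hQ

/-- A short second factor rules out repeated squaring, so lengths grow only linearly in the number
of steps. -/
theorem mul {r x y : ℕ} (hy : bitLength (σ.reg y) ≤ B)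
    (hQ : Q (σ.setReg r (σ.reg x * σ.reg y))) : RamReaches B 1 (.mul r x y) σ Q :=
  of_step (fun b hb => ⟨hb.setReg (by omega)
    ((bitLength_mul_le (hb.1 x) hy).trans (by omega)), _,
    by have := hb.1 x; have := hb.1 y; omega, .mul r x y σ⟩) hQ

theorem load {r x : ℕ} (hQ : Q (σ.setReg r (σ.mem (σ.reg x)))) :
    RamReaches B 1 (.load r x) σ Q :=
  of_step (fun b hb => ⟨hb.setReg (by omega) ((hb.2 _).trans (by omega)), _,
    by have := hb.1 x; have := hb.2 (σ.reg x); omega, .load r x σ⟩) hQ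

theorem store {r x : ℕ} (hQ : Q (σ.setMem (σ.reg r) (σ.reg x))) :
    RamReaches B 1 (.store r x) σ Q :=
  of_step (fun b hb => ⟨hb.setMem (by omega) ((hb.1 x).trans (by omega)), _,
    by have := hb.1 x; have := hb.1 r; omega, .store r x σ⟩) hQ

theorem test_of {R : RamProgram} {r : ℕ}
    (hR : ∀ τ t, RamExec P σ τ t → RamExec R σ τ (bitLength (σ.reg r) + t))
    (h : RamReaches B s P σ Q) : RamReaches B (s + 1) R σ Q := by
  obtain ⟨τ, h1, hq⟩ := h
  refine ⟨τ, fun b hb => ?_, hq⟩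
  obtain ⟨hb1, t, ht, he⟩ := h1 b hb
  refine ⟨hb1.mono (by rw [add_mul]; omega), _, ?_, hR τ t he⟩
  have h2 := hb.1 r
  calc bitLength (σ.reg r) + t ≤ b + s * (2 * (b + s * (B + 1))) := by omega
    _ ≤ (s + 1) * (2 * (b + (s + 1) * (B + 1))) := by
      rw [add_mul s 1, one_mul, add_comm]
      gcongr
      · omega
      · omega

theorem branch {r : ℕ} (hpos : 0 < σ.reg r → RamReaches B s P σ Q)
    (hnonpos : σ.reg r ≤ 0 → RamReaches B s P' σ Q) :
    RamReaches B (s + 1) (.branch r P P') σ Q := by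
  rcases lt_or_ge 0 (σ.reg r) with h | h
  · exact test_of (fun _ _ he => .branchPos h he) (hpos h)
  · exact test_of (fun _ _ he => .branchNonpos h he) (hnonpos h)

theorem loop_nonpos {r : ℕ} (h : σ.reg r ≤ 0) (hQ : Q σ) : RamReaches B 1 (.loop r P) σ Q :=
  of_step (fun b hb => ⟨hb.mono (by omega), _, by have := hb.1 r; omega, .loopNonpos h⟩) hQ

theorem loop_pos {r : ℕ} (h : 0 < σ.reg r)
    (hP : RamReaches B s P σ fun τ => RamReaches B s' (.loop r P) τ Q) :
    RamReaches B (s + s' + 1) (.loop r P) σ Q := by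
  -- A loop whose test succeeds is a test followed by the body and the same loop again.
  refine test_of (r := r) (P := .comp P (.loop r P)) (fun τ t he => ?_) hP.comp
  cases he with
  | comp h1 h2 => rw [← add_assoc]; exact .loopPos h h1 h2

/-- A loop that counts a register down to zero. -/
theorem countdown {r : ℕ} (k : ℕ) (I : ℕ → RamState → Prop)
    (hI : ∀ j < k, ∀ σ, I j σ → σ.reg r = k - j →
      RamReaches B s P σ fun τ => I (j + 1) τ ∧ τ.reg r = k - (j + 1))
    (h0 : I 0 σ) (hr : σ.reg r = k) :
    RamReaches B (k * (s + 1) + 1) (.loop r P) σ (I k) := by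
  suffices H : ∀ l j, j + l = k → ∀ σ, I j σ → σ.reg r = k - j →
      RamReaches B (l * (s + 1) + 1) (.loop r P) σ (I k) from
    H k 0 (by omega) σ h0 (by simpa using hr)
  intro l
  induction l with
  | zero =>
    intro j hj σ hσ hr
    obtain rfl : j = k := by omega
    exact (loop_nonpos (by omega) hσ).mono (by omega) fun _ h => h
  | succ l ih =>
    intro j hj σ hσ hr
    refine (loop_pos (s := s) (by omega) ((hI j (by omega) σ hσ hr).mono le_rfl
      fun τ hτ => ih (j + 1) (by omega) τ hτ.1 (by push_cast; exact hτ.2))).mono ?_ fun _ h => h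
    rw [add_mul l 1]; omega

end RamReaches

/-! ### A language of expressions with bounded iteration -/

/-- Integer expressions over thirty-two variables, an accumulator, the input memory and the working
memory. Iterations run `n` times, where `n` is a global parameter. -/
inductive LoopExpr : Type
  | var (i : Fin 32)
  | acc
  | lit (a : ℤ)
  | add (a b : LoopExpr)
  | sub (a b : LoopExpr)
  /-- multiplication by `n` -/
  | mulSize (a : LoopExpr)
  /-- the input entry at a nonnegative address -/
  | input (a : LoopExpr)
  /-- multiplication by the input entry at a nonnegative address -/
  | mulInput (a b : LoopExpr)
  /-- the working memory at an address -/
  | work (a : LoopExpr)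
  /-- test for positivity -/
  | ite (c a b : LoopExpr)
  /-- iterate over `i = 0, …, n - 1`, updating the accumulator -/
  | fold (i : Fin 32) (init body : LoopExpr)

/-- Commands that write to the working memory. -/
inductive LoopCmd : Type
  | store (a e : LoopExpr)
  | forLoop (i : Fin 32) (c : LoopCmd)
  | seq (c c' : LoopCmd)

/-- Iterate an update of an accumulator. -/
def iterAcc (f : ℕ → ℤ → ℤ) (x : ℤ) : ℕ → ℤ
  | 0 => x
  | k + 1 => f k (iterAcc f x k)

/-- Iterate an update of the memory. -/
def iterMem (f : ℕ → (ℤ → ℤ) → ℤ → ℤ) (m : ℤ → ℤ) : ℕ → ℤ → ℤ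
  | 0 => m
  | k + 1 => f k (iterMem f m k)

namespace LoopExpr

/-- The value of an expression. The working memory occupies the negative addresses. -/
def eval (n : ℕ) (m : ℤ → ℤ) : LoopExpr → (Fin 32 → ℤ) → ℤ → ℤ
  | var i, ρ, _ => ρ i
  | acc, _, x => x
  | lit a, _, _ => a
  | add a b, ρ, x => eval n m a ρ x + eval n m b ρ x
  | sub a b, ρ, x => eval n m a ρ x - eval n m b ρ x
  | mulSize a, ρ, x => eval n m a ρ x * n
  | input a, ρ, x => if 0 ≤ eval n m a ρ x then m (eval n m a ρ x) else 0
  | mulInput a b, ρ, x =>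
      eval n m a ρ x * if 0 ≤ eval n m b ρ x then m (eval n m b ρ x) else 0
  | work a, ρ, x => m (-1 - eval n m a ρ x)
  | ite c a b, ρ, x => if 0 < eval n m c ρ x then eval n m a ρ x else eval n m b ρ x
  | fold i init body, ρ, x =>
      iterAcc (fun k y => eval n m body (Function.update ρ i k) y) (eval n m init ρ x) n

/-- Read the input at the nonnegative address in register `d`. -/
def readInput (d : ℕ) : RamProgram :=
  .comp (.add d d 35) (.branch d (.comp (.sub d d 35) (.load d d)) (.const d 0))

/-- Code that puts the value of an expression into register `d`. The variables are in the registers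
below `32`, the accumulator in register `32`, and the constants `n`, `0`, `1` in the registers
`33`, `34`, `35`. -/
def compile : LoopExpr → ℕ → RamProgram
  | var i, d => .add d i 34
  | acc, d => .add d 32 34
  | lit a, d => .const d a
  | add a b, d => .comp (compile a d) (.comp (compile b (d + 1)) (.add d d (d + 1)))
  | sub a b, d => .comp (compile a d) (.comp (compile b (d + 1)) (.sub d d (d + 1)))
  | mulSize a, d => .comp (compile a d) (.mul d d 33)
  | input a, d => .comp (compile a d) (readInput d)
  | mulInput a b, d =>
      .comp (compile a d) (.comp (compile b (d + 1))
        (.comp (readInput (d + 1)) (.mul d d (d + 1))))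
  | work a, d =>
      .comp (compile a d) (.comp (.add d d 35) (.comp (.sub d 34 d) (.load d d)))
  | ite c a b, d => .comp (compile c d) (.branch d (compile a d) (compile b d))
  | fold i init body, d =>
      .comp (compile init d) (.comp (.add (d + 1) i 34) (.comp (.add (d + 2) 32 34)
      (.comp (.add 32 d 34) (.comp (.add i 34 34) (.comp (.add (d + 3) 33 34)
      (.comp (.loop (d + 3) (.comp (compile body (d + 4)) (.comp (.add 32 (d + 4) 34)
        (.comp (.add i i 35) (.sub (d + 3) (d + 3) 35)))))
      (.comp (.add d 32 34) (.comp (.add i (d + 1) 34) (.add 32 (d + 2) 34)))))))))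

open Polynomial in
/-- A bound for the number of weighted steps. -/
noncomputable def steps : LoopExpr → Polynomial ℕ
  | var _ => 1
  | acc => 1
  | lit a => C (bitLength a)
  | add a b => steps a + (steps b + 1)
  | sub a b => steps a + (steps b + 1)
  | mulSize a => steps a + 1
  | input a => steps a + 4
  | mulInput a b => steps a + (steps b + (4 + 1))
  | work a => steps a + 3
  | ite c a b => steps c + (steps a + steps b + 1)
  | fold _ init body => steps init + (1 + (1 + (1 + (1 + (1 +
      ((X * (steps body + 3 + 1) + 1) + (1 + (1 + 1))))))))

end LoopExpr

/-- The constants are in their registers, and `n` and the input entries are short. -/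
structure RamReady (B n : ℕ) (σ : RamState) : Prop where
  size : σ.reg 33 = n
  zero : σ.reg 34 = 0
  one : σ.reg 35 = 1
  size_short : bitLength n ≤ B
  input_short : ∀ a, 0 ≤ a → bitLength (σ.mem a) ≤ B

theorem RamReady.congr {B n : ℕ} {σ τ : RamState} (h : RamReady B n σ)
    (hm : ∀ a, 0 ≤ a → τ.mem a = σ.mem a) (hr : ∀ r, 33 ≤ r → r < 36 → τ.reg r = σ.reg r) :
    RamReady B n τ where
  size := by rw [hr 33 (by omega) (by omega), h.size]
  zero := by rw [hr 34 (by omega) (by omega), h.zero]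
  one := by rw [hr 35 (by omega) (by omega), h.one]
  size_short := h.size_short
  input_short a ha := by rw [hm a ha]; exact h.input_short a ha

/-! ### Correctness of compiled expressions -/

namespace LoopExpr

/-- The machine tests for strict positivity, so the address is raised by one for the test and
lowered again before reading. -/
theorem readInput_reaches {B n d : ℕ} {σ : RamState} (hσ : RamReady B n σ) (hd : 36 ≤ d)
    {Q : RamState → Prop}
    (hQ : ∀ τ, τ.mem = σ.mem → τ.reg d = (if 0 ≤ σ.reg d then σ.mem (σ.reg d) else 0) →
      (∀ r, r ≠ d → τ.reg r = σ.reg r) → Q τ) :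
    RamReaches B 4 (readInput d) σ Q := by
  have h35 : 35 ≠ d := by omega
  refine .comp (s := 1) (s' := 3) (.add (.branch (s := 2) (fun h => ?_) fun h => ?_))
  · simp only [RamState.setReg_reg, if_true, hσ.one] at h
    refine .comp (s := 1) (s' := 1) (.sub (.load (hQ _ rfl ?_ ?_)))
    · simp [h35, hσ.one, show 0 ≤ σ.reg d by omega]
    · intro r hr
      simp [hr]
  · simp only [RamState.setReg_reg, if_true, hσ.one] at h
    refine RamReaches.mono (RamReaches.const (hQ _ rfl ?_ ?_))
      (show bitLength 0 ≤ 2 by simp [bitLength]) fun _ h => h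
    · simp [show ¬ 0 ≤ σ.reg d by omega]
    · intro r hr
      simp [hr]

end LoopExpr

/-- The number `d` acts as a stack pointer. Variables, accumulator, constants and pending
intermediate values lie below it, and the clause on registers below `d` is what makes the induction
compose. -/
theorem LoopExpr.compile_reaches {B n : ℕ} (e : LoopExpr) (d : ℕ) (hd : 36 ≤ d) (σ : RamState)
    (hσ : RamReady B n σ) :
    RamReaches B (e.steps.eval n) (e.compile d) σ fun τ =>
      τ.mem = σ.mem ∧ τ.reg d = e.eval n σ.mem (fun i => σ.reg i) (σ.reg 32) ∧
      ∀ r < d, τ.reg r = σ.reg r := by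
  have ready : ∀ {σ τ : RamState}, RamReady B n σ → τ.mem = σ.mem →
      (∀ r < 36, 33 ≤ r → τ.reg r = σ.reg r) → RamReady B n τ := fun h hm hr =>
    h.congr (fun a _ => by rw [hm]) fun r h1 h2 => hr r h2 h1
  induction e generalizing d σ with
  | var i =>
    rw [steps, Polynomial.eval_one]
    refine .add ⟨rfl, by simp [eval, hσ.zero], fun r hr => by simp [hr.ne]⟩
  | acc =>
    rw [steps, Polynomial.eval_one]
    refine .add ⟨rfl, by simp [eval, hσ.zero], fun r hr => by simp [hr.ne]⟩
  | lit a =>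
    rw [steps, Polynomial.eval_C]
    refine .const ⟨rfl, by simp [eval], fun r hr => by simp [hr.ne]⟩
  | add a b iha ihb =>
    simp only [steps, Polynomial.eval_add, Polynomial.eval_one]
    refine .comp ((iha d hd σ hσ).mono le_rfl fun τ ⟨hm, hv, hr⟩ => ?_)
    have hτ := ready hσ hm fun r h1 h2 => hr r (by omega)
    refine .comp ((ihb (d + 1) (by omega) τ hτ).mono le_rfl fun υ ⟨hm', hv', hr'⟩ => .add ?_)
    have hρ : (fun i : Fin 32 => τ.reg i) = fun i : Fin 32 => σ.reg i :=
      funext fun i => hr _ (by omega)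
    refine ⟨hm'.trans hm, ?_, fun r h => ?_⟩
    · simp [eval, hv', hr' d (by omega), hv, hm, hρ, hr 32 (by omega)]
    · simp [h.ne, hr' r (by omega), hr r h]
  | sub a b iha ihb =>
    simp only [steps, Polynomial.eval_add, Polynomial.eval_one]
    refine .comp ((iha d hd σ hσ).mono le_rfl fun τ ⟨hm, hv, hr⟩ => ?_)
    have hτ := ready hσ hm fun r h1 h2 => hr r (by omega)
    refine .comp ((ihb (d + 1) (by omega) τ hτ).mono le_rfl fun υ ⟨hm', hv', hr'⟩ => .sub ?_)
    have hρ : (fun i : Fin 32 => τ.reg i) = fun i : Fin 32 => σ.reg i :=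
      funext fun i => hr _ (by omega)
    refine ⟨hm'.trans hm, ?_, fun r h => ?_⟩
    · simp [eval, hv', hr' d (by omega), hv, hm, hρ, hr 32 (by omega)]
    · simp [h.ne, hr' r (by omega), hr r h]
  | mulSize a iha =>
    simp only [steps, Polynomial.eval_add, Polynomial.eval_one]
    refine .comp ((iha d hd σ hσ).mono le_rfl fun τ ⟨hm, hv, hr⟩ => ?_)
    have hτ := ready hσ hm fun r h1 h2 => hr r (by omega)
    refine .mul (by rw [hτ.size]; exact hτ.size_short) ⟨hm, ?_, fun r h => ?_⟩
    · simp [eval, hv, hτ.size]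
    · simp [h.ne, hr r h]
  | input a iha =>
    simp only [steps, Polynomial.eval_add, Polynomial.eval_ofNat]
    refine .comp ((iha d hd σ hσ).mono le_rfl fun τ ⟨hm, hv, hr⟩ => ?_)
    have hτ := ready hσ hm fun r h1 h2 => hr r (by omega)
    refine readInput_reaches hτ hd fun υ hm' hv' hr' => ⟨hm'.trans hm, ?_, fun r h => ?_⟩
    · simp [eval, hv', hv, hm]
    · simp [hr' r h.ne, hr r h]
  | mulInput a b iha ihb =>
    simp only [steps, Polynomial.eval_add, Polynomial.eval_one, Polynomial.eval_ofNat]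
    refine .comp ((iha d hd σ hσ).mono le_rfl fun τ ⟨hm, hv, hr⟩ => ?_)
    have hτ := ready hσ hm fun r h1 h2 => hr r (by omega)
    refine .comp ((ihb (d + 1) (by omega) τ hτ).mono le_rfl fun υ ⟨hm', hv', hr'⟩ => ?_)
    have hυ := ready hτ hm' fun r h1 h2 => hr' r (by omega)
    have hρ : (fun i : Fin 32 => τ.reg i) = fun i : Fin 32 => σ.reg i :=
      funext fun i => hr _ (by omega)
    refine .comp (readInput_reaches hυ (by omega) fun φ hm2 hv2 hr2 => .mul ?_ ?_)
    · rw [hv2]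
      split_ifs with h
      · exact hυ.input_short _ h
      · simp only [bitLength, Int.natAbs_zero, Nat.size_zero]
        exact (one_le_bitLength n).trans hσ.size_short
    · refine ⟨hm2.trans (hm'.trans hm), ?_, fun r h => ?_⟩
      · simp [eval, hv2, hr2 d (by omega), hr' d (by omega), hv', hv, hm', hm, hρ,
          hr 32 (by omega)]
      · simp [h.ne, hr2 r (by omega), hr' r (by omega), hr r h]
  | work a iha =>
    simp only [steps, Polynomial.eval_add, Polynomial.eval_ofNat]
    refine .comp ((iha d hd σ hσ).mono le_rfl fun τ ⟨hm, hv, hr⟩ => ?_)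
    have hτ := ready hσ hm fun r h1 h2 => hr r (by omega)
    refine .comp (s := 1) (s' := 2) (.add (.comp (s := 1) (s' := 1) (.sub (.load ⟨hm, ?_, ?_⟩))))
    · simp only [RamState.setReg_reg, RamState.setReg_mem, if_true, show 34 ≠ d by omega,
        if_false, eval, hv, hm, hτ.zero, hτ.one]
      congr 1
      ring
    · intro r h
      simp [h.ne, hr r h]
  | ite c a b ihc iha ihb =>
    simp only [steps, Polynomial.eval_add, Polynomial.eval_one]
    refine .comp ((ihc d hd σ hσ).mono le_rfl fun τ ⟨hm, hv, hr⟩ => ?_)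
    have hτ := ready hσ hm fun r h1 h2 => hr r (by omega)
    have hρ : (fun i : Fin 32 => τ.reg i) = fun i : Fin 32 => σ.reg i :=
      funext fun i => hr _ (by omega)
    refine .branch (fun h => ?_) fun h => ?_
    · refine (iha d hd τ hτ).mono (by omega) fun υ ⟨hm', hv', hr'⟩ =>
        ⟨hm'.trans hm, ?_, fun r h => (hr' r h).trans (hr r h)⟩
      rw [hv] at h
      simp [eval, hv', hm, hρ, hr 32 (by omega), h]
    · refine (ihb d hd τ hτ).mono (by omega) fun υ ⟨hm', hv', hr'⟩ =>
        ⟨hm'.trans hm, ?_, fun r h => (hr' r h).trans (hr r h)⟩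
      rw [hv] at h
      simp [eval, hv', hm, hρ, hr 32 (by omega), h.not_gt]
  | fold i init body ihi ihb =>
    simp only [steps, Polynomial.eval_add, Polynomial.eval_one, Polynomial.eval_mul,
      Polynomial.eval_X, Polynomial.eval_ofNat]
    have hi : (i : ℕ) < 32 := i.2
    refine .comp ((ihi d hd σ hσ).mono le_rfl fun τ ⟨hm, hv, hr⟩ => ?_)
    have hτ := ready hσ hm fun r h1 h2 => hr r (by omega)
    refine .comp (.add (.comp (.add (.comp (.add (.comp (.add (.comp (.add ?_)))))))))
    set f : ℕ → ℤ → ℤ := fun k y => body.eval n σ.mem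
      (Function.update (fun i : Fin 32 => σ.reg i) i k) y with hf
    set x := init.eval n σ.mem (fun i => σ.reg i) (σ.reg 32) with hx
    -- After `j` rounds the loop variable is `j` and the accumulator is the `j`-th iterate; the
    -- outer values of both are kept in the registers `d + 1` and `d + 2`.
    refine .comp ((RamReaches.countdown (s := body.steps.eval n + 3) n (fun j υ =>
      υ.mem = σ.mem ∧ (∀ r < d, r ≠ i → r ≠ 32 → υ.reg r = σ.reg r) ∧ υ.reg i = j ∧
      υ.reg 32 = iterAcc f x j ∧ υ.reg (d + 1) = σ.reg i ∧ υ.reg (d + 2) = σ.reg 32)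
      ?_ ?_ ?_).mono le_rfl ?_)
    · rintro j hj υ ⟨hυm, hυr, hυi, hυa, hυ1, hυ2⟩ hc
      have hυ := ready hσ hυm fun r h1 h2 => hυr r (by omega) (by omega) (by omega)
      refine .comp ((ihb (d + 4) (by omega) υ hυ).mono le_rfl fun φ ⟨hφm, hφv, hφr⟩ => ?_)
      have hφ := ready hυ hφm fun r h1 h2 => hφr r (by omega)
      refine .comp (s := 1) (s' := 2) (.add (.comp (s := 1) (s' := 1) (.add (.sub ?_))))
      have hρ : (fun k : Fin 32 => υ.reg k) =
          Function.update (fun i : Fin 32 => σ.reg i) i (j : ℤ) := by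
        funext k
        rw [Function.update_apply]
        split_ifs with hk
        · rw [hk, hυi]
        · exact hυr _ (by omega) (fun h => hk (Fin.ext h)) (by omega)
      refine ⟨⟨hφm.trans hυm, fun r h1 h2 h3 => ?_, ?_, ?_, ?_, ?_⟩, ?_⟩
      · simp [h2, h3, show r ≠ d + 3 by omega, hφr r (by omega), hυr r h1 h2 h3]
      · simp [show (i : ℕ) ≠ d + 3 by omega, hi.ne, hφr i (by omega), hυi, hφ.one]
      · simp [show 32 ≠ d + 3 by omega, hi.ne', hφv, hφ.zero, hυm, hρ, hυa, iterAcc, hf]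
      · simp [show d + 1 ≠ i by omega, show d + 1 ≠ 32 by omega, hφr (d + 1) (by omega), hυ1]
      · simp [show d + 2 ≠ i by omega, show d + 2 ≠ 32 by omega, hφr (d + 2) (by omega), hυ2]
      · simp [show d + 3 ≠ i by omega, show d + 3 ≠ 32 by omega, show 35 ≠ (i : ℕ) by omega,
          hφr (d + 3) (by omega), hc, hφ.one, sub_sub]
    · refine ⟨hm, fun r h1 h2 h3 => ?_, ?_, ?_, ?_, ?_⟩
      · simp [h2, h3, show r ≠ d + 3 by omega, show r ≠ d + 2 by omega, show r ≠ d + 1 by omega,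
          hr r h1]
      · simp [show (i : ℕ) ≠ d + 3 by omega, show 34 ≠ d + 1 by omega, show 34 ≠ d + 2 by omega,
          hτ.zero]
      · simp [show 32 ≠ d + 3 by omega, hi.ne', show d ≠ 32 by omega, show 34 ≠ d + 1 by omega,
          show 34 ≠ d + 2 by omega, hτ.zero, hv, iterAcc]
      · simp [show d + 1 ≠ i by omega, show d + 1 ≠ 32 by omega, hτ.zero, hr i (by omega)]
      · simp [show d + 2 ≠ i by omega, show d + 2 ≠ 32 by omega, show 34 ≠ d + 1 by omega,
          show 32 ≠ d + 1 by omega, hτ.zero, hr 32 (by omega)]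
    · simp [show 33 ≠ (i : ℕ) by omega, show 34 ≠ (i : ℕ) by omega, show 33 ≠ d + 1 by omega,
        show 33 ≠ d + 2 by omega, show 34 ≠ d + 1 by omega, show 34 ≠ d + 2 by omega, hτ.zero,
        hτ.size]
    · rintro υ ⟨hυm, hυr, hυi, hυa, hυ1, hυ2⟩
      have hυ := ready hσ hυm fun r h1 h2 => hυr r (by omega) (by omega) (by omega)
      refine .comp (.add (.comp (.add (.add ⟨hυm, ?_, fun r h => ?_⟩))))
      · simp [show d ≠ i by omega, show d ≠ 32 by omega, hυ.zero, hυa, eval, hf, hx]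
      -- The accumulator and the loop variable are the only registers below `d` that the loop
      -- changes, and both are restored.
      · by_cases h1 : r = 32
        · simp [h1, show d + 2 ≠ i by omega, show 34 ≠ d by omega, show 34 ≠ (i : ℕ) by omega,
            hυ.zero, hυ2]
        · by_cases h2 : r = i
          · simp [h2, hi.ne, show 34 ≠ d by omega, hυ.zero, hυ1]
          · simp [h1, h2, h.ne, hυr r h h2 h1]

/-! ### Commands and their compilation -/

namespace LoopCmd

/-- The effect of a command on the memory. Addresses of the working memory are shifted to the
negative addresses; writing to other addresses has no effect. -/
def run (n : ℕ) : LoopCmd → (Fin 32 → ℤ) → (ℤ → ℤ) → ℤ → ℤ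
  | store a e, ρ, m =>
      if 0 ≤ a.eval n m ρ 0 then Function.update m (-1 - a.eval n m ρ 0) (e.eval n m ρ 0) else m
  | forLoop i c, ρ, m => iterMem (fun k m' => run n c (Function.update ρ i k) m') m n
  | seq c c', ρ, m => run n c' ρ (run n c ρ m)

/-- Code for a command that uses the registers from `d` on as scratch space. -/
def compile : LoopCmd → ℕ → RamProgram
  | store a e, d =>
      .comp (a.compile d) (.comp (e.compile (d + 1)) (.comp (.add d d 35)
        (.branch d (.comp (.sub d 34 d) (.store d (d + 1))) (.add d d 34))))
  | forLoop i c, d =>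
      .comp (.add d i 34) (.comp (.add i 34 34) (.comp (.add (d + 1) 33 34)
      (.comp (.loop (d + 1) (.comp (compile c (d + 2)) (.comp (.add i i 35)
        (.sub (d + 1) (d + 1) 35)))) (.add i d 34))))
  | seq c c', d => .comp (compile c d) (compile c' d)

open Polynomial in
/-- A bound for the number of weighted steps. -/
noncomputable def steps : LoopCmd → Polynomial ℕ
  | store a e => a.steps + (e.steps + (1 + (2 + 1)))
  | forLoop _ c => 1 + (1 + (1 + ((X * (steps c + 2 + 1) + 1) + 1)))
  | seq c c' => steps c + steps c'

/-- The guard in a store confines all writes to negative addresses, so the input, and with it the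
bound on its entries, survives every command. -/
theorem run_nonneg (n : ℕ) (c : LoopCmd) (ρ : Fin 32 → ℤ) (m : ℤ → ℤ) {z : ℤ} (hz : 0 ≤ z) :
    c.run n ρ m z = m z := by
  induction c generalizing ρ m with
  | store a e =>
    simp only [run]
    split_ifs with h
    · rw [Function.update_of_ne (by omega)]
    · rfl
  | forLoop i c ih =>
    simp only [run]
    generalize hk : n = k
    suffices ∀ k, iterMem (fun k m' => run n c (Function.update ρ i k) m') m k z = m z by
      rw [← hk]; exact this n
    intro k
    induction k with
    | zero => rfl
    | succ k ihk => rw [iterMem, ih, ihk]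
  | seq c c' ih ih' => rw [run, ih', ih]

/-- Commands evaluate their expressions with accumulator zero, hence the condition on register 32,
which every command preserves. -/
theorem compile_reaches {B n : ℕ} (c : LoopCmd) (d : ℕ) (hd : 36 ≤ d) (σ : RamState)
    (hσ : RamReady B n σ) (h32 : σ.reg 32 = 0) :
    RamReaches B (c.steps.eval n) (c.compile d) σ fun τ =>
      τ.mem = c.run n (fun i => σ.reg i) σ.mem ∧ ∀ r < d, τ.reg r = σ.reg r := by
  have ready : ∀ {σ τ : RamState}, RamReady B n σ → (∀ a, 0 ≤ a → τ.mem a = σ.mem a) →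
      (∀ r < 36, 33 ≤ r → τ.reg r = σ.reg r) → RamReady B n τ := fun h hm hr =>
    h.congr hm fun r h1 h2 => hr r h2 h1
  induction c generalizing d σ with
  | store a e =>
    simp only [steps, Polynomial.eval_add, Polynomial.eval_one, Polynomial.eval_ofNat]
    refine .comp ((a.compile_reaches d hd σ hσ).mono le_rfl fun τ ⟨hm, hv, hr⟩ => ?_)
    have hτ := ready hσ (fun _ _ => by rw [hm]) fun r h1 h2 => hr r (by omega)
    refine .comp ((e.compile_reaches (d + 1) (by omega) τ hτ).mono le_rfl
      fun υ ⟨hm', hv', hr'⟩ => ?_)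
    have hυ := ready hτ (fun _ _ => by rw [hm']) fun r h1 h2 => hr' r (by omega)
    have hρ : (fun i : Fin 32 => τ.reg i) = fun i : Fin 32 => σ.reg i :=
      funext fun i => hr _ (by omega)
    have h34 : 34 ≠ d := by omega
    have hd' := hr' d (by omega)
    rw [hv, h32] at hd'
    rw [hm, hρ, hr 32 (by omega), h32] at hv'
    refine .comp (.add (.branch (fun h => ?_) fun h => ?_))
    · simp only [RamState.setReg_reg, if_true, hυ.one, hd'] at h
      refine .comp (s := 1) (s' := 1) (.sub (.store ⟨?_, fun r h' => ?_⟩))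
      · simp only [run, RamState.setReg_reg, RamState.setReg_mem, RamState.setMem_mem, if_true,
          hυ.one, hυ.zero, hd', hm', hm, if_neg h34, show d + 1 ≠ d by omega, if_false, hv']
        rw [if_pos (by omega)]
        congr 1
        ring
      · simp [h'.ne, hr' r (by omega), hr r h']
    · simp only [RamState.setReg_reg, if_true, hυ.one, hd'] at h
      refine RamReaches.mono (.add ⟨?_, fun r h' => ?_⟩) (show 1 ≤ 2 by norm_num) fun _ h => h
      · simp only [run, RamState.setReg_mem]
        rw [if_neg (by omega), hm', hm]
      · simp [h'.ne, hr' r (by omega), hr r h']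
  | forLoop i c ih =>
    simp only [steps, Polynomial.eval_add, Polynomial.eval_one, Polynomial.eval_mul,
      Polynomial.eval_X, Polynomial.eval_ofNat]
    have hi : (i : ℕ) < 32 := i.2
    refine .comp (.add (.comp (.add (.comp (.add ?_)))))
    set f : ℕ → (ℤ → ℤ) → ℤ → ℤ := fun k m' => run n c
      (Function.update (fun i : Fin 32 => σ.reg i) i k) m' with hf
    have hnn : ∀ j a, 0 ≤ a → iterMem f σ.mem j a = σ.mem a := fun j a ha => by
      induction j with
      | zero => rfl
      | succ j ihj => simp only [iterMem, hf]; rw [run_nonneg _ _ _ _ ha]; exact ihj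
    refine .comp ((RamReaches.countdown (s := c.steps.eval n + 2) n (fun j υ =>
      υ.mem = iterMem f σ.mem j ∧ (∀ r < d, r ≠ i → υ.reg r = σ.reg r) ∧ υ.reg i = j ∧
      υ.reg d = σ.reg i) ?_ ?_ ?_).mono le_rfl ?_)
    · rintro j hj υ ⟨hυm, hυr, hυi, hυ1⟩ hc
      have hυ := ready hσ (fun a ha => by rw [hυm, hnn j a ha])
        fun r h1 h2 => hυr r (by omega) (by omega)
      refine .comp ((ih (d + 2) (by omega) υ hυ (by rw [hυr 32 (by omega) (by omega), h32])).mono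
        le_rfl fun φ ⟨hφm, hφr⟩ => ?_)
      have hφ := ready hυ (fun a ha => by rw [hφm, run_nonneg _ _ _ _ ha])
        fun r h1 h2 => hφr r (by omega)
      refine .comp (s := 1) (s' := 1) (.add (.sub ?_))
      have hρ : (fun k : Fin 32 => υ.reg k) =
          Function.update (fun i : Fin 32 => σ.reg i) i (j : ℤ) := by
        funext k
        rw [Function.update_apply]
        split_ifs with hk
        · rw [hk, hυi]
        · exact hυr _ (by omega) fun h => hk (Fin.ext h)
      refine ⟨⟨?_, fun r h1 h2 => ?_, ?_, ?_⟩, ?_⟩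
      · simp only [RamState.setReg_mem, hφm, hυm, hρ, iterMem, hf]
      · simp [h2, show r ≠ d + 1 by omega, hφr r (by omega), hυr r h1 h2]
      · simp [show (i : ℕ) ≠ d + 1 by omega, hφr i (by omega), hυi, hφ.one]
      · simp [show d ≠ i by omega, hφr d (by omega), hυ1]
      · simp [show d + 1 ≠ i by omega, show 35 ≠ (i : ℕ) by omega,
          hφr (d + 1) (by omega), hc, hφ.one, sub_sub]
    · refine ⟨rfl, fun r h1 h2 => ?_, ?_, ?_⟩
      · simp [h2, h1.ne, show r ≠ d + 1 by omega]
      · simp [show (i : ℕ) ≠ d + 1 by omega, show 34 ≠ d by omega, hσ.zero]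
      · simp [show d ≠ i by omega, hσ.zero]
    · simp [show 33 ≠ (i : ℕ) by omega, show 34 ≠ (i : ℕ) by omega, show 33 ≠ d by omega,
        show 34 ≠ d by omega, hσ.zero, hσ.size]
    · rintro υ ⟨hυm, hυr, hυi, hυ1⟩
      have hυ := ready hσ (fun a ha => by rw [hυm, hnn n a ha])
        fun r h1 h2 => hυr r (by omega) (by omega)
      refine .add ⟨by rw [RamState.setReg_mem, hυm, run], fun r h => ?_⟩
      simp only [RamState.setReg_reg, hυ1, hυ.zero, add_zero]
      split_ifs with h1
      · rw [h1]
      · exact hυr r h h1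
  | seq c c' ih ih' =>
    simp only [steps, Polynomial.eval_add]
    refine .comp ((ih d hd σ hσ h32).mono le_rfl fun τ ⟨hm, hr⟩ => ?_)
    have hτ := ready hσ (fun a ha => by rw [hm, run_nonneg _ _ _ _ ha])
      fun r h1 h2 => hr r (by omega)
    have hρ : (fun i : Fin 32 => τ.reg i) = fun i : Fin 32 => σ.reg i :=
      funext fun i => hr _ (by omega)
    refine (ih' d hd τ hτ (by rw [hr 32 (by omega), h32])).mono le_rfl fun υ ⟨hm', hr'⟩ =>
      ⟨by rw [hm', hm, run, hρ], fun r h => (hr' r h).trans (hr r h)⟩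

end LoopCmd

/-- Copy the cells `-5, -7, -9, …` to `0, 1, 2, …` and the cell `-1` to register `0`. -/
def copyOutput : RamProgram :=
  .comp (.const 36 (-5)) (.comp (.const 37 0) (.comp (.add 38 33 34) (.comp (.const 39 2)
    (.comp (.loop 38 (.comp (.load 40 36) (.comp (.store 37 40) (.comp (.add 37 37 35)
      (.comp (.sub 36 36 39) (.sub 38 38 35))))))
    (.comp (.const 36 (-1)) (.load 0 36))))))

/-- The output word that `copyOutput` extracts from a memory. -/
def outputWord (m : ℤ → ℤ) : List ℤ :=
  (List.range (m (-1)).toNat).map fun j : ℕ => m (-5 - 2 * (j : ℤ))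

theorem ramOutput_eq (σ : RamState) :
    ramOutput σ = (List.range (σ.reg 0).toNat).map fun j : ℕ => σ.mem j := by
  simp [ramOutput, ← List.map_eq_flatMap]

/-- The copying loop always makes `n` rounds, so `hn` ensures that the whole output is copied.
Sources are negative and targets nonnegative, so they do not interfere; the input is overwritten but
no longer needed. -/
theorem copyOutput_reaches {B n : ℕ} (σ : RamState) (hσ : RamReady B n σ)
    (hn : σ.mem (-1) ≤ n) :
    RamReaches B (6 * n + 20) copyOutput σ fun τ => ramOutput τ = outputWord σ.mem := by
  refine RamReaches.mono (s := bitLength (-5) + (bitLength 0 + (1 + (bitLength 2 +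
    ((n * (5 + 1) + 1) + (bitLength (-1) + 1)))))) ?_ ?_ fun _ h => h
  swap
  · simp [bitLength, show Nat.size 5 = 3 from rfl, show Nat.size 2 = 2 from rfl]
    omega
  refine .comp (.const (.comp (.const (.comp (.add (.comp (.const ?_)))))))
  refine .comp ((RamReaches.countdown (s := 5) n (fun j υ =>
    (∀ z < 0, υ.mem z = σ.mem z) ∧ (∀ i : ℕ, i < j → υ.mem i = σ.mem (-5 - 2 * (i : ℤ))) ∧
    υ.reg 36 = -5 - 2 * (j : ℤ) ∧ υ.reg 37 = j ∧ υ.reg 35 = 1 ∧ υ.reg 39 = 2)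
    ?_ ?_ ?_).mono le_rfl ?_)
  · rintro j hj υ ⟨h1, h2, h36, h37, h35, h39⟩ hc
    refine .comp (s := 1) (s' := 4) (.load (.comp (s := 1) (s' := 3) (.store
      (.comp (s := 1) (s' := 2) (.add (.comp (s := 1) (s' := 1) (.sub (.sub ?_))))))))
    refine ⟨⟨fun z hz => ?_, fun i hi => ?_, ?_, ?_, ?_, ?_⟩, ?_⟩
    · simp [h36, h37, h1 _ hz, show z ≠ j by omega]
    · rcases Nat.lt_succ_iff_lt_or_eq.1 hi with hi | rfl
      · simp [h36, h37, h2 i hi, show (i : ℤ) ≠ j by omega]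
      · simp [h36, h37, h1 (-5 - 2 * (i : ℤ)) (by omega)]
    · simp [h36, h39]; ring
    · simp [h37, h35]
    · simp [h35]
    · simp [h39]
    · simp [hc, h35, sub_sub]
  · exact ⟨fun _ _ => rfl, fun i hi => by omega, by simp, by simp, by simp [hσ.one], by simp⟩
  · simp [hσ.zero, hσ.size]
  · rintro υ ⟨h1, h2, -⟩
    refine .comp (.const (.load ?_))
    simp only [ramOutput_eq, outputWord, RamState.setReg_reg, RamState.setReg_mem, if_true,
      h1 (-1) (by norm_num)]
    refine List.map_congr_left fun j hj => ?_
    rw [List.mem_range] at hj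
    exact h2 j (by omega)

/-! ### Polynomial running time -/

theorem Polynomial.eval_le_eval_of_le (q : Polynomial ℕ) {a b : ℕ} (h : a ≤ b) :
    q.eval a ≤ q.eval b := by
  simp only [Polynomial.eval_eq_sum, Polynomial.sum]
  gcongr

theorem bitLength_le_wordSize {l : List ℤ} {a : ℤ} (h : a ∈ l) : bitLength a ≤ wordSize l :=
  List.single_le_sum (by simp) _ (List.mem_map_of_mem h)

theorem length_le_wordSize (l : List ℤ) : l.length ≤ wordSize l := by
  induction l with
  | nil => simp
  | cons a l ih =>
    have := one_le_bitLength a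
    simp only [wordSize, List.map_cons, List.sum_cons, List.length_cons] at ih ⊢
    omega

theorem bitLength_natCast_le (k : ℕ) : bitLength (k : ℤ) ≤ k + 1 := by
  rw [bitLength_le_iff, Int.natAbs_natCast]
  exact Nat.lt_two_pow_self

/-- Every command can be turned into a random access machine that runs in polynomial time. -/
theorem LoopCmd.exists_ramProgram (c : LoopCmd) :
    ∃ (P : RamProgram) (q : Polynomial ℕ), ∀ (input : List ℤ) (n : ℕ), input.head? = some (n : ℤ) →
      n ≤ input.length → c.run n (fun _ => 0) (ramInput input).mem (-1) ≤ n →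
      ∃ t ≤ q.eval (wordSize input),
        RamComputes P input (outputWord (c.run n (fun _ => 0) (ramInput input).mem)) t := by
  open Polynomial in
  -- Register 34 is zero from the start, so the load fetches `n` from cell 0. Register 0 initially
  -- holds the input length and is cleared because it serves as a variable.
  refine ⟨.comp (.const 35 1) (.comp (.load 33 34) (.comp (.sub 0 0 0)
    (.comp (c.compile 36) copyOutput))),
    -- The number of steps times twice the largest bit length: initially at most `X + 1`, growing by
    -- at most `X + 1` per step.
    (c.steps + 6 * X + 24) * (2 * (X + 1 + (c.steps + 6 * X + 24) * (X + 1))),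
    fun input n hhead hlen hout => ?_⟩
  set W := wordSize input with hW
  have hmem : (n : ℤ) ∈ input := List.mem_of_head? hhead
  have hnW : bitLength n ≤ W := bitLength_le_wordSize hmem
  have hlW : input.length ≤ W := length_le_wordSize input
  have h0 : bitLength 0 ≤ W := le_trans (by simp [bitLength]) hnW
  have hshort : ∀ a, bitLength ((ramInput input).mem a) ≤ W := by
    intro a
    simp only [ramInput]
    split_ifs with ha
    · rw [List.getD_eq_getElem?_getD]
      rcases lt_or_ge a.toNat input.length with h | h
      · rw [List.getElem?_eq_getElem h]
        exact bitLength_le_wordSize (List.getElem_mem h)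
      · rw [List.getElem?_eq_none h]
        exact h0
    · exact h0
  have hbound : (ramInput input).Bounded (W + 1) := by
    refine ⟨fun r => ?_, fun a => (hshort a).trans (by omega)⟩
    simp only [ramInput]
    split_ifs with hr
    · exact (bitLength_natCast_le _).trans (by omega)
    · exact h0.trans (by omega)
  have hn0 : (ramInput input).mem 0 = n := by
    cases input with
    | nil => simp at hhead
    | cons a l => simpa [ramInput] using hhead
  have key : RamReaches W (2 + (1 + (1 + (c.steps.eval n + (6 * n + 20)))))
      (.comp (.const 35 1) (.comp (.load 33 34) (.comp (.sub 0 0 0)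
        (.comp (c.compile 36) copyOutput)))) (ramInput input)
      fun τ => ramOutput τ = outputWord (c.run n (fun _ => 0) (ramInput input).mem) := by
    refine .comp (RamReaches.mono (.const (.comp (.load (.comp (.sub ?_)))))
      (show bitLength 1 ≤ 2 by simp [bitLength]) fun _ h => h)
    have hreg : ∀ r, r ≠ 0 → (ramInput input).reg r = 0 := fun r hr => by simp [ramInput, hr]
    suffices H : ∀ σ : RamState, σ.mem = (ramInput input).mem → RamReady W n σ →
        (∀ r < 33, σ.reg r = 0) → RamReaches W (c.steps.eval n + (6 * n + 20))
          (.comp (c.compile 36) copyOutput) σ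
          fun τ => ramOutput τ = outputWord (c.run n (fun _ => 0) (ramInput input).mem) by
      refine H _ rfl ⟨by simp [hreg, hn0], by simp [hreg], by simp, hnW, fun a _ => hshort a⟩
        fun r hr => ?_
      rcases eq_or_ne r 0 with rfl | h
      · simp
      · simp [h, hreg r h, hr.ne, show r ≠ 35 by omega]
    intro σ hm hσ hr
    refine .comp ((c.compile_reaches 36 le_rfl σ hσ (hr 32 (by norm_num))).mono le_rfl
      fun τ ⟨hmτ, hrτ⟩ => ?_)
    rw [show (fun i : Fin 32 => σ.reg i) = fun _ => 0 from funext fun i => hr i (by omega), hm]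
      at hmτ
    rw [← hmτ] at hout ⊢
    exact copyOutput_reaches τ (hσ.congr (fun a ha => by rw [hmτ, run_nonneg _ _ _ _ ha, hm])
      fun r _ h => hrτ r h) hout
  obtain ⟨τ, hrun, hτ⟩ := key
  obtain ⟨-, t, ht, he⟩ := hrun _ hbound
  refine ⟨t, ht.trans ?_, τ, he, hτ⟩
  -- The number `n` itself occupies few bits, but the input has at least `n` entries, so a
  -- polynomial in `n` is polynomial in the word size.
  have hs := c.steps.eval_le_eval_of_le (hlen.trans hlW)
  have hnW' := hlen.trans hlW
  have hS : 2 + (1 + (1 + (c.steps.eval n + (6 * n + 20)))) ≤ c.steps.eval W + 6 * W + 24 := by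
    omega
  simp only [Polynomial.eval_mul, Polynomial.eval_add, Polynomial.eval_X, Polynomial.eval_ofNat,
    Polynomial.eval_one]
  gcongr

/-! ### Shortest reduced walks between darts -/

section DartDist

open SimpleGraph

variable {n : ℕ} {G : SimpleGraph (Fin n)} {c : Fin n → ℚ} {w : Sym2 (Fin n) → ℚ}

/-- For such lengths the threshold is zero, while the closed bound with `z = 0` makes the slack
nonnegative. -/
theorem SatisfiesBasic.length_mod_three_ne_zero (hb : SatisfiesBasic G c w) {x : Fin n}
    {A : G.Walk x x} (hA : CyclicallyReduced A) (h0 : 0 < A.length) (hv : WalkViolated c w A) :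
    A.length % 3 ≠ 0 := by
  intro h3
  obtain ⟨hc, hl⟩ := (Cycle.chain_coe_iff _).1 hA
  have := hb.walkSlack_closed_ge A hc h0 h3 0 fun e he f hf => by
    have := hb.vertex_two (A.head_mem_incidenceSet he) (A.getLast_mem_incidenceSet hf)
      (hl f hf e he).symm
    linarith
  rw [WalkViolated, show 2 * A.length % 3 = 0 by omega] at hv
  push_cast at hv
  linarith

open scoped Classical in
/-- The cost, capped at `M`, of a cheapest reduced walk of `k` steps from the dart `(u, v)` to the
dart `(x, y)`, where the step from `(u, v)` to `(v, t)` costs `a u v t`. -/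
noncomputable def dartDist (G : SimpleGraph (Fin n)) (a : Fin n → Fin n → Fin n → ℤ) (M : ℤ)
    (x y : Fin n) : ℕ → Fin n → Fin n → ℤ
  | 0, u, v => if u = x ∧ v = y then 0 else M
  | k + 1, u, v => (Finset.univ.filter fun t => G.Adj v t ∧ t ≠ u).fold min M
      fun t => a u v t + dartDist G a M x y k v t

variable {a : Fin n → Fin n → Fin n → ℤ} {M : ℤ} {x y : Fin n}

theorem dartDist_succ_le {k : ℕ} {u v t : Fin n} (h : G.Adj v t) (ht : t ≠ u) :
    dartDist G a M x y (k + 1) u v ≤ a u v t + dartDist G a M x y k v t :=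
  (Finset.fold_min_le _).2 (.inr ⟨t, by simp [h, ht], le_rfl⟩)

theorem exists_dartDist_succ_eq {k : ℕ} {u v : Fin n} (h : dartDist G a M x y (k + 1) u v < M) :
    ∃ t, G.Adj v t ∧ t ≠ u ∧
      dartDist G a M x y (k + 1) u v = a u v t + dartDist G a M x y k v t := by
  have h' := (Finset.fold_min_le (b := M)
    (f := fun t => a u v t + dartDist G a M x y k v t) _).1 (le_refl (dartDist G a M x y (k + 1) u v))
  rcases h' with h' | ⟨t, ht, hle⟩
  · exact absurd h (not_lt.2 h')
  · simp only [Finset.mem_filter, Finset.mem_univ, true_and] at ht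
    exact ⟨t, ht.1, ht.2, le_antisymm (dartDist_succ_le ht.1 ht.2) hle⟩

/-- The integer costs `a` are `L` times the slack of an edge and the following vertex. -/
def IsStepCost (G : SimpleGraph (Fin n)) (c : Fin n → ℚ) (w : Sym2 (Fin n) → ℚ) (L : ℤ)
    (a : Fin n → Fin n → Fin n → ℤ) : Prop :=
  ∀ u v t, G.Adj u v → G.Adj v t →
    (a u v t : ℚ) = L * (2 - c u - 2 * c v - 2 * w s(u, v) - w s(v, t))

variable {L : ℤ}

/-- A step costs the edge slack plus the drop of the dart potential `c u / 2 + w s(u, v)`. The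
potential cancels around closed walks. -/
theorem IsStepCost.eq (ha : IsStepCost G c w L a) {u v t : Fin n} (h : G.Adj u v)
    (h' : G.Adj v t) : (a u v t : ℚ) =
      L * (edgeSlack c w u v + (c u / 2 + w s(u, v)) - (c v / 2 + w s(v, t))) := by
  rw [ha u v t h h', edgeSlack]; ring

/-- The cost is the sum of the gaps in the edge inequality of `uv` and in the vertex inequality at
`v` restricted to the two distinct edges of the step. -/
theorem IsStepCost.nonneg (ha : IsStepCost G c w L a) (hb : SatisfiesBasic G c w) (hL : 0 < L)
    {u v t : Fin n} (h : G.Adj u v) (h' : G.Adj v t) (ht : t ≠ u) : 0 ≤ a u v t := by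
  have h1 := hb.edge u v h
  have h2 := hb.vertex_two (v := v) (e := s(u, v)) (f := s(v, t)) ⟨h, by simp⟩ ⟨h', by simp⟩
    (by simp [Ne.symm ht, h.ne])
  have h3 : (0 : ℚ) ≤ a u v t := by
    rw [ha u v t h h']
    have : (0 : ℚ) < L := by exact_mod_cast hL
    exact mul_nonneg this.le (by linarith)
  exact_mod_cast h3

/-- The final dart supplies a successor to every edge of the walk, and the potentials telescope.
Capping only decreases distances, so nothing is asked of `M`. -/
theorem dartDist_le_walk (ha : IsStepCost G c w L a) (hxy : G.Adj x y) {u : Fin n}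
    (q : G.Walk u x) (v : Fin n) (hch : (q.edges ++ [s(x, y)]).IsChain (· ≠ ·))
    (hv : (q.edges ++ [s(x, y)]).head? = some s(u, v)) :
    (dartDist G a M x y q.length u v : ℚ) ≤
      L * (walkSlack c w q + (c u / 2 + w s(u, v)) - (c x / 2 + w s(x, y))) := by
  induction q generalizing v with
  | nil =>
    obtain rfl : y = v := Sym2.congr_right.1 (Option.some.inj hv)
    simp [dartDist]
  | @cons u v' z h q ih =>
    obtain rfl : v' = v := Sym2.congr_right.1 (Option.some.inj hv)
    obtain ⟨t, ht, hvt⟩ : ∃ t, (q.edges ++ [s(z, y)]).head? = some s(v', t) ∧ G.Adj v' t := by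
      cases q with
      | nil => exact ⟨y, rfl, hxy⟩
      | cons h' q => exact ⟨_, rfl, h'⟩
    rw [Walk.edges_cons, List.cons_append, List.isChain_cons] at hch
    have htu : t ≠ u := by
      rintro rfl
      exact hch.1 _ ht Sym2.eq_swap
    have h1 := ih hxy t hch.2 ht
    have h2 : (dartDist G a M z y (q.length + 1) u v' : ℚ) ≤ a u v' t +
        dartDist G a M z y q.length v' t := by exact_mod_cast dartDist_succ_le hvt htu
    rw [ha.eq h hvt] at h2
    rw [Walk.length_cons, walkSlack_cons]
    refine h2.trans ((add_le_add le_rfl h1).trans (le_of_eq ?_))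
    ring

/-- Nonnegative costs keep the remaining distances below the cap, so the hypothesis on `s` applies
at every step. The sequence is given rather than chosen because it is the one that the program
traces back. -/
theorem exists_walk_of_dartDist_lt (ha : IsStepCost G c w L a) (hb : SatisfiesBasic G c w)
    (hL : 0 < L) (k : ℕ) (s : ℕ → Fin n) (h01 : G.Adj (s 0) (s 1))
    (hs : ∀ i < k, dartDist G a M x y (k - i) (s i) (s (i + 1)) < M →
      G.Adj (s (i + 1)) (s (i + 2)) ∧ s (i + 2) ≠ s i ∧
      dartDist G a M x y (k - i) (s i) (s (i + 1)) =
        a (s i) (s (i + 1)) (s (i + 2)) + dartDist G a M x y (k - i - 1) (s (i + 1)) (s (i + 2)))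
    (hlt : dartDist G a M x y k (s 0) (s 1) < M) :
    ∃ q : G.Walk (s 0) x, q.length = k ∧ (q.edges ++ [s(x, y)]).IsChain (· ≠ ·) ∧
      (q.edges ++ [s(x, y)]).head? = some s(s 0, s 1) ∧
      (dartDist G a M x y k (s 0) (s 1) : ℚ) =
        L * (walkSlack c w q + (c (s 0) / 2 + w s(s 0, s 1)) - (c x / 2 + w s(x, y))) ∧
      q.support.tail = (List.range k).map fun i => s (i + 1) := by
  induction k generalizing s with
  | zero =>
    obtain ⟨h0, h1⟩ : s 0 = x ∧ s 1 = y := by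
      by_contra hne
      simp [dartDist, hne] at hlt
    subst h0 h1
    exact ⟨.nil, by simp, by simp, by simp, by simp [dartDist], by simp⟩
  | succ k ih =>
    obtain ⟨hadj, hne, heq⟩ := hs 0 (by omega) hlt
    simp only [zero_add, Nat.sub_zero, Nat.add_sub_cancel] at hadj hne heq
    have hlt' : dartDist G a M x y k (s 1) (s 2) < M := by
      have := ha.nonneg hb hL h01 hadj hne
      omega
    obtain ⟨q, hq1, hq2, hq3, hq4, hq5⟩ := ih (fun i => s (i + 1)) hadj
      (fun i hi h => by
        have := hs (i + 1) (by omega)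
        rw [show k + 1 - (i + 1) = k - i by omega] at this
        exact this h) hlt'
    refine ⟨.cons h01 q, by simpa using hq1, ?_, by simp, ?_, ?_⟩
    · rw [Walk.edges_cons, List.cons_append, List.isChain_cons]
      refine ⟨fun e he => ?_, hq2⟩
      rw [hq3] at he
      obtain rfl : s(s 1, s 2) = e := by simpa using he
      simp [Ne.symm hne, h01.ne]
    · rw [heq]
      push_cast
      rw [hq4, ha.eq h01 hadj, walkSlack_cons]
      ring
    · rw [Walk.support_cons, List.tail_cons, ← Walk.cons_tail_support, hq5,
        List.range_succ_eq_map]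
      simp [Function.comp_def]

theorem CyclicallyReduced.exists_dartDist_lt (ha : IsStepCost G c w L a) (hL : 0 < L) {u : Fin n}
    {W : G.Walk u u} (h0 : 0 < W.length) (hW : CyclicallyReduced W) (hv : WalkViolated c w W) :
    ∃ x y, G.Adj x y ∧
      dartDist G a M x y W.length x y < L * ((2 * W.length % 3 : ℕ) : ℤ) := by
  cases W with
  | nil => simp at h0
  | @cons _ v _ h q =>
    refine ⟨u, v, h, ?_⟩
    have h1 := dartDist_le_walk (M := M) ha h (.cons h q) v (by simpa [CyclicallyReduced] using hW)
      (by simp)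
    have h2 : (dartDist G a M u v (Walk.cons h q).length u v : ℚ) <
        L * ((2 * (Walk.cons h q).length % 3 : ℕ) : ℚ) := by
      refine h1.trans_lt ?_
      have : (0 : ℚ) < L := by exact_mod_cast hL
      rw [add_sub_cancel_right]
      exact mul_lt_mul_of_pos_left hv this
    rw [← Int.cast_natCast, ← Int.cast_mul] at h2
    exact Int.cast_lt.1 h2

/-- The answer to the separation problem that is read off from the capped distances. -/
theorem isSeparationAnswer_of_dartDist (ha : IsStepCost G c w L a) (hb : SatisfiesBasic G c w)
    (hL : 0 < L) (K : ℕ) (s : ℕ → Fin n)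
    (hmin : ∀ k, 0 < k → k < K → ∀ x y, G.Adj x y →
      L * ((2 * k % 3 : ℕ) : ℤ) ≤ dartDist G a (2 * L) x y k x y)
    (hK : 0 < K) (h01 : G.Adj (s 0) (s 1))
    (hlt : dartDist G a (2 * L) (s 0) (s 1) K (s 0) (s 1) < L * ((2 * K % 3 : ℕ) : ℤ))
    (hs : ∀ i < K, dartDist G a (2 * L) (s 0) (s 1) (K - i) (s i) (s (i + 1)) < 2 * L →
      G.Adj (s (i + 1)) (s (i + 2)) ∧ s (i + 2) ≠ s i ∧
      dartDist G a (2 * L) (s 0) (s 1) (K - i) (s i) (s (i + 1)) =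
        a (s i) (s (i + 1)) (s (i + 2)) +
          dartDist G a (2 * L) (s 0) (s 1) (K - i - 1) (s (i + 1)) (s (i + 2))) :
    IsSeparationAnswer G c w ((List.range K).map fun i => ((s (i + 1) : ℕ) : ℤ)) := by
  -- A threshold is at most `2 * L`, so the cap hides no violated walk.
  have hlt2 : dartDist G a (2 * L) (s 0) (s 1) K (s 0) (s 1) < 2 * L := by
    have : ((2 * K % 3 : ℕ) : ℤ) ≤ 2 := by omega
    nlinarith
  obtain ⟨q, hq1, hq2, hq3, hq4, hq5⟩ := exists_walk_of_dartDist_lt ha hb hL K s h01 hs hlt2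
  have hred : CyclicallyReduced q := by
    cases q with
    | nil => simp at hq1; omega
    | cons h q =>
      have hv : s(_, _) = s(s 0, s 1) := Option.some.inj hq3
      rw [CyclicallyReduced, Walk.edges_cons, Cycle.chain_coe_cons, ← List.cons_append,
        ← Walk.edges_cons h, hv]
      exact hq2
  have hviol : WalkViolated c w q := by
    rw [add_sub_cancel_right] at hq4
    have : (0 : ℚ) < L := by exact_mod_cast hL
    rw [WalkViolated, hq1]
    refine lt_of_mul_lt_mul_left ?_ this.le
    rw [← hq4, ← Int.cast_natCast, ← Int.cast_mul]
    exact Int.cast_lt.2 hlt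
  have hq0 : 0 < q.length := by omega
  -- Otherwise a shorter violated reduced closed walk would exist, and its first dart would
  -- contradict the minimality of `K`.
  have hcyc : q.IsCycle := by
    by_contra hcyc
    obtain ⟨v, W, hW0, hW, hWv, hWlt⟩ := hb.exists_shorter_violated hq0 hred hviol hcyc
    obtain ⟨x, y, hxy, hd⟩ := hW.exists_dartDist_lt (M := 2 * L) ha hL hW0 hWv
    exact absurd hd (not_lt.2 (hmin _ hW0 (by omega) x y hxy))
  refine .inl ⟨s 0, q, ⟨hcyc, ?_⟩, (cycleViolation_pos_iff hcyc).2 hviol, ?_⟩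
  · have := hb.length_mod_three_ne_zero hred hq0 hviol
    simp only [Nat.ModEq]
    omega
  · simp [cycleWord, hq5, ← List.map_eq_flatMap]

/-- A violated cycle is a violated reduced closed walk, and its length is at most `n` because its
vertices are distinct. -/
theorem isSeparationAnswer_nil_of_dartDist (ha : IsStepCost G c w L a) (hL : 0 < L)
    (hmin : ∀ k, 0 < k → k ≤ n → ∀ x y, G.Adj x y →
      L * ((2 * k % 3 : ℕ) : ℤ) ≤ dartDist G a (2 * L) x y k x y) :
    IsSeparationAnswer G c w [] := by
  refine .inr ⟨rfl, fun u C hC => not_lt.1 fun hpos => ?_⟩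
  have hv := (cycleViolation_pos_iff hC.1).1 hpos
  have h0 : 0 < C.length := by have := hC.1.three_le_length; omega
  have hlen : C.length ≤ n := by
    have := hC.1.support_nodup.length_le_card
    simpa using this
  obtain ⟨x, y, hxy, hd⟩ := (CyclicallyReduced.of_isCycle hC.1).exists_dartDist_lt (M := 2 * L)
    ha hL h0 hv
  exact absurd hd (not_lt.2 (hmin _ h0 hlen x y hxy))

end DartDist

/-! ### The separation program -/

namespace LoopExpr

instance : Add LoopExpr := ⟨.add⟩
instance : Sub LoopExpr := ⟨.sub⟩
instance (k : ℕ) : OfNat LoopExpr k := ⟨.lit k⟩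

/-- The parameter `n`. -/
def size : LoopExpr := mulSize 1

/-- Choose by equality. -/
def ifEq (a b e e' : LoopExpr) : LoopExpr := ite (a - b) e' (ite (b - a) e' e)

/-- The first `i < n` for which the condition is positive, and `n` if there is none. -/
def find (i : Fin 32) (cond : LoopExpr) : LoopExpr :=
  fold i size (ite (size - acc) acc (ite cond (var i) size))

/-- The address of the record of a pair of vertices. -/
def pairAddr (u v : LoopExpr) : LoopExpr :=
  1 + (size + size) + (mulSize u + v + (mulSize u + v) + (mulSize u + v))

def adj (u v : LoopExpr) : LoopExpr := input (pairAddr u v)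

/-- The record of `v` starts at address `1 + 2 * v`, with the numerator before the denominator. -/
def timesVertexDen (v : LoopExpr) : LoopExpr := mulInput acc (2 + (v + v))

def timesEdgeDen (u v : LoopExpr) : LoopExpr := mulInput acc (pairAddr u v + 2)

/-- The product of all denominators. -/
def scale : LoopExpr :=
  fold 29 (fold 29 1 (timesVertexDen (var 29))) (fold 30 acc (timesEdgeDen (var 29) (var 30)))

/-- The weight of a vertex, scaled to an integer. -/
def scaledVertex (v : LoopExpr) : LoopExpr :=
  fold 29 (fold 29 (input (1 + (v + v))) (ifEq (var 29) v acc (timesVertexDen (var 29))))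
    (fold 30 acc (timesEdgeDen (var 29) (var 30)))

/-- The weight of an edge, scaled to an integer. -/
def scaledEdge (u v : LoopExpr) : LoopExpr :=
  fold 29 (fold 29 (input (pairAddr u v + 1)) (timesVertexDen (var 29)))
    (fold 30 acc (ifEq (var 29) u (ifEq (var 30) v acc (timesEdgeDen (var 29) (var 30)))
      (timesEdgeDen (var 29) (var 30))))

def stepCost (u v t : LoopExpr) : LoopExpr :=
  scale + scale - scaledVertex u - (scaledVertex v + scaledVertex v) -
    (scaledEdge u v + scaledEdge u v) - scaledEdge v t

/-- The address at which a distance is stored. -/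
def distAddr (k u v x y : LoopExpr) : LoopExpr :=
  let e := mulSize (mulSize (mulSize (mulSize k + u) + v) + x) + y
  -- Odd offsets hold distances, even offsets from 2 on hold the traced walk, and offset 0 holds its
  -- length.
  e + e + 1

def dist (k u v x y : LoopExpr) : LoopExpr := work (distAddr k u v x y)

/-- `L * (2 * k % 3)`, where `L` is the common scale. -/
def threshold (k : LoopExpr) : LoopExpr :=
  fold 28 0 (ite (k - var 28) (ite acc (acc - scale) (scale + scale)) acc)

/-- Positive if a closed walk of length `k` starting with the edge from `x` to `y` is violated. -/
def violated (k x y : LoopExpr) : LoopExpr :=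
  ite (adj x y) (threshold k - dist k x y x y) 0

/-- The address of a vertex of the walk that is traced back. -/
def walkAddr (j : LoopExpr) : LoopExpr := j + j + 2

def walkVertex (j : LoopExpr) : LoopExpr := work (walkAddr j)

/-- The length of a shortest violated closed walk, or zero. -/
def bestLength : LoopExpr :=
  let k := find 0 (size - find 1 (size - find 2 (violated (var 0 + 1) (var 1) (var 2))))
  ite (size - k) (k + 1) 0

/-- A vertex that continues the walk from the `i`-th dart. -/
def nextVertex (i : LoopExpr) : LoopExpr :=
  let u := walkVertex i
  let v := walkVertex (i + 1)
  let x := walkVertex 0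
  let y := walkVertex 1
  let k := work 0 - i
  find 5 (ite (adj v (var 5)) (ifEq (var 5) u 0
    (ifEq (dist k u v x y) (stepCost u v (var 5) + dist (k - 1) v (var 5) x y) 1 0)) 0)

end LoopExpr

namespace LoopCmd

open LoopExpr

def forDarts (c : LoopCmd) : LoopCmd := forLoop 1 (forLoop 2 (forLoop 3 (forLoop 4 c)))

def initDist : LoopCmd :=
  store (distAddr 0 (var 1) (var 2) (var 3) (var 4))
    (ifEq (var 1) (var 3) (ifEq (var 2) (var 4) 0 (scale + scale)) (scale + scale))

def updateDist : LoopCmd :=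
  store (distAddr (var 0 + 1) (var 1) (var 2) (var 3) (var 4))
    (fold 5 (scale + scale) (ite (adj (var 2) (var 5)) (ifEq (var 5) (var 1) acc
      (ite (acc - (stepCost (var 1) (var 2) (var 5) +
          dist (var 0) (var 2) (var 5) (var 3) (var 4)))
        (stepCost (var 1) (var 2) (var 5) + dist (var 0) (var 2) (var 5) (var 3) (var 4)) acc))
      acc))

/-- Compute all distances, find a shortest violated closed walk and trace it back. -/
def separate : LoopCmd :=
  seq (seq (forDarts initDist) (forLoop 0 (forDarts updateDist)))
  (seq (store 0 bestLength)
  (seq (store (walkAddr 0) (find 1 (size - find 2 (violated (work 0) (var 1) (var 2)))))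
  (seq (store (walkAddr 1) (find 2 (violated (work 0) (walkVertex 0) (var 2))))
  (forLoop 0 (store (walkAddr (var 0 + 1 + 1)) (nextVertex (var 0)))))))

end LoopCmd

/-! ### Evaluation of the expressions -/

theorem iterAcc_induction {n : ℕ} {f : ℕ → ℤ → ℤ} {x : ℤ} (P : ℕ → ℤ → Prop) (h0 : P 0 x)
    (hs : ∀ k < n, ∀ y, P k y → P (k + 1) (f k y)) : P n (iterAcc f x n) := by
  suffices ∀ k ≤ n, P k (iterAcc f x k) from this n le_rfl
  intro k
  induction k with
  | zero => exact fun _ => h0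
  | succ k ih => exact fun hk => hs k hk _ (ih (by omega))

theorem iterMem_induction {n : ℕ} {f : ℕ → (ℤ → ℤ) → ℤ → ℤ} {m : ℤ → ℤ} (P : ℕ → (ℤ → ℤ) → Prop)
    (h0 : P 0 m) (hs : ∀ k < n, ∀ m', P k m' → P (k + 1) (f k m')) : P n (iterMem f m n) := by
  suffices ∀ k ≤ n, P k (iterMem f m k) from this n le_rfl
  intro k
  induction k with
  | zero => exact fun _ => h0
  | succ k ih => exact fun hk => hs k hk _ (ih (by omega))

theorem iterAcc_eq_prod {n : ℕ} {f : ℕ → ℤ → ℤ} (x : ℤ) (g : Fin n → ℤ)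
    (h : ∀ (k : Fin n) (y : ℤ), f k y = y * g k) : iterAcc f x n = x * ∏ k, g k := by
  have := iterAcc_induction (n := n) (f := f) (x := x)
    (fun k y => y = x * ∏ i ∈ Finset.range k, if h : i < n then g ⟨i, h⟩ else 1) (by simp)
    fun k hk y hy => by
      rw [Finset.prod_range_succ, dif_pos hk, ← mul_assoc, ← hy]
      exact h ⟨k, hk⟩ y
  rw [this, Finset.prod_range]
  simp

namespace LoopExpr

variable {n : ℕ} {m : ℤ → ℤ} {ρ : Fin 32 → ℤ} {a b e e' : LoopExpr} {y z z' : ℤ}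

theorem eval_add (a b : LoopExpr) (x : ℤ) :
    (a + b).eval n m ρ x = a.eval n m ρ x + b.eval n m ρ x := rfl

theorem eval_sub (a b : LoopExpr) (x : ℤ) :
    (a - b).eval n m ρ x = a.eval n m ρ x - b.eval n m ρ x := rfl

theorem eval_var (i : Fin 32) (x : ℤ) : (var i).eval n m ρ x = ρ i := rfl

theorem eval_acc (x : ℤ) : acc.eval n m ρ x = x := rfl

theorem eval_mulSize (a : LoopExpr) (x : ℤ) :
    (mulSize a).eval n m ρ x = a.eval n m ρ x * n := rfl

theorem eval_input (a : LoopExpr) (x : ℤ) : (input a).eval n m ρ x =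
    if 0 ≤ a.eval n m ρ x then m (a.eval n m ρ x) else 0 := rfl

theorem eval_mulInput (a b : LoopExpr) (x : ℤ) : (mulInput a b).eval n m ρ x =
    a.eval n m ρ x * if 0 ≤ b.eval n m ρ x then m (b.eval n m ρ x) else 0 := rfl

theorem eval_ite (a e e' : LoopExpr) (x : ℤ) : (ite a e e').eval n m ρ x =
    if 0 < a.eval n m ρ x then e.eval n m ρ x else e'.eval n m ρ x := rfl

theorem eval_fold (i : Fin 32) (e e' : LoopExpr) (x : ℤ) : (fold i e e').eval n m ρ x =
    iterAcc (fun k y => e'.eval n m (Function.update ρ i k) y) (e.eval n m ρ x) n := rfl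

/-- The expression has the value `z`, whatever the accumulator and the variables from `28` on
contain. -/
def Denotes (n : ℕ) (m : ℤ → ℤ) (ρ : Fin 32 → ℤ) (e : LoopExpr) (z : ℤ) : Prop :=
  ∀ (ρ' : Fin 32 → ℤ) (x : ℤ), (∀ i < 28, ρ' i = ρ i) → e.eval n m ρ' x = z

theorem Denotes.eval (h : Denotes n m ρ e z) (x : ℤ) : e.eval n m ρ x = z :=
  h ρ x fun _ _ => rfl

theorem denotes_var {i : Fin 32} (hi : i < 28) : Denotes n m ρ (var i) (ρ i) :=
  fun _ _ h => h i hi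

theorem denotes_ofNat (k : ℕ) : Denotes n m ρ (OfNat.ofNat k) (k : ℤ) :=
  fun _ _ _ => rfl

theorem denotes_zero : Denotes n m ρ 0 0 := denotes_ofNat 0

theorem denotes_one : Denotes n m ρ 1 1 := denotes_ofNat 1

theorem denotes_size : Denotes n m ρ size n := fun _ _ _ => by
  simp [size, LoopExpr.eval]

theorem Denotes.add (ha : Denotes n m ρ a y) (hb : Denotes n m ρ b z) :
    Denotes n m ρ (a + b) (y + z) :=
  fun ρ' x h => by rw [eval_add, ha ρ' x h, hb ρ' x h]

theorem Denotes.sub (ha : Denotes n m ρ a y) (hb : Denotes n m ρ b z) :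
    Denotes n m ρ (a - b) (y - z) :=
  fun ρ' x h => by rw [eval_sub, ha ρ' x h, hb ρ' x h]

theorem Denotes.mulSize (ha : Denotes n m ρ a y) : Denotes n m ρ (mulSize a) (y * n) :=
  fun ρ' x h => by rw [LoopExpr.eval, ha ρ' x h]

theorem Denotes.input (ha : Denotes n m ρ a y) (hy : 0 ≤ y) : Denotes n m ρ (input a) (m y) :=
  fun ρ' x h => by rw [LoopExpr.eval, ha ρ' x h, if_pos hy]

theorem Denotes.work (ha : Denotes n m ρ a y) : Denotes n m ρ (work a) (m (-1 - y)) :=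
  fun ρ' x h => by rw [LoopExpr.eval, ha ρ' x h]

theorem Denotes.ite (ha : Denotes n m ρ a y) (hpos : 0 < y → Denotes n m ρ e z)
    (hnonpos : y ≤ 0 → Denotes n m ρ e' z) : Denotes n m ρ (ite a e e') z := by
  intro ρ' x h
  rw [LoopExpr.eval, ha ρ' x h]
  split_ifs with hy
  · exact hpos hy ρ' x h
  · exact hnonpos (not_lt.1 hy) ρ' x h

theorem eval_ifEq (a b e e' : LoopExpr) (x : ℤ) : (ifEq a b e e').eval n m ρ x =
    if a.eval n m ρ x = b.eval n m ρ x then e.eval n m ρ x else e'.eval n m ρ x := by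
  simp only [ifEq, LoopExpr.eval, eval_sub]
  split_ifs <;> first | rfl | omega

theorem Denotes.ifEq (ha : Denotes n m ρ a y) (hb : Denotes n m ρ b z)
    (hpos : y = z → Denotes n m ρ e z') (hneg : y ≠ z → Denotes n m ρ e' z') :
    Denotes n m ρ (ifEq a b e e') z' := by
  intro ρ' x h
  rw [eval_ifEq, ha ρ' x h, hb ρ' x h]
  split_ifs with hy
  · exact hpos hy ρ' x h
  · exact hneg hy ρ' x h

/-- The accumulator is `n` until the first success and that index from then on; being below `n`, the
index is recognised as a success and kept. -/
theorem exists_denotes_find {i : Fin 32} {cond : LoopExpr} (z : ℕ → ℤ)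
    (hc : ∀ k < n, Denotes n m (Function.update ρ i k) cond (z k)) :
    ∃ r : ℕ, Denotes n m ρ (find i cond) r ∧ r ≤ n ∧ (r < n → 0 < z r) ∧ ∀ k < r, z k ≤ 0 := by
  classical
  have hex : ∃ k, n ≤ k ∨ 0 < z k := ⟨n, .inl le_rfl⟩
  refine ⟨Nat.find hex, fun ρ' x h => ?_, Nat.find_le (.inl le_rfl),
    fun hlt => (Nat.find_spec hex).resolve_left (not_le.2 hlt),
    fun k hk => not_lt.1 (not_or.1 (Nat.find_min hex hk)).2⟩
  have hrn : Nat.find hex ≤ n := Nat.find_le (.inl le_rfl)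
  have hspec := Nat.find_spec hex
  have hmin : ∀ k < Nat.find hex, z k ≤ 0 := fun k hk =>
    not_lt.1 (not_or.1 (Nat.find_min hex hk)).2
  generalize Nat.find hex = r at *
  rw [find, LoopExpr.eval]
  have := iterAcc_induction (n := n) (x := size.eval n m ρ' x)
    (f := fun k y => (LoopExpr.ite (size - acc) acc (LoopExpr.ite cond (var i) size)).eval n m
      (Function.update ρ' i k) y)
    (fun k y => (k ≤ r → y = n) ∧ (r < k → y = r)) ⟨fun _ => ?_, fun h => by omega⟩ ?_
  · rcases hrn.lt_or_eq with h' | h'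
    · exact this.2 h'
    · rw [this.1 h'.ge, h']
  · exact denotes_size ρ' x h
  · intro k hk y hy
    have hcond : cond.eval n m (Function.update ρ' i (k : ℤ)) y = z k :=
      hc k hk _ _ fun j hj => by
        simp only [Function.update_apply]
        split_ifs
        · rfl
        · exact h j hj
    have hsize : size.eval n m (Function.update ρ' i (k : ℤ)) y = n :=
      (denotes_size (ρ := Function.update ρ' i (k : ℤ))).eval y
    simp only [LoopExpr.eval, eval_sub, hcond, hsize, Function.update_self]
    rcases lt_trichotomy k r with hkr | rfl | hkr
    · have hz := hmin k hkr
      rw [hy.1 hkr.le, if_neg (by omega), if_neg (by omega)]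
      exact ⟨fun _ => rfl, fun h => by omega⟩
    · have hz : 0 < z k := hspec.resolve_left (by omega)
      rw [hy.1 le_rfl, if_neg (by omega), if_pos hz]
      exact ⟨fun h => by omega, fun _ => rfl⟩
    · rw [hy.2 hkr, if_pos (by omega)]
      exact ⟨fun h => by omega, fun _ => rfl⟩

end LoopExpr

/-! ### The encoded instance -/

theorem List.getD_flatMap_finRange {α : Type*} {n l : ℕ} (f : Fin n → List α) (d : α)
    (hf : ∀ i, (f i).length = l) (rest : List α) (i : Fin n) {j : ℕ} (hj : j < l) :
    ((List.finRange n).flatMap f ++ rest).getD (i * l + j) d = (f i).getD j d := by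
  induction n with
  | zero => exact i.elim0
  | succ n ih =>
    rw [List.finRange_succ, List.flatMap_cons, List.flatMap_map, List.append_assoc]
    refine Fin.cases ?_ (fun i => ?_) i
    · rw [List.getD_append _ _ _ _ (by rw [hf]; simpa using hj)]
      simp
    · rw [List.getD_append_right _ _ _ _ (by rw [hf, Fin.val_succ, add_mul]; omega), hf,
        Fin.val_succ, show (i + 1) * l + j - l = i * l + j by rw [add_mul]; omega]
      exact ih (fun i => f i.succ) (fun i => hf _) i

theorem List.length_flatMap_finRange {α : Type*} {n l : ℕ} (f : Fin n → List α)
    (hf : ∀ i, (f i).length = l) : ((List.finRange n).flatMap f).length = n * l := by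
  simp [List.length_flatMap, hf]

open scoped Classical in
/-- The numerator of the weight of a pair, zero for nonadjacent pairs. -/
noncomputable def pairNum {n : ℕ} (G : SimpleGraph (Fin n)) (w : Sym2 (Fin n) → ℚ)
    (u v : Fin n) : ℤ := if G.Adj u v then (w s(u, v)).num else 0

open scoped Classical in
/-- The denominator of the weight of a pair, one for nonadjacent pairs. -/
noncomputable def pairDen {n : ℕ} (G : SimpleGraph (Fin n)) (w : Sym2 (Fin n) → ℚ)
    (u v : Fin n) : ℤ := if G.Adj u v then (w s(u, v)).den else 1

open scoped Classical in
/-- The memory holds an instance of the separation problem. -/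
structure HoldsInstance {n : ℕ} (G : SimpleGraph (Fin n)) (c : Fin n → ℚ)
    (w : Sym2 (Fin n) → ℚ) (m : ℤ → ℤ) : Prop where
  vertexNum : ∀ v : Fin n, m (1 + (v + v)) = (c v).num
  vertexDen : ∀ v : Fin n, m (2 + (v + v)) = (c v).den
  adj : ∀ u v : Fin n, m (1 + (n + n) + (u * n + v + (u * n + v) + (u * n + v))) =
    if G.Adj u v then 1 else 0
  pairNum : ∀ u v : Fin n,
    m (1 + (n + n) + (u * n + v + (u * n + v) + (u * n + v)) + 1) = pairNum G w u v
  pairDen : ∀ u v : Fin n,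
    m (1 + (n + n) + (u * n + v + (u * n + v) + (u * n + v)) + 2) = pairDen G w u v

theorem holdsInstance_ramInput {n : ℕ} (G : SimpleGraph (Fin n)) (c : Fin n → ℚ)
    (w : Sym2 (Fin n) → ℚ) : HoldsInstance G c w (ramInput (encodeInstance G c w)).mem := by
  classical
  have hmem : ∀ (k : ℕ) (z : ℤ), z = k →
      (ramInput (encodeInstance G c w)).mem z = (encodeInstance G c w).getD k 0 := by
    rintro k _ rfl
    simp [ramInput]
  set f : Fin n → List ℤ := fun v => [(c v).num, ((c v).den : ℤ)] with hf
  set g : Fin n → Fin n → List ℤ := fun u v =>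
    if G.Adj u v then [1, (w s(u, v)).num, ((w s(u, v)).den : ℤ)] else [0, 0, 1] with hg
  have hfl : ∀ v, (f v).length = 2 := fun v => rfl
  have hgl : ∀ u v, (g u v).length = 3 := fun u v => by simp only [hg]; split_ifs <;> rfl
  have hgl' : ∀ u, ((List.finRange n).flatMap (g u)).length = n * 3 := fun u =>
    List.length_flatMap_finRange _ (hgl u)
  have henc : encodeInstance G c w = (n : ℤ) :: ((List.finRange n).flatMap f ++
      ((List.finRange n).flatMap fun u => (List.finRange n).flatMap (g u))) := by
    simp only [encodeInstance, List.cons_append, List.nil_append, hf, hg]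
  have hv : ∀ (v : Fin n) (j : ℕ), j < 2 →
      (encodeInstance G c w).getD (v * 2 + j + 1) 0 = (f v).getD j 0 := by
    intro v j hj
    rw [henc, List.getD_cons_succ]
    exact List.getD_flatMap_finRange f 0 hfl _ v hj
  have he : ∀ (u v : Fin n) (j : ℕ), j < 3 →
      (encodeInstance G c w).getD (n * 2 + (u * (n * 3) + (v * 3 + j)) + 1) 0 =
        (g u v).getD j 0 := by
    intro u v j hj
    rw [henc, List.getD_cons_succ, List.getD_append_right _ _ _ _
      (by rw [List.length_flatMap_finRange f hfl]; omega), List.length_flatMap_finRange f hfl,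
      Nat.add_sub_cancel_left]
    have h1 := List.getD_flatMap_finRange (fun u => (List.finRange n).flatMap (g u)) 0 hgl' [] u
      (j := v * 3 + j) (by have := v.2; omega)
    have h2 := List.getD_flatMap_finRange (g u) 0 (hgl u) [] v hj
    rw [List.append_nil] at h1 h2
    rw [h1, h2]
  refine ⟨fun v => ?_, fun v => ?_, fun u v => ?_, fun u v => ?_, fun u v => ?_⟩
  · rw [hmem (v * 2 + 0 + 1) _ (by push_cast; ring), hv v 0 (by norm_num)]; rfl
  · rw [hmem (v * 2 + 1 + 1) _ (by push_cast; ring), hv v 1 (by norm_num)]; rfl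
  · rw [hmem (n * 2 + (u * (n * 3) + (v * 3 + 0)) + 1) _ (by push_cast; ring),
      he u v 0 (by norm_num)]
    simp only [hg]; split_ifs <;> rfl
  · rw [hmem (n * 2 + (u * (n * 3) + (v * 3 + 1)) + 1) _ (by push_cast; ring),
      he u v 1 (by norm_num)]
    simp only [hg, _root_.pairNum]; split_ifs <;> rfl
  · rw [hmem (n * 2 + (u * (n * 3) + (v * 3 + 2)) + 1) _ (by push_cast; ring),
      he u v 2 (by norm_num)]
    simp only [hg, _root_.pairDen]; split_ifs <;> rfl

/-! ### Scaled weights -/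

theorem Fintype.prod_eq_mul_prod_ite {ι : Type*} [Fintype ι] [DecidableEq ι] (f : ι → ℤ) (j : ι) :
    ∏ i, f i = f j * ∏ i, if i = j then 1 else f i := by
  rw [← Finset.mul_prod_erase _ f (Finset.mem_univ j),
    ← Finset.mul_prod_erase _ (fun i => if i = j then 1 else f i) (Finset.mem_univ j), if_pos rfl,
    one_mul]
  congr 1
  refine Finset.prod_congr rfl fun i hi => ?_
  rw [if_neg (Finset.ne_of_mem_erase hi)]

section Scaled

variable {n : ℕ} (G : SimpleGraph (Fin n)) (c : Fin n → ℚ) (w : Sym2 (Fin n) → ℚ)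

/-- The product of all denominators. -/
noncomputable def commonDen : ℤ :=
  1 * (∏ v, ((c v).den : ℤ)) * ∏ a, ∏ b, pairDen G w a b

/-- The weight of a vertex times `commonDen`. -/
noncomputable def scaledVertexWeight (v : Fin n) : ℤ :=
  (c v).num * (∏ i, if i = v then 1 else ((c i).den : ℤ)) * ∏ a, ∏ b, pairDen G w a b

/-- The weight of an edge times `commonDen`. -/
noncomputable def scaledPairWeight (u v : Fin n) : ℤ :=
  pairNum G w u v * (∏ i, ((c i).den : ℤ)) *
    ∏ a, ∏ b, if a = u ∧ b = v then 1 else pairDen G w a b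

/-- The slack of an edge and the following vertex times `commonDen`. -/
noncomputable def scaledStepCost (u v t : Fin n) : ℤ :=
  commonDen G c w + commonDen G c w - scaledVertexWeight G c w u -
    (scaledVertexWeight G c w v + scaledVertexWeight G c w v) -
    (scaledPairWeight G c w u v + scaledPairWeight G c w u v) - scaledPairWeight G c w v t

theorem commonDen_pos : 0 < commonDen G c w := by
  refine mul_pos (mul_pos one_pos (Finset.prod_pos fun v _ => by exact_mod_cast (c v).den_pos))
    (Finset.prod_pos fun a _ => Finset.prod_pos fun b _ => ?_)
  rw [pairDen]
  split_ifs
  · exact_mod_cast (w s(a, b)).den_pos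
  · exact one_pos

/-- Omitting the denominator of `v` from the product takes the place of a division. -/
theorem cast_scaledVertexWeight (v : Fin n) :
    (scaledVertexWeight G c w v : ℚ) = commonDen G c w * c v := by
  rw [scaledVertexWeight, commonDen, Fintype.prod_eq_mul_prod_ite (fun i => ((c i).den : ℤ)) v]
  push_cast
  have : (c v).num = c v * (c v).den := (Rat.mul_den_eq_num _).symm
  rw [this]
  ring

theorem cast_scaledPairWeight {u v : Fin n} (h : G.Adj u v) :
    (scaledPairWeight G c w u v : ℚ) = commonDen G c w * w s(u, v) := by
  have h1 : ∏ a, ∏ b, pairDen G w a b = pairDen G w u v *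
      ∏ a, ∏ b, if a = u ∧ b = v then 1 else pairDen G w a b := by
    have := Fintype.prod_eq_mul_prod_ite (fun p : Fin n × Fin n => pairDen G w p.1 p.2) (u, v)
    simpa only [Fintype.prod_prod_type, Prod.mk.injEq] using this
  rw [scaledPairWeight, commonDen, h1, pairNum, pairDen, if_pos h, if_pos h]
  push_cast
  have : (w s(u, v)).num = w s(u, v) * (w s(u, v)).den := (Rat.mul_den_eq_num _).symm
  rw [this]
  ring

theorem isStepCost_scaledStepCost :
    IsStepCost G c w (commonDen G c w) (scaledStepCost G c w) := by
  intro u v t h h'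
  rw [scaledStepCost]
  push_cast
  rw [cast_scaledVertexWeight, cast_scaledVertexWeight, cast_scaledPairWeight G c w h,
    cast_scaledPairWeight G c w h']
  ring

end Scaled

/-! ### Values of the scaled weights, step costs and thresholds -/

namespace LoopExpr

variable {n : ℕ} {m : ℤ → ℤ} {ρ : Fin 32 → ℤ}
  {G : SimpleGraph (Fin n)} {c : Fin n → ℚ} {w : Sym2 (Fin n) → ℚ}

theorem denotes_pairAddr {a b : LoopExpr} {y z : ℤ} (ha : Denotes n m ρ a y)
    (hb : Denotes n m ρ b z) : Denotes n m ρ (pairAddr a b)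
      (1 + (n + n) + (y * n + z + (y * n + z) + (y * n + z))) :=
  (denotes_one.add (denotes_size.add denotes_size)).add
    (((ha.mulSize.add hb).add (ha.mulSize.add hb)).add (ha.mulSize.add hb))

theorem eval_timesVertexDen (hm : HoldsInstance G c w m) {e : LoopExpr} {v : Fin n} {y : ℤ}
    (he : e.eval n m ρ y = (v : ℕ)) :
    (timesVertexDen e).eval n m ρ y = y * (c v).den := by
  have h2 : (2 : LoopExpr).eval n m ρ y = 2 := (denotes_ofNat 2).eval y
  rw [timesVertexDen, eval_mulInput, eval_acc, eval_add, eval_add, he, h2,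
    if_pos (by positivity), hm.vertexDen v]

theorem eval_timesEdgeDen (hm : HoldsInstance G c w m) {e e' : LoopExpr} {u v : Fin n} {y : ℤ}
    (he : e.eval n m ρ y = (u : ℕ)) (he' : e'.eval n m ρ y = (v : ℕ)) :
    (timesEdgeDen e e').eval n m ρ y = y * pairDen G w u v := by
  have hs : size.eval n m ρ y = n := denotes_size.eval y
  have h1 : (1 : LoopExpr).eval n m ρ y = 1 := denotes_one.eval y
  have h2 : (2 : LoopExpr).eval n m ρ y = 2 := (denotes_ofNat 2).eval y
  have hp : (pairAddr e e' + 2).eval n m ρ y =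
      1 + (n + n) + (u * n + v + (u * n + v) + (u * n + v)) + 2 := by
    simp only [pairAddr, eval_add, eval_mulSize, he, he', hs, h1, h2]
  rw [timesEdgeDen, eval_mulInput, eval_acc, hp, if_pos (by positivity), hm.pairDen u v]

theorem denotes_scale (hm : HoldsInstance G c w m) :
    Denotes n m ρ scale (commonDen G c w) := by
  intro ρ' x _
  rw [scale, eval_fold, eval_fold]
  rw [iterAcc_eq_prod _ (fun a => ∏ b, pairDen G w a b), iterAcc_eq_prod _ fun v => ((c v).den : ℤ)]
  · rfl
  · exact fun k y => eval_timesVertexDen hm (by simp [eval_var])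
  · intro k y
    exact iterAcc_eq_prod _ _ fun l y =>
      eval_timesEdgeDen hm (by simp [eval_var]) (by simp [eval_var])

theorem denotes_scaledVertex (hm : HoldsInstance G c w m) {e : LoopExpr} {v : Fin n}
    (he : Denotes n m ρ e (v : ℕ)) :
    Denotes n m ρ (scaledVertex e) (scaledVertexWeight G c w v) := by
  intro ρ' x hρ
  rw [scaledVertex, eval_fold, eval_fold]
  rw [iterAcc_eq_prod _ (fun a => ∏ b, pairDen G w a b),
    iterAcc_eq_prod _ fun i => if i = v then 1 else ((c i).den : ℤ)]
  · rw [eval_input, (denotes_one.add (he.add he)) ρ' x hρ, if_pos (by positivity),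
      hm.vertexNum v]
    rfl
  · intro k y
    have he' := he (Function.update ρ' 29 (k : ℕ)) y fun i hi => by
      rw [Function.update_of_ne (by rintro rfl; exact absurd hi (by decide))]; exact hρ i hi
    rw [eval_ifEq, eval_timesVertexDen hm (v := k) (by simp [eval_var]), he']
    simp only [eval_var, eval_acc, Function.update_self, Nat.cast_inj, Fin.val_inj]
    split_ifs <;> simp
  · intro k y
    exact iterAcc_eq_prod _ _ fun l y =>
      eval_timesEdgeDen hm (by simp [eval_var]) (by simp [eval_var])

theorem denotes_scaledEdge (hm : HoldsInstance G c w m) {e e' : LoopExpr} {u v : Fin n}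
    (he : Denotes n m ρ e (u : ℕ)) (he' : Denotes n m ρ e' (v : ℕ)) :
    Denotes n m ρ (scaledEdge e e') (scaledPairWeight G c w u v) := by
  intro ρ' x hρ
  rw [scaledEdge, eval_fold, eval_fold]
  rw [iterAcc_eq_prod _ (fun a => ∏ b, if a = u ∧ b = v then 1 else pairDen G w a b),
    iterAcc_eq_prod _ fun i => ((c i).den : ℤ)]
  · rw [eval_input, ((denotes_pairAddr he he').add denotes_one) ρ' x hρ, if_pos (by positivity),
      hm.pairNum u v]
    rfl
  · exact fun k y => eval_timesVertexDen hm (by simp [eval_var])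
  · intro k y
    refine iterAcc_eq_prod _ _ fun l y => ?_
    have hρ' : ∀ i < 28, Function.update (Function.update ρ' 29 (k : ℕ)) 30 (l : ℕ) i = ρ i := by
      intro i hi
      rw [Function.update_of_ne (by rintro rfl; exact absurd hi (by decide)),
        Function.update_of_ne (by rintro rfl; exact absurd hi (by decide))]
      exact hρ i hi
    rw [eval_ifEq, eval_ifEq, he _ y hρ', he' _ y hρ',
      eval_timesEdgeDen hm (u := k) (v := l) (by simp [eval_var]) (by simp [eval_var])]
    simp only [eval_var, eval_acc, Function.update_self, Nat.cast_inj, Fin.val_inj]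
    rw [Function.update_of_ne (by decide), Function.update_self]
    simp only [Nat.cast_inj, Fin.val_inj]
    split_ifs <;> simp_all

theorem denotes_stepCost (hm : HoldsInstance G c w m) {e₁ e₂ e₃ : LoopExpr} {u v t : Fin n}
    (h₁ : Denotes n m ρ e₁ (u : ℕ)) (h₂ : Denotes n m ρ e₂ (v : ℕ))
    (h₃ : Denotes n m ρ e₃ (t : ℕ)) :
    Denotes n m ρ (stepCost e₁ e₂ e₃) (scaledStepCost G c w u v t) :=
  (((((denotes_scale hm).add (denotes_scale hm)).sub (denotes_scaledVertex hm h₁)).sub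
    ((denotes_scaledVertex hm h₂).add (denotes_scaledVertex hm h₂))).sub
    ((denotes_scaledEdge hm h₁ h₂).add (denotes_scaledEdge hm h₁ h₂))).sub
    (denotes_scaledEdge hm h₂ h₃)

open scoped Classical in
theorem denotes_adj (hm : HoldsInstance G c w m) {e e' : LoopExpr} {u v : Fin n}
    (he : Denotes n m ρ e (u : ℕ)) (he' : Denotes n m ρ e' (v : ℕ)) :
    Denotes n m ρ (adj e e') (if G.Adj u v then 1 else 0) := by
  have := (denotes_pairAddr he he').input (by positivity)
  rwa [hm.adj] at this

/-- No division is needed: while the index is below `k`, each round adds two modulo three, in units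
of the scale, so the accumulator runs through 0, 2, 1 cyclically. The bound `k ≤ n` guarantees
enough rounds. -/
theorem denotes_threshold (hm : HoldsInstance G c w m) {e : LoopExpr} {k : ℕ} (hk : k ≤ n)
    (he : Denotes n m ρ e k) :
    Denotes n m ρ (threshold e) (commonDen G c w * ((2 * k % 3 : ℕ) : ℤ)) := by
  intro ρ' x hρ
  have hL := commonDen_pos G c w
  rw [threshold, eval_fold]
  have := iterAcc_induction (n := n) (x := (0 : LoopExpr).eval n m ρ' x)
    (f := fun l y => (ite (e - var 28) (ite acc (acc - scale) (scale + scale)) acc).eval n m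
      (Function.update ρ' 28 (l : ℤ)) y)
    (fun l y => y = commonDen G c w * ((2 * min l k % 3 : ℕ) : ℤ)) (by simp [denotes_zero.eval])
    fun l hl y hy => ?_
  · rw [this, min_eq_right hk]
  · have he' := he (Function.update ρ' 28 (l : ℤ)) y fun i hi => by
      rw [Function.update_of_ne (by rintro rfl; exact absurd hi (by decide))]; exact hρ i hi
    have hs := (denotes_scale (ρ := Function.update ρ' 28 (l : ℤ)) hm).eval y
    simp only [eval_ite, eval_sub, eval_add, hs, he', eval_acc, eval_var, Function.update_self]
    by_cases hlk : l < k
    · rw [if_pos (by omega), min_eq_left (by omega)]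
      rw [min_eq_left hlk.le] at hy
      have h3 : l % 3 < 3 := Nat.mod_lt _ (by norm_num)
      rw [show 2 * (l + 1) % 3 = (2 * (l % 3) + 2) % 3 by omega]
      rw [show 2 * l % 3 = (2 * (l % 3)) % 3 by omega] at hy
      generalize l % 3 = r at *
      interval_cases r <;> norm_num at hy ⊢ <;> subst hy
      · simp; ring
      · rw [if_pos (by omega)]; ring
      · rw [if_pos hL]; ring
    · rw [if_neg (by omega), hy, min_eq_right (by omega), min_eq_right (by omega)]

end LoopExpr

/-! ### Filling the table of distances -/

/-- Uniqueness of quotient and remainder; iterated, it recovers the indices of a distance from the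
base-`n` digits of its address. -/
theorem Nat.mul_add_inj {n a b a' b' : ℕ} (hb : b < n) (hb' : b' < n)
    (h : a * n + b = a' * n + b') : a = a' ∧ b = b' := by
  have key : ∀ {a b a' b' : ℕ}, b < n → a * n + b = a' * n + b' → ¬ a < a' := by
    intro a b a' b' hb h hlt
    have := Nat.mul_le_mul_right n (Nat.succ_le_of_lt hlt)
    rw [Nat.succ_mul] at this
    omega
  obtain rfl : a = a' := le_antisymm (not_lt.1 (key hb' h.symm)) (not_lt.1 (key hb h))
  exact ⟨rfl, by omega⟩

/-- The memory cell of a distance. -/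
def distCell {n : ℕ} (k : ℕ) (u v x y : Fin n) : ℤ :=
  -1 - ((((k * n + u) * n + v) * n + x) * n + y + ((((k * n + u) * n + v) * n + x) * n + y) + 1)

theorem distCell_inj {n k k' : ℕ} {u v x y u' v' x' y' : Fin n}
    (h : distCell k u v x y = distCell k' u' v' x' y') :
    k = k' ∧ u = u' ∧ v = v' ∧ x = x' ∧ y = y' := by
  have h' : (((k * n + u) * n + v) * n + x) * n + (y : ℕ) =
      (((k' * n + u') * n + v') * n + x') * n + (y' : ℕ) := by
    zify
    rw [distCell, distCell] at h
    omega
  obtain ⟨h', hy⟩ := Nat.mul_add_inj y.2 y'.2 h'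
  obtain ⟨h', hx⟩ := Nat.mul_add_inj x.2 x'.2 h'
  obtain ⟨h', hv⟩ := Nat.mul_add_inj v.2 v'.2 h'
  obtain ⟨h', hu⟩ := Nat.mul_add_inj u.2 u'.2 h'
  exact ⟨h', Fin.ext hu, Fin.ext hv, Fin.ext hx, Fin.ext hy⟩

theorem distCell_neg {n : ℕ} (k : ℕ) (u v x y : Fin n) : distCell k u v x y < 0 := by
  rw [distCell]
  have : (0 : ℤ) ≤ (((k * n + u) * n + v) * n + x) * n + y := by positivity
  omega

/-- The memory cell of a vertex of the walk that is traced back. -/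
def walkCell (j : ℕ) : ℤ := -1 - (j + j + 2)

/-- Distance cells are even and walk cells are odd. -/
theorem distCell_ne_walkCell {n : ℕ} (k : ℕ) (u v x y : Fin n) (j : ℕ) :
    distCell k u v x y ≠ walkCell j := by
  rw [distCell, walkCell]
  generalize (((k * n + u) * n + v) * n + x) * n + (y : ℤ) = e
  omega

theorem distCell_ne_neg_one {n : ℕ} (k : ℕ) (u v x y : Fin n) : distCell k u v x y ≠ -1 := by
  rw [distCell]
  generalize (((k * n + u) * n + v) * n + x) * n + (y : ℤ) = e
  omega

theorem HoldsInstance.update {n : ℕ} {G : SimpleGraph (Fin n)} {c : Fin n → ℚ}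
    {w : Sym2 (Fin n) → ℚ} {m : ℤ → ℤ} (hm : HoldsInstance G c w m) {z : ℤ} (hz : z < 0) (a : ℤ) :
    HoldsInstance G c w (Function.update m z a) := by
  have h : ∀ z', 0 ≤ z' → Function.update m z a z' = m z' := fun z' hz' =>
    Function.update_of_ne (by omega) _ _
  constructor <;> intros <;> rw [h _ (by positivity)]
  · exact hm.vertexNum _
  · exact hm.vertexDen _
  · exact hm.adj _ _
  · exact hm.pairNum _ _
  · exact hm.pairDen _ _

section Table

variable {n : ℕ} (G : SimpleGraph (Fin n)) (c : Fin n → ℚ) (w : Sym2 (Fin n) → ℚ)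

/-- The distance that the program computes. -/
noncomputable def scaledDist (x y : Fin n) (k : ℕ) (u v : Fin n) : ℤ :=
  dartDist G (scaledStepCost G c w) (2 * commonDen G c w) x y k u v

/-- The memory holds the instance and the distances with indices in `T`. -/
def DistStored (T : Set (ℕ × Fin n × Fin n × Fin n × Fin n)) (m : ℤ → ℤ) : Prop :=
  HoldsInstance G c w m ∧ ∀ k u v x y, (k, u, v, x, y) ∈ T →
    m (distCell k u v x y) = scaledDist G c w x y k u v

/-- If the distances in `T₀` are stored, then the command adds those in `A`. -/
def AddsDist (T₀ A : Set (ℕ × Fin n × Fin n × Fin n × Fin n)) (C : LoopCmd)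
    (ρ : Fin 32 → ℤ) : Prop :=
  ∀ T m, T₀ ⊆ T → DistStored G c w T m → DistStored G c w (T ∪ A) (C.run n ρ m)

variable {G c w}

theorem DistStored.mono {T T' : Set (ℕ × Fin n × Fin n × Fin n × Fin n)} {m : ℤ → ℤ}
    (h : DistStored G c w T m) (hT : T' ⊆ T) : DistStored G c w T' m :=
  ⟨h.1, fun k u v x y hk => h.2 k u v x y (hT hk)⟩

theorem DistStored.update {T : Set (ℕ × Fin n × Fin n × Fin n × Fin n)} {m : ℤ → ℤ}
    (h : DistStored G c w T m) {z : ℤ} (hz : z < 0)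
    (hne : ∀ k (u v x y : Fin n), distCell k u v x y ≠ z) (a : ℤ) :
    DistStored G c w T (Function.update m z a) :=
  ⟨h.1.update hz a, fun k u v x y hk => by
    rw [Function.update_of_ne (hne k u v x y), h.2 k u v x y hk]⟩

/-- Since `AddsDist` speaks of every superset of `T₀`, the rounds can accumulate: after `k` of them
the sets `A j` with `j < k` have been added. -/
theorem AddsDist.forLoop {T₀ : Set (ℕ × Fin n × Fin n × Fin n × Fin n)}
    {A : Fin n → Set (ℕ × Fin n × Fin n × Fin n × Fin n)} {C : LoopCmd} {i : Fin 32}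
    {ρ : Fin 32 → ℤ} (h : ∀ k : Fin n, AddsDist G c w T₀ (A k) C (Function.update ρ i (k : ℕ))) :
    AddsDist G c w T₀ (⋃ k, A k) (.forLoop i C) ρ := by
  intro T m hT hm
  have := iterMem_induction (n := n) (m := m)
    (f := fun k m' => C.run n (Function.update ρ i (k : ℤ)) m')
    (fun k m' => DistStored G c w (T ∪ ⋃ j : Fin n, ⋃ (_ : (j : ℕ) < k), A j) m')
    (hm.mono (by simp)) fun k hk m' hm' =>
      (h ⟨k, hk⟩ _ m' (hT.trans Set.subset_union_left) hm').mono fun p hp => by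
        simp only [Set.mem_union, Set.mem_iUnion] at hp ⊢
        rcases hp with hp | ⟨j, hj, hp⟩
        · exact .inl (.inl hp)
        · rcases Nat.lt_succ_iff_lt_or_eq.1 hj with hj | hj
          · exact .inl (.inr ⟨j, hj, hp⟩)
          · obtain rfl : j = ⟨k, hk⟩ := Fin.ext hj
            exact .inr hp
  exact this.mono fun p hp => by simpa using hp

theorem AddsDist.forDarts {T₀ : Set (ℕ × Fin n × Fin n × Fin n × Fin n)} {C : LoopCmd}
    {ρ : Fin 32 → ℤ} {k : ℕ}
    (h : ∀ (u v x y : Fin n) (ρ' : Fin 32 → ℤ), ρ' 0 = ρ 0 → ρ' 1 = (u : ℕ) → ρ' 2 = (v : ℕ) →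
      ρ' 3 = (x : ℕ) → ρ' 4 = (y : ℕ) → AddsDist G c w T₀ {(k, u, v, x, y)} C ρ') :
    AddsDist G c w T₀ {p | p.1 = k} (.forDarts C) ρ := by
  have : {p : ℕ × Fin n × Fin n × Fin n × Fin n | p.1 = k} =
      ⋃ u, ⋃ v, ⋃ x, ⋃ y, {(k, u, v, x, y)} := by
    ext ⟨k', u, v, x, y⟩
    simp [eq_comm]
  rw [this]
  exact .forLoop fun u => .forLoop fun v => .forLoop fun x => .forLoop fun y =>
    h u v x y _ (by simp) (by simp) (by simp) (by simp) (by simp)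

open LoopExpr

variable {m : ℤ → ℤ} {ρ : Fin 32 → ℤ} {e₀ e₁ e₂ e₃ e₄ : LoopExpr} {k : ℕ} {u v x y : Fin n}

theorem denotes_var_of_eq {i : Fin 32} {z : ℤ} (h : ρ i = z) (hi : i < 28) :
    Denotes n m ρ (var i) z :=
  h ▸ denotes_var hi

theorem denotes_distAddr (h₀ : Denotes n m ρ e₀ k) (h₁ : Denotes n m ρ e₁ (u : ℕ))
    (h₂ : Denotes n m ρ e₂ (v : ℕ)) (h₃ : Denotes n m ρ e₃ (x : ℕ))
    (h₄ : Denotes n m ρ e₄ (y : ℕ)) :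
    Denotes n m ρ (distAddr e₀ e₁ e₂ e₃ e₄) (-1 - distCell k u v x y) := by
  have h := ((((h₀.mulSize.add h₁).mulSize.add h₂).mulSize.add h₃).mulSize.add h₄)
  have h' := (h.add h).add denotes_one
  rw [distCell, sub_sub_cancel]
  exact h'

theorem denotes_dist {T : Set (ℕ × Fin n × Fin n × Fin n × Fin n)} (hm : DistStored G c w T m)
    (hT : (k, u, v, x, y) ∈ T) (h₀ : Denotes n m ρ e₀ k) (h₁ : Denotes n m ρ e₁ (u : ℕ))
    (h₂ : Denotes n m ρ e₂ (v : ℕ)) (h₃ : Denotes n m ρ e₃ (x : ℕ))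
    (h₄ : Denotes n m ρ e₄ (y : ℕ)) :
    Denotes n m ρ (dist e₀ e₁ e₂ e₃ e₄) (scaledDist G c w x y k u v) := by
  have := (denotes_distAddr h₀ h₁ h₂ h₃ h₄).work
  rwa [sub_sub_cancel, hm.2 k u v x y hT] at this

/-- By injectivity of the addresses a write touches one distance only, and stores its correct value.
Distances already in `T` thus stay correct, even one that is overwritten. -/
theorem addsDist_store {T₀ : Set (ℕ × Fin n × Fin n × Fin n × Fin n)} {e : LoopExpr}
    (ha : ∀ m, Denotes n m ρ (distAddr e₀ e₁ e₂ e₃ e₄) (-1 - distCell k u v x y))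
    (he : ∀ m, DistStored G c w T₀ m → e.eval n m ρ 0 = scaledDist G c w x y k u v) :
    AddsDist G c w T₀ {(k, u, v, x, y)} (.store (distAddr e₀ e₁ e₂ e₃ e₄) e) ρ := by
  intro T m hT hm
  have hneg := distCell_neg k u v x y
  rw [LoopCmd.run, (ha m).eval, if_pos (by omega), he m (hm.mono hT), sub_sub_cancel]
  refine ⟨hm.1.update hneg _, fun k' u' v' x' y' h => ?_⟩
  rcases eq_or_ne (distCell k' u' v' x' y') (distCell k u v x y) with heq | hne
  · obtain ⟨rfl, rfl, rfl, rfl, rfl⟩ := distCell_inj heq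
    rw [Function.update_self]
  · rw [Function.update_of_ne hne]
    refine hm.2 _ _ _ _ _ (h.resolve_right fun h' => hne ?_)
    simp only [Set.mem_singleton_iff, Prod.mk.injEq] at h'
    obtain ⟨rfl, rfl, rfl, rfl, rfl⟩ := h'
    rfl

theorem addsDist_initDist (ρ : Fin 32 → ℤ) :
    AddsDist G c w ∅ {p | p.1 = 0} (.forDarts .initDist) ρ := by
  refine .forDarts fun u v x y ρ' _ h1 h2 h3 h4 => addsDist_store (fun m => ?_) fun m hm => ?_
  · exact denotes_distAddr (k := 0) denotes_zero (denotes_var_of_eq h1 (by decide))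
      (denotes_var_of_eq h2 (by decide)) (denotes_var_of_eq h3 (by decide))
      (denotes_var_of_eq h4 (by decide))
  · have hs := (denotes_scale (ρ := ρ') hm.1).eval 0
    simp only [eval_ifEq, eval_var, h1, h2, h3, h4, eval_add, hs, denotes_zero.eval, scaledDist,
      dartDist, Nat.cast_inj, Fin.val_inj, two_mul]
    split_ifs <;> simp_all

/-- The running minimum is characterised by its lower bounds, which matches the description of the
recursion by `Finset.le_fold_min`. -/
theorem eval_minFold {T₀ : Set (ℕ × Fin n × Fin n × Fin n × Fin n)} {m : ℤ → ℤ}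
    (hm : DistStored G c w T₀ m) (hT : ∀ t, (k, v, t, x, y) ∈ T₀)
    (h0 : ρ 0 = k) (h1 : ρ 1 = (u : ℕ)) (h2 : ρ 2 = (v : ℕ)) (h3 : ρ 3 = (x : ℕ))
    (h4 : ρ 4 = (y : ℕ)) :
    (fold 5 (scale + scale) (ite (adj (var 2) (var 5)) (ifEq (var 5) (var 1) acc
      (ite (acc - (stepCost (var 1) (var 2) (var 5) +
          dist (var 0) (var 2) (var 5) (var 3) (var 4)))
        (stepCost (var 1) (var 2) (var 5) + dist (var 0) (var 2) (var 5) (var 3) (var 4)) acc))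
      acc)).eval n m ρ 0 = scaledDist G c w x y (k + 1) u v := by
  classical
  set f : Fin n → ℤ := fun t => scaledStepCost G c w u v t + scaledDist G c w x y k v t with hf
  rw [eval_fold]
  have := iterAcc_induction (n := n) (x := (scale + scale).eval n m ρ 0)
    (f := fun l z => (ite (adj (var 2) (var 5)) (ifEq (var 5) (var 1) acc
      (ite (acc - (stepCost (var 1) (var 2) (var 5) +
          dist (var 0) (var 2) (var 5) (var 3) (var 4)))
        (stepCost (var 1) (var 2) (var 5) + dist (var 0) (var 2) (var 5) (var 3) (var 4)) acc))
      acc).eval n m (Function.update ρ 5 (l : ℤ)) z)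
    (fun l z => ∀ b, b ≤ z ↔ b ≤ 2 * commonDen G c w ∧
      ∀ t : Fin n, (t : ℕ) < l → G.Adj v t → t ≠ u → b ≤ f t) ?_ ?_
  · refine eq_of_forall_le_iff fun b => ?_
    rw [this b, scaledDist, dartDist, Finset.le_fold_min]
    simp [hf, scaledDist]
  · intro b
    rw [eval_add, (denotes_scale hm.1).eval, two_mul]
    simp
  · intro l hl z hz b
    set ρ' := Function.update ρ 5 (l : ℤ) with hρ'
    have d0 : Denotes n m ρ' (var 0) k := denotes_var_of_eq (by simp [hρ', h0]) (by decide)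
    have d1 : Denotes n m ρ' (var 1) (u : ℕ) := denotes_var_of_eq (by simp [hρ', h1]) (by decide)
    have d2 : Denotes n m ρ' (var 2) (v : ℕ) := denotes_var_of_eq (by simp [hρ', h2]) (by decide)
    have d3 : Denotes n m ρ' (var 3) (x : ℕ) := denotes_var_of_eq (by simp [hρ', h3]) (by decide)
    have d4 : Denotes n m ρ' (var 4) (y : ℕ) := denotes_var_of_eq (by simp [hρ', h4]) (by decide)
    have d5 : Denotes n m ρ' (var 5) ((⟨l, hl⟩ : Fin n) : ℕ) :=
      denotes_var_of_eq (by simp [hρ']) (by decide)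
    have hval := ((denotes_stepCost hm.1 d1 d2 d5).add
      (denotes_dist hm (hT _) d0 d2 d5 d3 d4)).eval z
    change _ = f ⟨l, hl⟩ at hval
    simp only [eval_ite, eval_ifEq, eval_sub, hval, (denotes_adj hm.1 d2 d5).eval, d5.eval, d1.eval,
      eval_acc, Nat.cast_inj]
    have hsplit : (∀ t : Fin n, (t : ℕ) < l + 1 → G.Adj v t → t ≠ u → b ≤ f t) ↔
        (∀ t : Fin n, (t : ℕ) < l → G.Adj v t → t ≠ u → b ≤ f t) ∧
          (G.Adj v ⟨l, hl⟩ → ⟨l, hl⟩ ≠ u → b ≤ f ⟨l, hl⟩) := by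
      refine ⟨fun h => ⟨fun t ht => h t (by omega), h _ (by simp)⟩, fun h t ht => ?_⟩
      rcases Nat.lt_succ_iff_lt_or_eq.1 ht with ht | ht
      · exact h.1 t ht
      · obtain rfl : t = ⟨l, hl⟩ := Fin.ext ht
        exact h.2
    rw [hsplit, ← and_assoc, ← hz b]
    by_cases hadj : G.Adj v ⟨l, hl⟩
    · rw [if_pos (by simp [hadj])]
      by_cases hne : l = u
      · simp [hne]
      · have hne' : (⟨l, hl⟩ : Fin n) ≠ u := fun h => hne (congrArg Fin.val h)
        rw [if_neg hne]
        simp only [hadj, ne_eq, hne', not_false_eq_true, true_imp_iff]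
        split_ifs <;> omega
    · simp [hadj]

theorem addsDist_updateDist (hk : ρ 0 = k) :
    AddsDist G c w {p | p.1 = k} {p | p.1 = k + 1} (.forDarts .updateDist) ρ := by
  refine .forDarts fun u v x y ρ' h0 h1 h2 h3 h4 => addsDist_store (fun m => ?_) fun m hm => ?_
  · exact denotes_distAddr (k := k + 1)
      (by push_cast; exact (denotes_var_of_eq (h0.trans hk) (by decide)).add denotes_one)
      (denotes_var_of_eq h1 (by decide))
      (denotes_var_of_eq h2 (by decide)) (denotes_var_of_eq h3 (by decide))
      (denotes_var_of_eq h4 (by decide))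
  · exact eval_minFold hm (fun t => rfl) (h0.trans hk) h1 h2 h3 h4

/-- Layer `k + 1` reads only layer `k`. -/
theorem distStored_table (hm : HoldsInstance G c w m) (ρ : Fin 32 → ℤ) :
    DistStored G c w {p | p.1 ≤ n} ((LoopCmd.seq (.forDarts .initDist)
      (.forLoop 0 (.forDarts .updateDist))).run n ρ m) := by
  rw [LoopCmd.run, LoopCmd.run]
  have h0 := addsDist_initDist ρ ∅ m le_rfl ⟨hm, fun _ _ _ _ _ h => h.elim⟩
  exact iterMem_induction (n := n)
    (f := fun k m' => (LoopCmd.forDarts .updateDist).run n (Function.update ρ 0 (k : ℤ)) m')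
    (fun k m' => DistStored G c w {p | p.1 ≤ k} m') (h0.mono fun p hp => by simpa using hp)
    fun k hk m' hm' => (addsDist_updateDist (ρ := Function.update ρ 0 (k : ℤ)) (k := k) (by simp)
      _ m' (fun p hp => le_of_eq hp) hm').mono fun p hp =>
        (Nat.lt_succ_iff_lt_or_eq.1 (Nat.lt_succ_of_le hp)).imp (fun h => Nat.le_of_lt_succ h) id

end Table

/-! ### Searching for the smallest violated length -/

section Search

open LoopExpr

variable {n : ℕ} {G : SimpleGraph (Fin n)} {c : Fin n → ℚ} {w : Sym2 (Fin n) → ℚ}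
  {m : ℤ → ℤ} {ρ : Fin 32 → ℤ}

theorem LoopExpr.exists_denotes_find_fin {i : Fin 32} {cond : LoopExpr} {z : Fin n → ℤ}
    (hc : ∀ k : Fin n, Denotes n m (Function.update ρ i (k : ℕ)) cond (z k)) :
    ∃ r : ℤ, Denotes n m ρ (find i cond) r ∧ ((r = n ∧ ∀ k, z k ≤ 0) ∨
      ∃ k : Fin n, r = (k : ℕ) ∧ 0 < z k ∧ ∀ j < k, z j ≤ 0) := by
  obtain ⟨r, hr, hrn, hpos, hmin⟩ := exists_denotes_find (n := n) (m := m) (ρ := ρ) (i := i)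
    (cond := cond) (fun k => if h : k < n then z ⟨k, h⟩ else 0)
    fun k hk => by rw [dif_pos hk]; exact hc ⟨k, hk⟩
  have hmin' : ∀ k : Fin n, (k : ℕ) < r → z k ≤ 0 := fun k hk => by
    have := hmin k hk
    rwa [dif_pos k.2] at this
  refine ⟨r, hr, ?_⟩
  rcases hrn.lt_or_eq with h | rfl
  · have := hpos h
    rw [dif_pos h] at this
    exact .inr ⟨⟨r, h⟩, rfl, this, fun j hj => hmin' j hj⟩
  · exact .inl ⟨rfl, fun k => hmin' k k.2⟩

open scoped Classical in
/-- Positive if a closed walk of length `k` starting with the edge from `x` to `y` is violated. -/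
noncomputable def violationMargin (G : SimpleGraph (Fin n)) (c : Fin n → ℚ)
    (w : Sym2 (Fin n) → ℚ) (k : ℕ) (x y : Fin n) : ℤ :=
  if G.Adj x y then commonDen G c w * ((2 * k % 3 : ℕ) : ℤ) - scaledDist G c w x y k x y else 0

theorem violationMargin_pos_iff {k : ℕ} {x y : Fin n} : 0 < violationMargin G c w k x y ↔
    G.Adj x y ∧ scaledDist G c w x y k x y < commonDen G c w * ((2 * k % 3 : ℕ) : ℤ) := by
  rw [violationMargin]
  split_ifs with h <;> simp [h]

theorem denotes_violated (hm : DistStored G c w {p | p.1 ≤ n} m) {e₀ e₁ e₂ : LoopExpr} {k : ℕ}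
    {x y : Fin n} (hk : k ≤ n) (h₀ : Denotes n m ρ e₀ k) (h₁ : Denotes n m ρ e₁ (x : ℕ))
    (h₂ : Denotes n m ρ e₂ (y : ℕ)) :
    Denotes n m ρ (violated e₀ e₁ e₂) (violationMargin G c w k x y) := by
  refine (denotes_adj hm.1 h₁ h₂).ite (fun h => ?_) fun h => ?_
  · rw [violationMargin, if_pos (by by_contra h'; simp [h'] at h)]
    exact (denotes_threshold hm.1 hk h₀).sub (denotes_dist hm (by exact hk) h₀ h₁ h₂ h₁ h₂)
  · rw [violationMargin, if_neg (fun h' => by simp [h'] at h)]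
    exact denotes_zero

/-- The search for a pair of vertices. -/
theorem exists_denotes_findPair (hm : DistStored G c w {p | p.1 ≤ n} m) {e : LoopExpr} {k : ℕ}
    (hk : k ≤ n) (he : ∀ x y : ℤ, Denotes n m (Function.update (Function.update ρ 1 x) 2 y) e k) :
    ∃ r : ℤ, Denotes n m ρ (find 1 (size - find 2 (violated e (var 1) (var 2)))) r ∧
      ((r = n ∧ ∀ x y, violationMargin G c w k x y ≤ 0) ∨
        ∃ x : Fin n, r = (x : ℕ) ∧ ∃ y, 0 < violationMargin G c w k x y) := by
  have inner : ∀ x : Fin n, ∃ r : ℤ, Denotes n m (Function.update ρ 1 (x : ℕ))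
      (find 2 (violated e (var 1) (var 2))) r ∧ ((r = n ∧ ∀ y, violationMargin G c w k x y ≤ 0) ∨
      ∃ y : Fin n, r = (y : ℕ) ∧ 0 < violationMargin G c w k x y ∧
        ∀ j < y, violationMargin G c w k x j ≤ 0) := fun x =>
    exists_denotes_find_fin fun y => denotes_violated hm hk (he x y)
      (denotes_var_of_eq (by simp) (by decide)) (denotes_var_of_eq (by simp) (by decide))
  choose r hr hr' using inner
  -- The inner search returns `n` on failure, so `size` minus its result is positive exactly when
  -- some `y` works.
  obtain ⟨s, hs, hs'⟩ := exists_denotes_find_fin (ρ := ρ) (i := 1) fun x =>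
    (denotes_size (m := m)).sub (hr x)
  refine ⟨s, hs, ?_⟩
  rcases hs' with ⟨h1, h2⟩ | ⟨x, h1, h2, -⟩
  · refine .inl ⟨h1, fun x => ?_⟩
    rcases hr' x with ⟨-, h⟩ | ⟨y, h, -⟩
    · exact h
    · have := h2 x
      have := y.2
      omega
  · refine .inr ⟨x, h1, ?_⟩
    rcases hr' x with ⟨h, -⟩ | ⟨y, -, h, -⟩
    · omega
    · exact ⟨y, h⟩

/-- Lengths are tried in increasing order, the search index `k` standing for the length `k + 1`.
This leaves zero free to signal that nothing was found. -/
theorem exists_denotes_bestLength (hm : DistStored G c w {p | p.1 ≤ n} m) :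
    ∃ K : ℕ, Denotes n m ρ bestLength K ∧ K ≤ n ∧
      (∀ k, 0 < k → k < K → ∀ x y, violationMargin G c w k x y ≤ 0) ∧
      (K = 0 → ∀ k, 0 < k → k ≤ n → ∀ x y, violationMargin G c w k x y ≤ 0) ∧
      (0 < K → ∃ x y, 0 < violationMargin G c w K x y) := by
  have inner : ∀ k : Fin n, _ := fun k => exists_denotes_findPair (k := (k : ℕ) + 1)
    (ρ := Function.update ρ 0 (k : ℕ)) hm k.2 (e := var 0 + 1) fun x y => by
      push_cast
      exact (denotes_var_of_eq (by simp) (by decide)).add denotes_one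
  choose r hr hr' using inner
  obtain ⟨s, hs, hs'⟩ := exists_denotes_find_fin (ρ := ρ) (i := 0) fun k =>
    (denotes_size (m := m)).sub (hr k)
  have hneg : ∀ k : Fin n, (n : ℤ) - r k ≤ 0 → ∀ x y, violationMargin G c w (k + 1) x y ≤ 0 := by
    intro k hk
    rcases hr' k with ⟨-, h⟩ | ⟨x, h, -⟩
    · exact h
    · have := x.2
      omega
  rcases hs' with ⟨rfl, h2⟩ | ⟨k, rfl, h2, h3⟩
  · refine ⟨0, ?_, by omega, by omega, fun _ k hk hkn => ?_, by omega⟩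
    · exact (denotes_size.sub hs).ite (fun h => by omega) fun _ => denotes_zero
    · obtain ⟨k, rfl⟩ : ∃ j, k = j + 1 := ⟨k - 1, by omega⟩
      exact hneg ⟨k, hkn⟩ (h2 _)
  · have hk := k.2
    refine ⟨k + 1, ?_, k.2, fun j hj hjk => ?_, by omega, fun _ => ?_⟩
    · exact (denotes_size.sub hs).ite
        (fun _ => by push_cast; exact hs.add denotes_one) fun _ => by omega
    · obtain ⟨j, rfl⟩ : ∃ i, j = i + 1 := ⟨j - 1, by omega⟩
      exact hneg ⟨j, by omega⟩ (h3 _ (show j < (k : ℕ) by omega))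
    · rcases hr' k with ⟨h, -⟩ | ⟨x, -, h⟩
      · omega
      · exact ⟨x, h⟩

/-! ### Tracing back -/

theorem walkCell_neg (j : ℕ) : walkCell j < 0 := by rw [walkCell]; omega

theorem walkCell_inj {i j : ℕ} : walkCell i = walkCell j ↔ i = j := by
  rw [walkCell, walkCell]; omega

theorem run_store_walkAddr {e e' : LoopExpr} {j : ℕ} (he : Denotes n m ρ e j) :
    (LoopCmd.store (walkAddr e) e').run n ρ m =
      Function.update m (walkCell j) (e'.eval n m ρ 0) := by
  have h : Denotes n m ρ (walkAddr e) (j + j + 2) := (he.add he).add (denotes_ofNat 2)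
  rw [LoopCmd.run, h.eval, if_pos (by positivity), walkCell]

theorem denotes_walkVertex {e : LoopExpr} {j : ℕ} {z : ℤ} (he : Denotes n m ρ e j)
    (hz : m (walkCell j) = z) : Denotes n m ρ (walkVertex e) z := by
  have h : Denotes n m ρ (walkAddr e) (j + j + 2) := (he.add he).add (denotes_ofNat 2)
  rw [← hz]
  exact h.work

/-- The dart at position `i` of the walk, if it is one, is continued along a shortest walk. -/
def TracedAt (G : SimpleGraph (Fin n)) (c : Fin n → ℚ) (w : Sym2 (Fin n) → ℚ) (K : ℕ)
    (x y : Fin n) (m : ℤ → ℤ) (i : ℕ) : Prop :=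
  i < K → ∀ u v : Fin n, m (walkCell i) = (u : ℕ) → m (walkCell (i + 1)) = (v : ℕ) →
    scaledDist G c w x y (K - i) u v < 2 * commonDen G c w →
    ∃ t : Fin n, m (walkCell (i + 2)) = (t : ℕ) ∧ G.Adj v t ∧ t ≠ u ∧
      scaledDist G c w x y (K - i) u v =
        scaledStepCost G c w u v t + scaledDist G c w x y (K - i - 1) v t

/-- A capped distance strictly below the cap is attained by a step, so the search for a continuation
cannot fail. -/
theorem eval_nextVertex (hm : DistStored G c w {p | p.1 ≤ n} m) {K i : ℕ} {x y u v : Fin n}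
    (hK : m (-1) = K) (hKn : K ≤ n) (hx : m (walkCell 0) = (x : ℕ))
    (hy : m (walkCell 1) = (y : ℕ)) (hu : m (walkCell i) = (u : ℕ))
    (hv : m (walkCell (i + 1)) = (v : ℕ)) (hi : i < K) (hρ : ρ 0 = i)
    (hlt : scaledDist G c w x y (K - i) u v < 2 * commonDen G c w) :
    ∃ t : Fin n, (nextVertex (var 0)).eval n m ρ 0 = (t : ℕ) ∧ G.Adj v t ∧ t ≠ u ∧
      scaledDist G c w x y (K - i) u v =
        scaledStepCost G c w u v t + scaledDist G c w x y (K - i - 1) v t := by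
  classical
  have hfind := exists_denotes_find_fin (n := n) (m := m) (ρ := ρ) (i := 5)
    (cond := ite (adj (walkVertex (var 0 + 1)) (var 5)) (ifEq (var 5) (walkVertex (var 0)) 0
      (ifEq (dist (work 0 - var 0) (walkVertex (var 0)) (walkVertex (var 0 + 1)) (walkVertex 0)
        (walkVertex 1)) (stepCost (walkVertex (var 0)) (walkVertex (var 0 + 1)) (var 5) +
          dist (work 0 - var 0 - 1) (walkVertex (var 0 + 1)) (var 5) (walkVertex 0)
            (walkVertex 1)) 1 0)) 0)
    (z := fun t => if G.Adj v t ∧ t ≠ u ∧ scaledDist G c w x y (K - i) u v =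
        scaledStepCost G c w u v t + scaledDist G c w x y (K - i - 1) v t then 1 else 0) ?_
  · obtain ⟨r, hr, hr'⟩ := hfind
    rcases hr' with ⟨-, h⟩ | ⟨t, rfl, ht, -⟩
    · rw [show K - i = (K - i - 1) + 1 by omega] at hlt
      obtain ⟨t, h1, h2, h3⟩ := exists_dartDist_succ_eq hlt
      have := h t
      rw [if_pos ⟨h1, h2, by rw [show K - i = (K - i - 1) + 1 by omega]; exact h3⟩] at this
      omega
    · refine ⟨t, hr.eval 0, ?_⟩
      by_contra hne
      rw [if_neg hne] at ht
      omega
  · intro t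
    set ρ' := Function.update ρ 5 ((t : ℕ) : ℤ) with hρ'
    have d0 : Denotes n m ρ' (var 0) i := denotes_var_of_eq (by simp [hρ', hρ]) (by decide)
    have d0' : Denotes n m ρ' (var 0 + 1) ((i + 1 : ℕ) : ℤ) := by
      push_cast; exact d0.add denotes_one
    have d5 : Denotes n m ρ' (var 5) (t : ℕ) := denotes_var_of_eq (by simp [hρ']) (by decide)
    have du : Denotes n m ρ' (walkVertex (var 0)) (u : ℕ) := denotes_walkVertex d0 hu
    have dv : Denotes n m ρ' (walkVertex (var 0 + 1)) (v : ℕ) := denotes_walkVertex d0' hv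
    have dx : Denotes n m ρ' (walkVertex 0) (x : ℕ) := denotes_walkVertex (denotes_ofNat 0) hx
    have dy : Denotes n m ρ' (walkVertex 1) (y : ℕ) := denotes_walkVertex (denotes_ofNat 1) hy
    have dK : Denotes n m ρ' (work 0 - var 0) ((K - i : ℕ) : ℤ) := by
      have := (denotes_zero (n := n) (m := m) (ρ := ρ')).work.sub d0
      rw [sub_zero, hK] at this
      rwa [Nat.cast_sub hi.le]
    have dK' : Denotes n m ρ' (work 0 - var 0 - 1) ((K - i - 1 : ℕ) : ℤ) := by
      have := dK.sub denotes_one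
      rwa [Nat.cast_sub (show 1 ≤ K - i by omega), Nat.cast_one]
    refine (denotes_adj hm.1 dv d5).ite (fun h => ?_) fun h => ?_
    · have hadj : G.Adj v t := by by_contra h'; simp [h'] at h
      refine d5.ifEq du (fun h' => ?_) fun h' => ?_
      · rw [if_neg fun hc => hc.2.1 (Fin.ext (by exact_mod_cast h'))]
        exact denotes_zero
      · have hne : t ≠ u := fun hc => h' (by rw [hc])
        refine (denotes_dist hm (show K - i ≤ n by omega) dK du dv dx dy).ifEq
          ((denotes_stepCost hm.1 du dv d5).add
            (denotes_dist hm (show K - i - 1 ≤ n by omega) dK' dv d5 dx dy)) (fun h2 => ?_)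
          fun h2 => ?_
        · rw [if_pos ⟨hadj, hne, h2⟩]
          exact denotes_one
        · rw [if_neg fun hc => h2 hc.2.2]
          exact denotes_zero
    · rw [if_neg fun hc => by simp [hc.1] at h]
      exact denotes_zero

theorem denotes_update_zero_add_two (m : ℤ → ℤ) (ρ : Fin 32 → ℤ) (k : ℕ) :
    Denotes n m (Function.update ρ 0 (k : ℤ)) (var 0 + 1 + 1) ((k + 2 : ℕ) : ℤ) := by
  rw [show ((k + 2 : ℕ) : ℤ) = k + 1 + 1 by push_cast; ring]
  exact ((denotes_var_of_eq (by simp) (by decide)).add denotes_one).add denotes_one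

/-- Tracing back a walk from its first two vertices. -/
theorem run_traceBack (hm : DistStored G c w {p | p.1 ≤ n} m) {K : ℕ} {x y : Fin n}
    (hK : m (-1) = K) (hKn : K ≤ n) (hx : m (walkCell 0) = (x : ℕ))
    (hy : m (walkCell 1) = (y : ℕ)) (m' : ℤ → ℤ)
    (hm' : m' = (LoopCmd.forLoop 0 (.store (walkAddr (var 0 + 1 + 1)) (nextVertex (var 0)))).run
      n ρ m) :
    m' (-1) = K ∧ m' (walkCell 0) = (x : ℕ) ∧ m' (walkCell 1) = (y : ℕ) ∧
      ∀ i < n, TracedAt G c w K x y m' i := by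
  have := iterMem_induction (n := n) (m := m)
    (f := fun k m' => (LoopCmd.store (walkAddr (var 0 + 1 + 1)) (nextVertex (var 0))).run n
      (Function.update ρ 0 (k : ℤ)) m')
    (fun k m' => DistStored G c w {p | p.1 ≤ n} m' ∧ m' (-1) = K ∧ m' (walkCell 0) = (x : ℕ) ∧
      m' (walkCell 1) = (y : ℕ) ∧ ∀ i < k, TracedAt G c w K x y m' i)
    ⟨hm, hK, hx, hy, fun i hi => by omega⟩ ?_
  · subst hm'
    exact this.2
  · rintro k - m' ⟨h1, h2, h3, h4, h5⟩
    rw [run_store_walkAddr (denotes_update_zero_add_two m' ρ k)]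
    have hne : ∀ j, j < k + 2 → ∀ z, Function.update m' (walkCell (k + 2)) z (walkCell j) =
        m' (walkCell j) := fun j hj z =>
      Function.update_of_ne (fun h => by rw [walkCell_inj] at h; omega) _ _
    refine ⟨h1.update (walkCell_neg _) (fun _ _ _ _ _ => distCell_ne_walkCell _ _ _ _ _ _) _, ?_,
      ?_, ?_, fun i hi => ?_⟩
    · rw [Function.update_of_ne (by rw [walkCell]; omega), h2]
    · rw [hne 0 (by omega), h3]
    · rw [hne 1 (by omega), h4]
    · intro hiK u v hu hv hlt
      rw [hne i (by omega)] at hu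
      rw [hne (i + 1) (by omega)] at hv
      rcases Nat.lt_succ_iff_lt_or_eq.1 hi with hi | rfl
      · rw [hne (i + 2) (by omega)]
        exact h5 i hi hiK u v hu hv hlt
      · rw [Function.update_self]
        exact eval_nextVertex h1 h2 hKn h3 h4 hu hv hiK (by simp) hlt

/-- The output begins with the second vertex of the walk, as in `cycleWord`: the base vertex is
listed at the end. -/
theorem outputWord_eq (m : ℤ → ℤ) {K : ℕ} (hK : m (-1) = K) :
    outputWord m = (List.range K).map fun j => m (walkCell (j + 1)) := by
  rw [outputWord, hK, Int.toNat_natCast]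
  refine List.map_congr_left fun j _ => ?_
  rw [walkCell]
  push_cast
  congr 1
  ring

/-- The premises in `TracedAt` are discharged inductively along the walk: consecutive cells hold a
dart, and its remaining distance stays below the cap because step costs are nonnegative. -/
theorem isSeparationAnswer_of_traced (hb : SatisfiesBasic G c w) {K : ℕ} {x y : Fin n}
    (hmin : ∀ k, 0 < k → k < K → ∀ x y, violationMargin G c w k x y ≤ 0)
    (hK0 : 0 < K) (hKn : K ≤ n) (hviol : 0 < violationMargin G c w K x y)
    (hK : m (-1) = K) (hx : m (walkCell 0) = (x : ℕ)) (hy : m (walkCell 1) = (y : ℕ))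
    (ht : ∀ i < n, TracedAt G c w K x y m i) :
    IsSeparationAnswer G c w (outputWord m) := by
  classical
  have hL := commonDen_pos G c w
  have hcost := isStepCost_scaledStepCost G c w
  obtain ⟨hadj, hlt⟩ := violationMargin_pos_iff.1 hviol
  -- Cells beyond the end of the walk need not hold vertices; the default `x` only makes the
  -- sequence total.
  set s : ℕ → Fin n := fun j => if h : ∃ u : Fin n, m (walkCell j) = (u : ℕ) then h.choose else x
    with hs
  have hsel : ∀ j (u : Fin n), m (walkCell j) = (u : ℕ) → s j = u := by
    intro j u hu
    have hex : ∃ u : Fin n, m (walkCell j) = (u : ℕ) := ⟨u, hu⟩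
    simp only [hs, dif_pos hex]
    refine Fin.ext ?_
    exact_mod_cast hex.choose_spec.symm.trans hu
  have hs0 := hsel 0 x hx
  have hs1 := hsel 1 y hy
  have key : ∀ i ≤ K, m (walkCell i) = (s i : ℕ) ∧ m (walkCell (i + 1)) = (s (i + 1) : ℕ) ∧
      G.Adj (s i) (s (i + 1)) ∧
      scaledDist G c w x y (K - i) (s i) (s (i + 1)) < 2 * commonDen G c w := by
    intro i
    induction i with
    | zero =>
      intro _
      rw [zero_add, hs0, hs1]
      refine ⟨hx, hy, hadj, hlt.trans_le ?_⟩
      have : ((2 * K % 3 : ℕ) : ℤ) ≤ 2 := by omega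
      nlinarith
    | succ i ih =>
      intro hi
      obtain ⟨h1, h2, h3, h4⟩ := ih (by omega)
      obtain ⟨t, h5, h6, h7, h8⟩ := ht i (by omega) (by omega) _ _ h1 h2 h4
      have hst := hsel (i + 2) t h5
      rw [show i + 1 + 1 = i + 2 from rfl, hst]
      refine ⟨h2, h5, h6, ?_⟩
      have := hcost.nonneg hb hL h3 h6 h7
      rw [show K - (i + 1) = K - i - 1 by omega]
      omega
  have hans := isSeparationAnswer_of_dartDist hcost hb hL K s
    (fun k hk hkK x y hxy => by
      by_contra h
      exact absurd (violationMargin_pos_iff.2 ⟨hxy, not_le.1 h⟩) (not_lt.2 (hmin k hk hkK x y)))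
    hK0 (by rw [hs0, hs1]; exact hadj) (by rw [hs0, hs1]; exact hlt)
    (fun i hi hd => by
      rw [hs0, hs1] at hd ⊢
      obtain ⟨h1, h2, -, -⟩ := key i hi.le
      obtain ⟨t, h5, h6, h7, h8⟩ := ht i (by omega) hi _ _ h1 h2 hd
      rw [hsel (i + 2) t h5]
      exact ⟨h6, h7, h8⟩)
  rw [outputWord_eq m hK]
  have : (List.range K).map (fun j => m (walkCell (j + 1))) =
      (List.range K).map fun i => ((s (i + 1) : ℕ) : ℤ) :=
    List.map_congr_left fun j hj => (key j (List.mem_range.1 hj).le).2.1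
  rwa [this]

/-- The memory is followed through the successive stores. Each leaves the distance table intact, and
only the first one writes to cell `-1`, which holds the length. -/
theorem run_separate (hb : SatisfiesBasic G c w) (hm : HoldsInstance G c w m) :
    LoopCmd.separate.run n ρ m (-1) ≤ n ∧
      IsSeparationAnswer G c w (outputWord (LoopCmd.separate.run n ρ m)) := by
  have hd := distStored_table hm ρ
  rw [LoopCmd.separate, LoopCmd.run]
  generalize (LoopCmd.seq (.forDarts .initDist) (.forLoop 0 (.forDarts .updateDist))).run n ρ m
    = m₀ at *
  obtain ⟨K, hK, hKn, hmin, hzero, hpos⟩ := exists_denotes_bestLength (ρ := ρ) hd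
  rw [LoopCmd.run, LoopCmd.run, denotes_zero.eval, if_pos le_rfl, hK.eval, sub_zero]
  replace hd := hd.update (z := -1) (by norm_num) (fun _ _ _ _ _ => distCell_ne_neg_one _ _ _ _ _) K
  have hm1 : Function.update m₀ (-1) (K : ℤ) (-1) = K := Function.update_self ..
  generalize Function.update m₀ (-1) (K : ℤ) = m₁ at *
  have hwork : ∀ {m' : ℤ → ℤ} (ρ' : Fin 32 → ℤ), m' (-1) = K → Denotes n m' ρ' (work 0) K :=
    fun ρ' h => by
      rw [← h]
      exact (denotes_zero (ρ := ρ')).work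
  rw [LoopCmd.run, run_store_walkAddr (j := 0) denotes_zero]
  have hne : ∀ j, (-1 : ℤ) ≠ walkCell j := fun j => by rw [walkCell]; omega
  obtain ⟨r, hr, hr'⟩ := exists_denotes_findPair (ρ := ρ) hd hKn fun x y => hwork _ hm1
  rw [hr.eval]
  replace hd := hd.update (walkCell_neg 0) (fun _ _ _ _ _ => distCell_ne_walkCell _ _ _ _ _ _) r
  have hm2 : Function.update m₁ (walkCell 0) r (-1) = K := by
    rw [Function.update_of_ne (hne _), hm1]
  have hx2 : Function.update m₁ (walkCell 0) r (walkCell 0) = r := Function.update_self ..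
  generalize Function.update m₁ (walkCell 0) r = m₂ at *
  rw [LoopCmd.run, run_store_walkAddr (j := 1) denotes_one]
  -- The value is known to be a vertex only when a violated length exists, so it stays abstract
  -- until the case distinction.
  set z := (find 2 (violated (work 0) (walkVertex 0) (var 2))).eval n m₂ ρ 0 with hz
  have hd3 := hd.update (walkCell_neg 1) (fun _ _ _ _ _ => distCell_ne_walkCell _ _ _ _ _ _) z
  have hm3 : Function.update m₂ (walkCell 1) z (-1) = K := by
    rw [Function.update_of_ne (hne _), hm2]
  have hx3 : Function.update m₂ (walkCell 1) z (walkCell 0) = r := by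
    rw [Function.update_of_ne (by simp [walkCell_inj]), hx2]
  have hy3 : Function.update m₂ (walkCell 1) z (walkCell 1) = z := Function.update_self ..
  generalize Function.update m₂ (walkCell 1) z = m₃ at *
  rcases Nat.eq_zero_or_pos K with rfl | hK0
  -- Without a violated length the trace stores irrelevant values, but never in cell `-1`, so the
  -- output is empty.
  · have h0 : (LoopCmd.forLoop 0 (.store (walkAddr (var 0 + 1 + 1)) (nextVertex (var 0)))).run
        n ρ m₃ (-1) = (0 : ℕ) := by
      refine iterMem_induction (n := n) (m := m₃) (f := fun k m' =>
        (LoopCmd.store (walkAddr (var 0 + 1 + 1)) (nextVertex (var 0))).run n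
          (Function.update ρ 0 (k : ℤ)) m') (fun _ m' => m' (-1) = (0 : ℕ)) hm3 fun k _ m' hm' => ?_
      rw [run_store_walkAddr (denotes_update_zero_add_two m' ρ k),
        Function.update_of_ne (hne _), hm']
    refine ⟨by rw [h0]; positivity, ?_⟩
    rw [outputWord_eq _ h0]
    exact isSeparationAnswer_nil_of_dartDist (isStepCost_scaledStepCost G c w)
      (commonDen_pos G c w) fun k hk hkn x y hxy => by
        by_contra h
        exact absurd (violationMargin_pos_iff.2 ⟨hxy, not_le.1 h⟩)
          (not_lt.2 (hzero rfl k hk hkn x y))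
  · obtain ⟨x, rfl, hxy⟩ : ∃ x : Fin n, r = (x : ℕ) ∧ ∃ y, 0 < violationMargin G c w K x y := by
      rcases hr' with ⟨-, h⟩ | h
      · obtain ⟨x, y, hxy⟩ := hpos hK0
        exact absurd hxy (not_lt.2 (h x y))
      · exact h
    obtain ⟨r', hr2, hr2'⟩ := exists_denotes_find_fin (n := n) (m := m₂) (ρ := ρ) (i := 2)
      (cond := violated (work 0) (walkVertex 0) (var 2)) fun y =>
        denotes_violated hd hKn (hwork _ hm2) (denotes_walkVertex (denotes_ofNat 0) hx2)
          (denotes_var_of_eq (z := (y : ℕ)) (by simp) (by decide))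
    rw [hr2.eval] at hz
    obtain ⟨y, hy, hviol⟩ : ∃ y : Fin n, r' = (y : ℕ) ∧ 0 < violationMargin G c w K x y := by
      rcases hr2' with ⟨-, h⟩ | ⟨y, h1, h2, -⟩
      · obtain ⟨y, hy⟩ := hxy
        exact absurd hy (not_lt.2 (h y))
      · exact ⟨y, h1, h2⟩
    obtain ⟨h1, h2, h3, h4⟩ := run_traceBack (ρ := ρ) hd3 hm3 hKn hx3 (hy3.trans (hz.trans hy)) _ rfl
    exact ⟨by rw [h1]; exact_mod_cast hKn,
      isSeparationAnswer_of_traced hb hmin hK0 hKn hviol h1 h2 h3 h4⟩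

end Search

theorem mainTheorem9 :
    ∃ (P : RamProgram) (q : Polynomial ℕ),
      ∀ (n : ℕ) (G : SimpleGraph (Fin n)) (c : Fin n → ℚ) (w : Sym2 (Fin n) → ℚ),
        SatisfiesBasic G c w →
          ∃ (out : List ℤ) (t : ℕ),
            RamComputes P (encodeInstance G c w) out t ∧
            t ≤ q.eval (wordSize (encodeInstance G c w)) ∧
            IsSeparationAnswer G c w out := by
  obtain ⟨P, q, h⟩ := LoopCmd.separate.exists_ramProgram
  refine ⟨P, q, fun n G c w hb => ?_⟩
  obtain ⟨h1, h2⟩ := run_separate (ρ := fun _ => 0) hb (holdsInstance_ramInput G c w)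
  obtain ⟨t, ht, hc⟩ := h (encodeInstance G c w) n (by simp [encodeInstance])
    (by simp [encodeInstance, List.length_flatMap]; omega) h1
  exact ⟨_, t, hc, ht, h2⟩
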